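/- A fundamental discriminant is an integer $D$ such that either $D\equiv 1 \pmod 4$ and $D$ is square-free, or $D=4m$ with $m\equiv 2$ or $3\pmod 4$ and $m$ square-free; $\chi_D=\left(\frac{D}{\cdot}\right)$ denotes the associated real primitive Dirichlet character (Kronecker symbol), and $\mathcal F(x)$ is the set of fundamental discriminants $D$ with $|D|\le x$. Let $\{\mathbb X(p)\}_p$ be independent random variables indexed by the primes, with $\mathbb P(\mathbb X(p)=1)=\mathbb P(\mathbb X(p)=-1)=\frac{p}{2(p+1)}$ and $\mathbb P(\mathbb X(p)=0)=\frac1{p+1}$. For $\mathbf s,\mathbf u,\mathbf v\in\mathbb R^J$ and a function $f$ on the primes put $$L_{\mathbf u,\mathbf v}(\mathbf s,f)=\Big(\sum_{u_j<p<v_j}\frac{f(p)\log p}{p^{s_j}}\Big)_{1\le j\le J}\in\mathbb R^J,$$ and define the discrepancy $$D_{\mathbf u,\mathbf v}(\mathbf s)=\sup_{\mathcal R}\left|\frac{1}{|\mathcal F(x)|}\big|\{D\in\mathcal F(x): L_{\mathbf u,\mathbf v}(\mathbf s,\chi_D)\in\mathcal R\}\big|-\mathbb P\big(L_{\mathbf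 u,\mathbf v}(\mathbf s,\mathbb X)\in\mathcal R\big)\right|,$$ where the supremum is over all (possibly unbounded) rectangular boxes $\mathcal R\subset\mathbb R^J$ with sides parallel to the coordinate axes. **Theorem.** There is an absolute constant $C>0$ with the following property. For each real $x$ let $J=J(x)$ be a nonnegative integer and let $s_j=s_j(x)$, $u_j=u_j(x)$, $v_j=v_j(x)$ $(1\le j\le J)$ be real numbers. Suppose that, for all sufficiently large $x$ and all $1\le j\le J$, $$1\le J\le(\log\log x)^2,\qquad (\log x)^{-1/5}\le s_j-\tfrac12\le(\log\log x)^{-2},\qquad \log x\le u_j<v_j<\exp\big((\log x)^{1/5}\big),$$ and that, as $x\to\infty$, uniformly in $1\le j\le J$, $$(\log u_j)(s_j-\tfrac12)\to0\qquad\text{and}\qquad(\log v_j)(s_j-\tfrac12)\to\infty.$$ Then for all sufficiently large $x$ (the threshold may depend on the given families) $$D_{\mathbf u,\mathbf v}(\mathbf s)\le \frac{C\,J}{(\log x)^{1/10}}.$$ -/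

import Mathlib

open Filter MeasureTheory

/-- `D` is a fundamental discriminant: `D ≡ 1 (mod 4)` and `D` is square-free, or `D = 4m` with
`m ≡ 2, 3 (mod 4)` square-free. -/
def IsFundamentalDiscriminant (D : ℤ) : Prop :=
  (D % 4 = 1 ∧ Squarefree D) ∨
    ∃ m : ℤ, D = 4 * m ∧ (m % 4 = 2 ∨ m % 4 = 3) ∧ Squarefree m

open Classical in
/-- The finite set `𝓕(x)` of fundamental discriminants `D` (of either sign) with `|D| ≤ x`. -/
noncomputable def fundamentalDiscriminants (x : ℝ) : Finset ℤ :=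
  (Finset.Icc (-⌊x⌋) ⌊x⌋).filter IsFundamentalDiscriminant

theorem mem_fundamentalDiscriminants {x : ℝ} {D : ℤ} :
    D ∈ fundamentalDiscriminants x ↔ IsFundamentalDiscriminant D ∧ |(D : ℝ)| ≤ x := by
  have h : -⌊x⌋ ≤ D ↔ -D ≤ ⌊x⌋ := by omega
  simp only [fundamentalDiscriminants, Finset.mem_filter, Finset.mem_Icc, h, Int.le_floor,
    abs_le']
  push_cast
  tauto

/-- The real primitive Dirichlet character `χ_D` attached to a fundamental discriminant `D`, as the
Kronecker symbol `n ↦ (D / n)` on the natural numbers. For `n = 2 ^ a * m` with `m` odd it is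
`(D / 2) ^ a * (D / m)`, where `(D / m)` is the Jacobi symbol and `(D / 2) = χ₈(D)`, i.e. `0` for
even `D`, `1` for `D ≡ ±1 (mod 8)` and `-1` for `D ≡ ±3 (mod 8)`. -/
def kroneckerChar (D : ℤ) (n : ℕ) : ℤ :=
  if n = 0 then (if D.natAbs = 1 then 1 else 0)
  else ZMod.χ₈ (D : ZMod 8) ^ padicValNat 2 n * jacobiSym D (n / 2 ^ padicValNat 2 n)

/-- The finite set of primes `p` with `y < p < z`. -/
noncomputable def primesBetween (y z : ℝ) : Finset Nat.Primes :=
  ((Finset.range ⌈z⌉₊).filter (fun n : ℕ => y < (n : ℝ))).subtype Nat.Prime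

theorem mem_primesBetween {y z : ℝ} {p : Nat.Primes} :
    p ∈ primesBetween y z ↔ y < ((p : ℕ) : ℝ) ∧ ((p : ℕ) : ℝ) < z := by
  refine Finset.mem_subtype.trans ?_
  rw [Finset.mem_filter, Finset.mem_range, Nat.lt_ceil]
  exact and_comm

/-- The prime sum `∑_{y < p < z} f(p) (log p) / p ^ s` for a function `f` on the primes. -/
noncomputable def primeSum (y z s : ℝ) (f : Nat.Primes → ℝ) : ℝ :=
  ∑ p ∈ primesBetween y z, f p * Real.log ((p : ℕ) : ℝ) / ((p : ℕ) : ℝ) ^ s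

/-- The vector `(∑_{u_j < p < v_j} f(p) (log p) / p ^ {s_j})_j`. -/
noncomputable def primeSumVec {J : ℕ} (s u v : Fin J → ℝ) (f : Nat.Primes → ℝ) : Fin J → ℝ :=
  fun j => primeSum (u j) (v j) (s j) f

/-- The values of `χ_D` at the primes, as real numbers. -/
def charValues (D : ℤ) : Nat.Primes → ℝ := fun p => (kroneckerChar D (p : ℕ) : ℝ)

/-- The law of `𝕏(p)`: the values `1` and `-1` are taken with probability `p / (2(p+1))` each, and
the value `0` with probability `1 / (p+1)`. -/
noncomputable def primeLaw (p : Nat.Primes) : Measure ℝ :=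
  ENNReal.ofReal (((p : ℕ) : ℝ) / (2 * (((p : ℕ) : ℝ) + 1))) • Measure.dirac 1 +
    ENNReal.ofReal (((p : ℕ) : ℝ) / (2 * (((p : ℕ) : ℝ) + 1))) • Measure.dirac (-1) +
    ENNReal.ofReal (1 / (((p : ℕ) : ℝ) + 1)) • Measure.dirac 0

instance primeLaw_isProbabilityMeasure (p : Nat.Primes) : IsProbabilityMeasure (primeLaw p) := by
  constructor
  have hp : (0 : ℝ) ≤ ((p : ℕ) : ℝ) := Nat.cast_nonneg _
  simp only [primeLaw, Measure.add_apply, Measure.smul_apply, measure_univ, smul_eq_mul, mul_one]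
  rw [← ENNReal.ofReal_add (by positivity) (by positivity),
    ← ENNReal.ofReal_add (by positivity) (by positivity), ← ENNReal.ofReal_one]
  congr 1
  field_simp
  ring

/-- The joint law of the independent random variables `(𝕏(p))_p`: the product of the laws of the
`𝕏(p)` over all primes, on the space of all functions `Nat.Primes → ℝ`. The variable `𝕏(p)` is the
coordinate `ω ↦ ω p`. -/
noncomputable def randomModel : Measure (Nat.Primes → ℝ) := Measure.infinitePi primeLaw

/-- A (possibly unbounded) rectangular box with sides parallel to the coordinate axes: a product of
arbitrary intervals (open, closed or half-open, bounded or not), i.e. of order-connected sets. -/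
def IsBox {J : ℕ} (R : Set (Fin J → ℝ)) : Prop :=
  ∃ I : Fin J → Set ℝ, (∀ j, (I j).OrdConnected) ∧ R = Set.univ.pi I

open Classical in
/-- The proportion of `D ∈ 𝓕(x)` for which the vector of prime sums of `χ_D` lies in `R`. -/
noncomputable def charProportion (x : ℝ) {J : ℕ} (s u v : Fin J → ℝ) (R : Set (Fin J → ℝ)) : ℝ :=
  (((fundamentalDiscriminants x).filter
      (fun D => primeSumVec s u v (charValues D) ∈ R)).card : ℝ) /
    ((fundamentalDiscriminants x).card : ℝ)

/-- The probability that the random vector of prime sums of `𝕏` lies in `R`. -/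
noncomputable def randomProb {J : ℕ} (s u v : Fin J → ℝ) (R : Set (Fin J → ℝ)) : ℝ :=
  randomModel.real {ω | primeSumVec s u v ω ∈ R}

/-- The discrepancy: the supremum over all boxes `R` of the distance between the proportion of
`D ∈ 𝓕(x)` and the probability in the random model. -/
noncomputable def discrepancy (x : ℝ) {J : ℕ} (s u v : Fin J → ℝ) : ℝ :=
  ⨆ R : {R : Set (Fin J → ℝ) // IsBox R},
    |charProportion x s u v (R : Set (Fin J → ℝ)) - randomProb s u v (R : Set (Fin J → ℝ))|

open Classical in
/-- The supremum in `discrepancy` is that of a bounded family. -/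
theorem discrepancy_bddAbove (x : ℝ) {J : ℕ} (s u v : Fin J → ℝ) :
    BddAbove (Set.range fun R : {R : Set (Fin J → ℝ) // IsBox R} =>
      |charProportion x s u v (R : Set (Fin J → ℝ)) -
        randomProb s u v (R : Set (Fin J → ℝ))|) := by
  refine ⟨1, ?_⟩
  rintro _ ⟨R, rfl⟩
  have : IsProbabilityMeasure randomModel := by unfold randomModel; infer_instance
  have h1 : 0 ≤ charProportion x s u v (R : Set (Fin J → ℝ)) := by
    unfold charProportion; positivity
  have h2 : charProportion x s u v (R : Set (Fin J → ℝ)) ≤ 1 := by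
    unfold charProportion
    refine div_le_one_of_le₀ ?_ (by positivity)
    exact Nat.cast_le.mpr (Finset.card_le_card (Finset.filter_subset _ _))
  have h3 : 0 ≤ randomProb s u v (R : Set (Fin J → ℝ)) := measureReal_nonneg
  have h4 : randomProb s u v (R : Set (Fin J → ℝ)) ≤ 1 := measureReal_le_one
  rw [abs_le]
  constructor <;> linarith

/-! Write w = (log x)^{1/10}, so that the goal is a discrepancy O(J/w). The proof compares moments,
then characteristic functions, then boxes.

Moments. For odd n, the mean of (D/n) over 𝓕(x) is ∏_{p ∣ n} p/(p+1) if n is a square and 0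
otherwise, up to O(n/√x) (`exists_abs_discriminantSum_div_sub_le`): square-freeness is detected by
μ(d) over d² ∣ m, and complete sums of a non-principal symbol vanish. This main term is exactly the
expectation of ∏ 𝕏(q_i) when n = ∏ q_i (`integral_prod_eval_randomModel`). The primes in the sums
exceed log x, hence are odd.

Characteristic functions. Expand e^{iY}, with Y a linear combination of the J prime sums, to order
2K with K about w^5 (`norm_integral_exp_linForm_sub_le`). As all primes are below e^{w²}, replacing
moments costs e^{O(w^7)}/√x, and √x = e^{w^10/2}. The Taylor remainder is controlled by the 2K-th
moment in the random model, which is sub-Gaussian, and is at most e^{O(w^4) - 2K}. The two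
characteristic functions therefore differ by at most 5e^{-w^5} (`charFun_error_le`).

Boxes. The sums are rescaled into [-π/2, π/2]. The indicator of an interval is replaced by a
trigonometric sum of degree at most 2N with values in [0, 1], and the error is dominated by a
positive kernel centred at the endpoints (`exists_isTrigSum_near_indicator`). The mean of that
kernel is at most 1/N times the sum of the absolute values of the characteristic function at the
frequencies |m| ≤ N. In the random model these decay like a Gaussian of width N/w, which gives
O(1/w) for each coordinate and O(J/w) in total. Multiplying J trigonometric sums costs a factor
(32N)^J = e^{O(w³)}, which e^{-w^5} absorbs.

Gaussian decay needs two inputs: each sum has variance at least 1, thanks to the primes near e^{1/σ}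
with σ = s_j - 1/2 (`exists_one_le_primeVariance`), and each coefficient (log p)/p^{s_j} is at most
1/w, since p > w^10 (`mul_primeCoeff_le_one`). The rescaling divides by the standard deviation, so
no upper bound for the variance enters. -/

/-! ### Complete sums of Jacobi symbols -/

/-- The sum of the Jacobi symbol over a complete residue system. -/
def jacobiTotal (n : ℕ) : ℤ := ∑ a ∈ Finset.range n, jacobiSym (a : ℤ) n

theorem jacobiTotal_of_isSquare {n : ℕ} (hn : 0 < n) (h : IsSquare n) :
    jacobiTotal n = (n.totient : ℤ) := by
  obtain ⟨k, rfl⟩ := h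
  have hk : NeZero k := ⟨by rintro rfl; simp at hn⟩
  rw [Nat.totient_eq_card_coprime, jacobiTotal, Finset.card_filter]
  push_cast
  refine Finset.sum_congr rfl fun a _ => ?_
  rw [jacobiSym.mul_right]
  split_ifs with hc
  · have : Int.gcd (a : ℤ) k = 1 := by
      rw [Int.gcd_natCast_natCast]
      exact (Nat.Coprime.coprime_dvd_left (Dvd.intro _ rfl) hc).symm
    rw [← sq, jacobiSym.sq_one this]
  · have : jacobiSym (a : ℤ) k = 0 := by
      rw [jacobiSym.eq_zero_iff_not_coprime]
      intro h
      rw [Int.gcd_natCast_natCast] at h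
      exact hc (Nat.Coprime.mul_left (Nat.Coprime.symm h) (Nat.Coprime.symm h))
    rw [this, zero_mul]

theorem exists_odd_factorization {n : ℕ} (hn0 : n ≠ 0) (h : ¬ IsSquare n) :
    ∃ p, p.Prime ∧ Odd (n.factorization p) := by
  by_contra hcon
  push Not at hcon
  apply h
  refine ⟨n.factorization.prod fun p e => p ^ (e / 2), ?_⟩
  rw [← Finsupp.prod_mul]
  conv_lhs => rw [← Nat.prod_factorization_pow_eq_self hn0]
  refine Finsupp.prod_congr fun p hp => ?_
  have hpp : p.Prime := Nat.prime_of_mem_primeFactors hp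
  obtain ⟨r, hr⟩ := Nat.not_odd_iff_even.1 (hcon p hpp)
  rw [hr, ← pow_add]
  congr 1
  omega

/-- Choose a prime p dividing n to an odd power e. By the Chinese remainder theorem some b is a
non-residue modulo p and 1 modulo n/p^e; the symbol is then (-1)^e. -/
theorem exists_jacobiSym_eq_neg_one {n : ℕ} (hn : Odd n) (h : ¬ IsSquare n) :
    ∃ b : ℕ, jacobiSym (b : ℤ) n = -1 := by
  have hn0 : n ≠ 0 := by rintro rfl; simp at hn
  obtain ⟨p, hp, hodd⟩ := exists_odd_factorization hn0 h
  have : Fact p.Prime := ⟨hp⟩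
  set e := n.factorization p
  set n' := n / p ^ e with hn'
  have hnn : p ^ e * n' = n := Nat.ordProj_mul_ordCompl_eq_self n p
  have hcop : Nat.Coprime (p ^ e) n' := (Nat.coprime_ordCompl hp hn0).pow_left e
  have hp2 : p ≠ 2 := by
    rintro rfl
    have he : e ≠ 0 := by rintro h0; rw [h0] at hodd; simp at hodd
    have : 2 ∣ n := (dvd_pow_self 2 he).trans (hnn ▸ Dvd.intro _ rfl)
    exact (Nat.not_even_iff_odd.2 hn) (even_iff_two_dvd.2 this)
  obtain ⟨z, hz⟩ := FiniteField.exists_nonsquare (F := ZMod p) (by rwa [ZMod.ringChar_zmod_n])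
  obtain ⟨b, hb1, hb2⟩ := Nat.chineseRemainder hcop z.val 1
  refine ⟨b, ?_⟩
  have hn'0 : n' ≠ 0 := by rintro h0; rw [h0, mul_zero] at hnn; exact hn0 hnn.symm
  have he : e ≠ 0 := by rintro h0; rw [h0] at hodd; simp at hodd
  rw [← hnn, jacobiSym.mul_right' _ (pow_ne_zero _ hp.ne_zero) hn'0, jacobiSym.pow_right]
  have h1 : jacobiSym (b : ℤ) p = -1 := by
    rw [← jacobiSym.legendreSym.to_jacobiSym, legendreSym.eq_neg_one_iff]
    have : (b : ZMod p) = z := by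
      have hm := (hb1.of_dvd (dvd_pow_self p he))
      rw [(ZMod.natCast_eq_natCast_iff b z.val p).2 hm, ZMod.natCast_zmod_val]
    push_cast
    rwa [this]
  have h2 : jacobiSym (b : ℤ) n' = 1 := by
    rw [jacobiSym.mod_left' (a₂ := 1), jacobiSym.one_left]
    exact (Int.natCast_modEq_iff.2 hb2)
  rw [h1, h2, hodd.neg_one_pow, mul_one]

/-- Orthogonality: multiplication by a b with (b/n) = -1 permutes the residues modulo n and changes
the sign of the sum. -/
theorem jacobiTotal_of_not_isSquare {n : ℕ} (hn : Odd n) (h : ¬ IsSquare n) :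
    jacobiTotal n = 0 := by
  obtain ⟨b, hb⟩ := exists_jacobiSym_eq_neg_one hn h
  have hn0 : 0 < n := hn.pos
  have : NeZero n := ⟨hn0.ne'⟩
  have hcop : Nat.Coprime n b := by
    by_contra hc
    have : jacobiSym (b : ℤ) n = 0 := by
      rw [jacobiSym.eq_zero_iff_not_coprime, Int.gcd_natCast_natCast]
      exact fun h => hc (Nat.Coprime.symm h)
    rw [this] at hb; norm_num at hb
  have key : ∑ a ∈ Finset.range n, jacobiSym (((b * a) % n : ℕ) : ℤ) n = jacobiTotal n := by
    have himg : (Finset.range n).image (fun a => (b * a) % n) = Finset.range n := by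
      apply Finset.eq_of_subset_of_card_le
      · intro x hx
        simp only [Finset.mem_image] at hx
        obtain ⟨a, _, rfl⟩ := hx
        exact Finset.mem_range.2 (Nat.mod_lt _ hn0)
      · rw [Finset.card_image_of_injOn]
        intro x hx y hy hxy
        have : x ≡ y [MOD n] := Nat.ModEq.cancel_left_of_coprime hcop hxy
        exact this.eq_of_lt_of_lt (Finset.mem_range.1 hx) (Finset.mem_range.1 hy)
    conv_rhs => rw [jacobiTotal, ← himg]
    rw [Finset.sum_image]
    intro x hx y hy hxy
    have : x ≡ y [MOD n] := Nat.ModEq.cancel_left_of_coprime hcop hxy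
    exact this.eq_of_lt_of_lt (Finset.mem_range.1 hx) (Finset.mem_range.1 hy)
  have key2 : ∑ a ∈ Finset.range n, jacobiSym (((b * a) % n : ℕ) : ℤ) n = - jacobiTotal n := by
    rw [jacobiTotal, ← Finset.sum_neg_distrib]
    refine Finset.sum_congr rfl fun a _ => ?_
    push_cast
    rw [← jacobiSym.mod_left, jacobiSym.mul_left, hb, neg_one_mul]
  linarith

/-- Since 4 and n are coprime, reduction modulo n maps the class of a modulo 4 inside `range (4 *
n)` bijectively onto the residues modulo n. -/
theorem sum_range_four_mul_jacobiSym {n : ℕ} (hn : Odd n) {a : ℕ} (ha : a < 4) :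
    ∑ r ∈ (Finset.range (4 * n)).filter (fun r => r % 4 = a), jacobiSym (r : ℤ) n =
      jacobiTotal n := by
  have hn0 : 0 < n := hn.pos
  have hcop : Nat.Coprime 4 n := by
    have : Nat.Coprime (2 ^ 2) n := (Nat.coprime_two_left.2 hn).pow_left 2
    simpa using this
  refine Finset.sum_bij (fun r _ => r % n) ?_ ?_ ?_ ?_
  · intro r _; exact Finset.mem_range.2 (Nat.mod_lt _ hn0)
  · intro x hx y hy hxy
    simp only [Finset.mem_filter, Finset.mem_range] at hx hy
    have : x ≡ y [MOD 4 * n] :=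
      (Nat.modEq_and_modEq_iff_modEq_mul hcop).1 ⟨hx.2.trans hy.2.symm, hxy⟩
    exact this.eq_of_lt_of_lt hx.1 hy.1
  · intro b hb
    have hb := Finset.mem_range.1 hb
    obtain ⟨z, hz1, hz2⟩ := Nat.chineseRemainder hcop a b
    refine ⟨z % (4 * n), ?_, ?_⟩
    · simp only [Finset.mem_filter, Finset.mem_range]
      refine ⟨Nat.mod_lt _ (by omega), ?_⟩
      rw [Nat.mod_mul_right_mod]
      exact Eq.trans hz1 (Nat.mod_eq_of_lt ha)
    · rw [Nat.mod_mul_left_mod]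
      exact Eq.trans hz2 (Nat.mod_eq_of_lt hb)
  · intro r _
    push_cast
    rw [← jacobiSym.mod_left]

/-! ### Sums of periodic functions over long intervals -/

/-- One unit of the error comes from the two floors in the exact count, the other from replacing the
length 2⌊Y⌋ + 1 by 2Y. -/
theorem abs_card_modEq_sub_le {Y : ℝ} (hY : 0 ≤ Y) {q : ℕ} (hq : 0 < q) (r : ℤ) :
    |(((Finset.Icc (-⌊Y⌋) ⌊Y⌋).filter (fun l => l ≡ r [ZMOD q])).card : ℝ) - 2 * Y / q| ≤ 2 := by
  have hF : (0 : ℤ) ≤ ⌊Y⌋ := Int.floor_nonneg.2 hY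
  have hIcc : Finset.Icc (-⌊Y⌋) ⌊Y⌋ = Finset.Ioc (-⌊Y⌋ - 1) ⌊Y⌋ := by
    ext l; simp only [Finset.mem_Icc, Finset.mem_Ioc]; omega
  have hqz : (0 : ℤ) < q := by exact_mod_cast hq
  have hc := Int.Ioc_filter_modEq_card (-⌊Y⌋ - 1) ⌊Y⌋ hqz r
  rw [hIcc]
  have hcr : (((Finset.Ioc (-⌊Y⌋ - 1) ⌊Y⌋).filter (fun l => l ≡ r [ZMOD q])).card : ℝ) =
      max ((⌊((⌊Y⌋ : ℚ) - r) / (q : ℚ)⌋ : ℝ) - ⌊((-(⌊Y⌋ : ℚ) - 1) - r) / (q : ℚ)⌋) 0 := by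
    have := congrArg (fun z : ℤ => (z : ℝ)) hc
    push_cast at this
    exact this
  rw [hcr]
  have hqr : (1 : ℝ) ≤ q := by exact_mod_cast hq
  have toR : ∀ t : ℚ, ((⌊t⌋ : ℤ) : ℝ) ≤ (t : ℝ) ∧ (t : ℝ) < ⌊t⌋ + 1 := by
    intro t
    constructor
    · exact_mod_cast Int.floor_le t
    · exact_mod_cast Int.lt_floor_add_one t
  obtain ⟨h1, h2⟩ := toR (((⌊Y⌋ : ℚ) - r) / (q : ℚ))
  obtain ⟨h3, h4⟩ := toR (((-(⌊Y⌋ : ℚ) - 1) - r) / (q : ℚ))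
  set A : ℝ := ((⌊((⌊Y⌋ : ℚ) - r) / (q : ℚ)⌋ : ℤ) : ℝ)
  set B : ℝ := ((⌊((-(⌊Y⌋ : ℚ) - 1) - r) / (q : ℚ)⌋ : ℤ) : ℝ)
  push_cast at h1 h2 h3 h4
  have hf1 := Int.floor_le Y
  have hf2 := Int.lt_floor_add_one Y
  have hd : ((⌊Y⌋ : ℝ) - r) / q - ((-(⌊Y⌋ : ℝ) - 1) - r) / q = (2 * ⌊Y⌋ + 1) / q := by ring
  have hd2 : |(2 * (⌊Y⌋ : ℝ) + 1) / q - 2 * Y / q| ≤ 1 := by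
    rw [← sub_div, abs_div, abs_of_pos (by linarith : (0 : ℝ) < q), div_le_one (by linarith)]
    refine le_trans ?_ hqr
    rw [abs_le]; constructor <;> linarith
  have hpos : 0 ≤ 2 * Y / q := by positivity
  rw [abs_le] at hd2 ⊢
  rcases max_cases (A - B) 0 with ⟨h, _⟩ | ⟨h, _⟩ <;> rw [h] <;> constructor <;> linarith

theorem abs_sum_periodic_sub_le {f : ℤ → ℝ} {q : ℕ} (hq : 0 < q)
    (hf : ∀ l r : ℤ, l ≡ r [ZMOD q] → f l = f r) (hf1 : ∀ l, |f l| ≤ 1) {Y : ℝ} (hY : 0 ≤ Y) :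
    |∑ l ∈ Finset.Icc (-⌊Y⌋) ⌊Y⌋, f l - 2 * Y / q * ∑ r ∈ Finset.range q, f r| ≤ 2 * q := by
  have hqz : (0 : ℤ) < q := by exact_mod_cast hq
  have hsplit : ∑ l ∈ Finset.Icc (-⌊Y⌋) ⌊Y⌋, f l = ∑ r ∈ Finset.range q,
      (((Finset.Icc (-⌊Y⌋) ⌊Y⌋).filter (fun l => l ≡ (r : ℤ) [ZMOD q])).card : ℝ) * f r := by
    rw [← Finset.sum_fiberwise_of_maps_to (s := Finset.Icc (-⌊Y⌋) ⌊Y⌋) (t := Finset.range q)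
      (g := fun l : ℤ => (l % q).toNat)]
    · refine Finset.sum_congr rfl fun r hr => ?_
      have hr := Finset.mem_range.1 hr
      rw [← nsmul_eq_mul, ← Finset.sum_const]
      have : ∀ l : ℤ, (l % q).toNat = r ↔ l ≡ (r : ℤ) [ZMOD q] := by
        intro l
        have h0 := Int.emod_nonneg l hqz.ne'
        rw [Int.ModEq, Int.emod_eq_of_lt (a := (r : ℤ)) (by omega) (by exact_mod_cast hr)]
        omega
      simp only [this]
      refine Finset.sum_congr rfl fun l hl => ?_
      exact hf _ _ (Finset.mem_filter.1 hl).2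
    · intro l _
      have h0 := Int.emod_nonneg l hqz.ne'
      have h1 := Int.emod_lt_of_pos l hqz
      simp only [Finset.mem_range]
      omega
  rw [hsplit, Finset.mul_sum, ← Finset.sum_sub_distrib]
  refine (Finset.abs_sum_le_sum_abs _ _).trans ?_
  refine (Finset.sum_le_card_nsmul _ _ 2 fun r _ => ?_).trans (by simp [mul_comm])
  rw [← sub_mul, abs_mul]
  calc _ ≤ (2 : ℝ) * 1 := mul_le_mul (abs_card_modEq_sub_le hY hq r) (hf1 _) (abs_nonneg _)
        (by norm_num)
    _ = 2 := by norm_num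

theorem abs_jacobiSym_le_one (a : ℤ) (n : ℕ) : |((jacobiSym a n : ℤ) : ℝ)| ≤ 1 := by
  rcases jacobiSym.trichotomy a n with h | h | h <;> simp [h]

theorem abs_sum_jacobiSym_sub_le {n : ℕ} (hn : Odd n) {a : ℕ} (ha : a < 4) {Y : ℝ} (hY : 0 ≤ Y) :
    |∑ l ∈ (Finset.Icc (-⌊Y⌋) ⌊Y⌋).filter (fun l : ℤ => l % 4 = a), ((jacobiSym l n : ℤ) : ℝ) -
      Y / 2 * (jacobiTotal n / n)| ≤ 8 * n := by
  have hn0 : 0 < n := hn.pos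
  have h := abs_sum_periodic_sub_le (f := fun l => if l % 4 = a then ((jacobiSym l n : ℤ) : ℝ) else 0)
    (q := 4 * n) (by omega) ?_ ?_ hY
  · have h2 : ∑ r ∈ Finset.range (4 * n),
        (if (r : ℤ) % 4 = a then ((jacobiSym r n : ℤ) : ℝ) else 0) = jacobiTotal n := by
      rw [← sum_range_four_mul_jacobiSym hn ha, Finset.sum_filter]
      push_cast
      refine Finset.sum_congr rfl fun r _ => ?_
      have : (r : ℤ) % 4 = a ↔ r % 4 = a := by omega
      simp only [this]
    rw [h2] at h
    rw [Finset.sum_filter]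
    have hnr : (n : ℝ) ≠ 0 := by exact_mod_cast hn0.ne'
    have e1 : Y / 2 * ((jacobiTotal n : ℝ) / n) = 2 * Y / ((4 * n : ℕ) : ℝ) * jacobiTotal n := by
      push_cast
      field_simp
      ring
    rw [e1]
    refine h.trans (le_of_eq ?_)
    push_cast; ring
  · intro l r hlr
    have h4 : l % 4 = r % 4 := by
      have : l ≡ r [ZMOD 4] := hlr.of_dvd (by push_cast; exact Dvd.intro _ rfl)
      exact this
    have hnn : jacobiSym l n = jacobiSym r n := by
      apply jacobiSym.mod_left'
      exact hlr.of_dvd (by push_cast; exact Dvd.intro_left _ rfl)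
    simp only [h4, hnn]
  · intro l
    split_ifs
    · exact abs_jacobiSym_le_one _ _
    · simp

/-! ### Möbius sums -/

/-- The term `μ(d) / d ^ 2`, or `0` if some element of `s` divides `d`. -/
noncomputable def moebiusTerm (s : Finset ℕ) (d : ℕ) : ℝ :=
  if ∀ p ∈ s, ¬ p ∣ d then (ArithmeticFunction.moebius d : ℝ) / (d : ℝ) ^ 2 else 0

/-- The sum of `μ(d) / d ^ 2` over the `d` that no element of `s` divides. -/
noncomputable def moebiusSqSum (s : Finset ℕ) : ℝ := ∑' d : ℕ, moebiusTerm s d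

theorem abs_moebius_le_one_real (d : ℕ) : |(ArithmeticFunction.moebius d : ℝ)| ≤ 1 := by
  exact_mod_cast ArithmeticFunction.abs_moebius_le_one (n := d)

theorem abs_moebius_term_le (s : Finset ℕ) (d : ℕ) :
    |moebiusTerm s d| ≤ 1 / (d : ℝ) ^ 2 := by
  unfold moebiusTerm
  split_ifs
  · rw [abs_div, abs_of_nonneg (sq_nonneg (d : ℝ))]
    exact div_le_div_of_nonneg_right (abs_moebius_le_one_real d) (sq_nonneg _)
  · simp only [abs_zero]; positivity

theorem summable_moebius_term (s : Finset ℕ) :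
    Summable (moebiusTerm s) :=
  Summable.of_norm_bounded (Real.summable_one_div_nat_pow.2 one_lt_two) (abs_moebius_term_le s)

/-- The two sums differ only at d = pe, where μ(pe) is -μ(e) if p ∤ e and 0 otherwise. This removes
one Euler factor at a time, so that the infinite product is never needed. -/
theorem moebiusSqSum_insert {s : Finset ℕ} {p : ℕ} (hp : p.Prime) (hs : ∀ q ∈ s, q.Prime)
    (hps : p ∉ s) :
    moebiusSqSum s = moebiusSqSum (insert p s) * (1 - 1 / (p : ℝ) ^ 2) := by
  have hp0 : (p : ℝ) ≠ 0 := by exact_mod_cast hp.ne_zero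
  set f : ℕ → ℝ := moebiusTerm s with hf
  set g : ℕ → ℝ := moebiusTerm (insert p s) with hg
  have hfs : Summable f := summable_moebius_term s
  have hgs : Summable g := summable_moebius_term _
  have hinj : Function.Injective fun e : ℕ => p * e := fun a b h =>
    Nat.eq_of_mul_eq_mul_left hp.pos h
  have hsub : ∀ e, f (p * e) - g (p * e) = -(1 / (p : ℝ) ^ 2) * g e := by
    intro e
    have hg0 : g (p * e) = 0 := by
      simp only [hg, moebiusTerm, Finset.forall_mem_insert, dvd_mul_right, not_true, false_and, if_false]
    rw [hg0, sub_zero]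
    simp only [hf, hg, moebiusTerm, Finset.forall_mem_insert]
    have hiff : (∀ q ∈ s, ¬ q ∣ p * e) ↔ ∀ q ∈ s, ¬ q ∣ e := by
      refine forall₂_congr fun q hq => not_congr ?_
      rw [(hs q hq).dvd_mul]
      constructor
      · rintro (h | h)
        · exact absurd ((Nat.prime_dvd_prime_iff_eq (hs q hq) hp).1 h ▸ hq) hps
        · exact h
      · exact Or.inr
    simp only [hiff]
    by_cases hpe : p ∣ e
    · have : ArithmeticFunction.moebius (p * e) = 0 := by
        apply ArithmeticFunction.moebius_eq_zero_of_not_squarefree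
        intro h
        exact hp.not_isUnit (h p (mul_dvd_mul_left p hpe))
      simp [this, hpe]
    · have : ArithmeticFunction.moebius (p * e) = - ArithmeticFunction.moebius e := by
        rw [ArithmeticFunction.isMultiplicative_moebius.map_mul_of_coprime
          ((Nat.Prime.coprime_iff_not_dvd hp).2 hpe), ArithmeticFunction.moebius_apply_prime hp,
          neg_one_mul]
      simp only [this, hpe, not_false_eq_true, true_and]
      split_ifs
      · push_cast
        field_simp
      · simp
  have hsupp : Function.support (fun d => f d - g d) ⊆ Set.range fun e : ℕ => p * e := by
    intro d hd
    by_contra hnot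
    apply hd
    have hpd : ¬ p ∣ d := fun ⟨e, he⟩ => hnot ⟨e, he.symm⟩
    simp [hf, hg, moebiusTerm, hpd]
  have h1 : ∑' d, (f d - g d) = ∑' e, (f (p * e) - g (p * e)) :=
    (hinj.tsum_eq hsupp).symm
  rw [hfs.tsum_sub hgs] at h1
  simp only [hsub, tsum_mul_left] at h1
  change (∑' d, f d) = (∑' d, g d) * _
  linarith

theorem moebiusSqSum_union {s t : Finset ℕ} (hs : ∀ q ∈ s, q.Prime) (ht : ∀ q ∈ t, q.Prime)
    (hst : Disjoint s t) :
    moebiusSqSum s = moebiusSqSum (t ∪ s) * ∏ p ∈ t, (1 - 1 / (p : ℝ) ^ 2) := by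
  induction t using Finset.induction_on with
  | empty => simp
  | insert p t hpt ih =>
    rw [Finset.disjoint_insert_right] at hst
    rw [ih (fun q hq => ht q (Finset.mem_insert_of_mem hq)) hst.2, Finset.prod_insert hpt,
      Finset.insert_union, moebiusSqSum_insert (ht p (Finset.mem_insert_self _ _)) ?_ ?_]
    · ring
    · intro q hq
      rcases Finset.mem_union.1 hq with h | h
      · exact ht q (Finset.mem_insert_of_mem h)
      · exact hs q h
    · simp [hpt, hst.1]

/-- The term d = 1 equals 1 and the others contribute at most ζ(2) - 1 < 1. Positivity is all that
is needed, because the constant cancels when dividing by |𝓕(x)|. -/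
theorem moebiusSqSum_two_pos : 0 < moebiusSqSum {2} := by
  have hz := hasSum_zeta_two
  set f : ℕ → ℝ := moebiusTerm {2} with hf
  have hfb : ∀ d, |f d| ≤ 1 / (d : ℝ) ^ 2 := abs_moebius_term_le {2}
  have h1 : ∑ i ∈ Finset.range 2, f i + ∑' i, f (i + 2) = moebiusSqSum {2} :=
    (summable_moebius_term {2}).sum_add_tsum_nat_add 2
  have h2 := hz.summable.sum_add_tsum_nat_add 2
  rw [hz.tsum_eq] at h2
  have h3 : |∑' i : ℕ, f (i + 2)| ≤ ∑' i : ℕ, 1 / ((i + 2 : ℕ) : ℝ) ^ 2 := by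
    rw [← Real.norm_eq_abs]
    exact tsum_of_norm_bounded ((summable_nat_add_iff 2).2 hz.summable).hasSum
      fun i => hfb (i + 2)
  have f0 : f 0 = 0 := by simp [hf, moebiusTerm]
  have f1 : f 1 = 1 := by simp [hf, moebiusTerm]
  rw [Finset.sum_range_succ, Finset.sum_range_one, f0, f1] at h1
  rw [Finset.sum_range_succ, Finset.sum_range_one] at h2
  have hpi := Real.pi_lt_d2
  have hpi0 := Real.pi_pos
  rw [abs_le] at h3
  norm_num at h2
  norm_num at h3
  nlinarith

theorem tsum_one_div_sq_tail_le {R : ℕ} (hR : 0 < R) :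
    ∑' i : ℕ, (1 : ℝ) / ((i + (R + 1) : ℕ) : ℝ) ^ 2 ≤ 1 / (R : ℝ) := by
  refine Real.tsum_le_of_sum_range_le (fun i => by positivity) fun n => ?_
  have := sum_Ioc_inv_sq_le_sub (α := ℝ) hR.ne' (Nat.le_add_right R n)
  have hn : (0 : ℝ) ≤ ((R + n : ℕ) : ℝ)⁻¹ := by positivity
  have e : ∑ i ∈ Finset.range n, 1 / ((i + (R + 1) : ℕ) : ℝ) ^ 2 =
      ∑ i ∈ Finset.Ioc R (R + n), ((i : ℝ) ^ 2)⁻¹ := by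
    have h : Finset.Ioc R (R + n) = Finset.Ico (R + 1) (R + 1 + n) := by
      ext i; simp only [Finset.mem_Ioc, Finset.mem_Ico]; omega
    rw [h, Finset.sum_Ico_eq_sum_range, Nat.add_sub_cancel_left]
    refine Finset.sum_congr rfl fun i _ => ?_
    rw [one_div, add_comm]
  rw [e, one_div]
  linarith

theorem sum_moebiusTerm_range (s : Finset ℕ) (R : ℕ) :
    ∑ d ∈ Finset.range (R + 1), moebiusTerm s d = ∑ d ∈ Finset.Icc 1 R, moebiusTerm s d := by
  rw [Finset.range_eq_Ico, Finset.sum_eq_sum_Ico_succ_bot (Nat.succ_pos R)]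
  have : moebiusTerm s 0 = 0 := by simp [moebiusTerm]
  rw [this, zero_add]
  refine Finset.sum_congr ?_ fun _ _ => rfl
  ext i; simp only [Finset.mem_Icc, Finset.mem_Ico]; omega

theorem abs_moebiusSqSum_sub_le (s : Finset ℕ) {R : ℕ} (hR : 0 < R) :
    |moebiusSqSum s - ∑ d ∈ Finset.Icc 1 R, moebiusTerm s d| ≤ 1 / R := by
  have h1 : ∑ i ∈ Finset.range (R + 1), moebiusTerm s i + ∑' i, moebiusTerm s (i + (R + 1)) =
      moebiusSqSum s := (summable_moebius_term s).sum_add_tsum_nat_add (R + 1)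
  have hb : Summable fun i : ℕ => (1 : ℝ) / ((i + (R + 1) : ℕ) : ℝ) ^ 2 :=
    (Real.summable_one_div_nat_pow.2 one_lt_two).comp_injective (add_left_injective (R + 1))
  have h3 : |∑' i : ℕ, moebiusTerm s (i + (R + 1))| ≤
      ∑' i : ℕ, (1 : ℝ) / ((i + (R + 1) : ℕ) : ℝ) ^ 2 := by
    rw [← Real.norm_eq_abs]
    refine tsum_of_norm_bounded hb.hasSum fun i => ?_
    exact abs_moebius_term_le s (i + (R + 1))
  rw [← h1, sum_moebiusTerm_range, add_sub_cancel_left]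
  exact h3.trans (tsum_one_div_sq_tail_le hR)

/-- Write m = b²a with a square-free. Then d² ∣ m exactly when d ∣ b, and the divisor sum of μ over
b is 1 or 0 according to whether b = 1. -/
theorem sum_moebius_sq_dvd {m : ℕ} (hm : 0 < m) {R : ℕ} (hR : ∀ d, d ^ 2 ∣ m → d ≤ R) :
    ∑ d ∈ (Finset.Icc 1 R).filter (fun d => d ^ 2 ∣ m), ArithmeticFunction.moebius d =
      if Squarefree m then 1 else 0 := by
  obtain ⟨a, b, ha, hb, hab, hsq⟩ := Nat.sq_mul_squarefree_of_pos hm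
  have hdiv : ∀ d, d ^ 2 ∣ m ↔ d ∣ b := by
    intro d
    constructor
    · intro h
      rw [← hab] at h
      rcases Nat.eq_zero_or_pos d with rfl | hd
      · simp at h; omega
      rw [← Nat.factorization_le_iff_dvd hd.ne' hb.ne']
      have h' := (Nat.factorization_le_iff_dvd (by positivity) (by positivity)).2 h
      intro p
      have h1 := h' p
      have h2 := hsq.natFactorization_le_one p
      rw [Nat.factorization_pow, Nat.factorization_mul (by positivity) ha.ne',
        Nat.factorization_pow] at h1
      simp at h1
      omega
    · intro h
      rw [← hab]
      exact (pow_dvd_pow_of_dvd h 2).trans (dvd_mul_right _ _)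
  have hset : (Finset.Icc 1 R).filter (fun d => d ^ 2 ∣ m) = b.divisors := by
    ext d
    simp only [Finset.mem_filter, Finset.mem_Icc, Nat.mem_divisors, hdiv]
    constructor
    · rintro ⟨_, h⟩; exact ⟨h, hb.ne'⟩
    · rintro ⟨h, _⟩; exact ⟨⟨Nat.pos_of_dvd_of_pos h hb, hR d ((hdiv d).2 h)⟩, h⟩
  have := congrArg (fun F => F b) ArithmeticFunction.moebius_mul_coe_zeta
  simp only [ArithmeticFunction.coe_mul_zeta_apply, ArithmeticFunction.one_apply] at this
  rw [hset, this]
  congr 1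
  rw [eq_iff_iff]
  constructor
  · rintro rfl
    rw [← hab]; simpa using hsq
  · intro h
    have : IsUnit b := h b (by rw [← hab, ← sq]; exact dvd_mul_right _ _)
    exact Nat.isUnit_iff.1 this

/-! ### Jacobi sums over square-free integers -/

open Classical in
/-- The sum of the Jacobi symbol `(l / n)` over the square-free `l ≡ a (mod 4)` with `|l| ≤ Y`. -/
noncomputable def squarefreeJacobiSum (a : ℕ) (Y : ℝ) (n : ℕ) : ℝ :=
  ∑ l ∈ (Finset.Icc (-⌊Y⌋) ⌊Y⌋).filter (fun l : ℤ => l % 4 = a ∧ Squarefree l),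
    ((jacobiSym l n : ℤ) : ℝ)

/-- Substitute l = d²m: an odd d has d² ≡ 1 (mod 4), and (d²/n) = 1 because d is coprime to n. -/
theorem sum_jacobiSym_multiples {n d a : ℕ} (hd : Odd d) (hdn : Nat.Coprime d n)
    (Y : ℝ) :
    ∑ l ∈ (Finset.Icc (-⌊Y⌋) ⌊Y⌋).filter (fun l : ℤ => l % 4 = a ∧ ((d ^ 2 : ℕ) : ℤ) ∣ l),
      ((jacobiSym l n : ℤ) : ℝ) =
    ∑ m ∈ (Finset.Icc (-⌊Y / (d : ℝ) ^ 2⌋) ⌊Y / (d : ℝ) ^ 2⌋).filter (fun l : ℤ => l % 4 = a),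
      ((jacobiSym m n : ℤ) : ℝ) := by
  have hd0 : 0 < d := hd.pos
  have hdr : (0 : ℝ) < (d : ℝ) ^ 2 := by positivity
  have hmod : ∀ m : ℤ, (((d ^ 2 : ℕ) : ℤ) * m) % 4 = m % 4 := by
    intro m
    obtain ⟨k, rfl⟩ := hd
    have : (((2 * k + 1) ^ 2 : ℕ) : ℤ) * m = m + 4 * ((k * k + k) * m) := by push_cast; ring
    rw [this, Int.add_mul_emod_self_left]
  have hle : ∀ m : ℤ, m ≤ ⌊Y / (d : ℝ) ^ 2⌋ ↔ ((d ^ 2 : ℕ) : ℤ) * m ≤ ⌊Y⌋ := by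
    intro m
    rw [Int.le_floor, Int.le_floor, le_div_iff₀ hdr]
    push_cast
    rw [mul_comm]
  have hmem : ∀ m : ℤ, m ∈ Finset.Icc (-⌊Y / (d : ℝ) ^ 2⌋) ⌊Y / (d : ℝ) ^ 2⌋ ↔
      ((d ^ 2 : ℕ) : ℤ) * m ∈ Finset.Icc (-⌊Y⌋) ⌊Y⌋ := by
    intro m
    have h1 := hle m
    have h2 := hle (-m)
    rw [mul_neg] at h2
    rw [Finset.mem_Icc, Finset.mem_Icc, neg_le, h1, h2, neg_le]
  symm
  refine Finset.sum_bij (fun m _ => ((d ^ 2 : ℕ) : ℤ) * m) ?_ ?_ ?_ ?_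
  · intro m hm
    rw [Finset.mem_filter] at hm ⊢
    exact ⟨(hmem m).1 hm.1, (hmod m).trans hm.2, dvd_mul_right _ _⟩
  · intro m _ m' _ h
    exact mul_left_cancel₀ (by positivity) h
  · intro l hl
    rw [Finset.mem_filter] at hl
    obtain ⟨hl1, hl2, m, rfl⟩ := hl
    refine ⟨m, ?_, rfl⟩
    rw [Finset.mem_filter]
    exact ⟨(hmem m).2 hl1, (hmod m).symm.trans hl2⟩
  · intro m _
    rw [jacobiSym.mul_left]
    push_cast
    rw [jacobiSym.sq_one' (by rw [Int.gcd_natCast_natCast]; exact hdn)]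
    simp

/-- If 2 ∣ d, no multiple of d² lies in an odd class modulo 4; if d shares a prime with n, every
symbol in the sum is 0. -/
theorem sum_jacobiSym_multiples_eq_zero {n d a : ℕ} (ha : Odd a)
    (h : ∃ p ∈ insert 2 n.primeFactors, p ∣ d) (Y : ℝ) :
    ∑ l ∈ (Finset.Icc (-⌊Y⌋) ⌊Y⌋).filter (fun l : ℤ => l % 4 = a ∧ ((d ^ 2 : ℕ) : ℤ) ∣ l),
      ((jacobiSym l n : ℤ) : ℝ) = 0 := by
  obtain ⟨p, hp, hpd⟩ := h
  refine Finset.sum_eq_zero fun l hl => ?_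
  rw [Finset.mem_filter] at hl
  obtain ⟨_, hl4, hdl⟩ := hl
  have hpl : (p : ℤ) ∣ l :=
    dvd_trans (by exact_mod_cast hpd.trans (dvd_pow_self d two_ne_zero)) hdl
  rcases Finset.mem_insert.1 hp with rfl | hp
  · obtain ⟨k, rfl⟩ := ha
    push_cast at hpl hl4
    omega
  · have hpp := Nat.prime_of_mem_primeFactors hp
    have hpn := Nat.dvd_of_mem_primeFactors hp
    have hn : n ≠ 0 := (Nat.mem_primeFactors.1 hp).2.2
    rw [jacobiSym.eq_zero_iff.2 ⟨hn, ?_⟩, Int.cast_zero]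
    intro hg
    have : (p : ℤ) ∣ (l.gcd n : ℤ) := Int.dvd_coe_gcd hpl (by exact_mod_cast hpn)
    rw [hg] at this
    have : p ∣ 1 := by exact_mod_cast this
    exact hpp.one_lt.ne' (Nat.dvd_one.1 this)

theorem squarefreeJacobiSum_eq {n a : ℕ} (ha : Odd a) (Y : ℝ) :
    squarefreeJacobiSum a Y n = ∑ d ∈ Finset.Icc 1 ⌊√Y⌋₊, (ArithmeticFunction.moebius d : ℝ) *
      ∑ l ∈ (Finset.Icc (-⌊Y⌋) ⌊Y⌋).filter (fun l : ℤ => l % 4 = a ∧ ((d ^ 2 : ℕ) : ℤ) ∣ l),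
        ((jacobiSym l n : ℤ) : ℝ) := by
  classical
  have h1 : ∀ d : ℕ, ∑ l ∈ (Finset.Icc (-⌊Y⌋) ⌊Y⌋).filter
      (fun l : ℤ => l % 4 = a ∧ ((d ^ 2 : ℕ) : ℤ) ∣ l), ((jacobiSym l n : ℤ) : ℝ) =
      ∑ l ∈ (Finset.Icc (-⌊Y⌋) ⌊Y⌋).filter (fun l : ℤ => l % 4 = a),
        if ((d ^ 2 : ℕ) : ℤ) ∣ l then ((jacobiSym l n : ℤ) : ℝ) else 0 := by
    intro d
    rw [← Finset.filter_filter, Finset.sum_filter]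
  simp only [h1, Finset.mul_sum]
  rw [Finset.sum_comm, squarefreeJacobiSum, ← Finset.filter_filter, Finset.sum_filter]
  refine Finset.sum_congr rfl fun l hl => ?_
  rw [Finset.mem_filter, Finset.mem_Icc] at hl
  obtain ⟨hl, hl4⟩ := hl
  have hl0 : l ≠ 0 := by
    rintro rfl
    obtain ⟨k, rfl⟩ := ha
    push_cast at hl4
    omega
  have habs : (l.natAbs : ℝ) ≤ Y := by
    have : (l.natAbs : ℤ) ≤ ⌊Y⌋ := by omega
    have := Int.le_floor.1 this
    rwa [Int.cast_natCast] at this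
  have hm := sum_moebius_sq_dvd (m := l.natAbs) (Int.natAbs_pos.2 hl0) (R := ⌊√Y⌋₊) ?_
  · have hdvd : ∀ d : ℕ, ((d ^ 2 : ℕ) : ℤ) ∣ l ↔ d ^ 2 ∣ l.natAbs := fun d => Int.natCast_dvd
    simp only [hdvd, mul_ite, mul_zero]
    rw [← Finset.sum_filter, ← Finset.sum_mul]
    have := congrArg (fun z : ℤ => (z : ℝ)) hm
    push_cast at this
    rw [this]
    simp only [Int.squarefree_natAbs]
    split_ifs <;> simp
  · intro d hd
    have := Nat.le_of_dvd (Int.natAbs_pos.2 hl0) hd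
    apply Nat.le_floor
    apply Real.le_sqrt_of_sq_le
    refine le_trans ?_ habs
    exact_mod_cast this

theorem abs_jacobiTotal_div_le_one (n : ℕ) : |(jacobiTotal n : ℝ) / n| ≤ 1 := by
  rw [abs_div, Nat.abs_cast]
  refine div_le_one_of_le₀ ?_ (Nat.cast_nonneg _)
  rw [jacobiTotal]
  push_cast
  refine (Finset.abs_sum_le_sum_abs _ _).trans ?_
  refine (Finset.sum_le_card_nsmul (Finset.range n) _ 1 fun a _ => abs_jacobiSym_le_one a n).trans ?_
  simp

/-- Each of the R = ⌊√Y⌋ values of d contributes an error of at most 8n. Completing the Möbius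
series beyond R costs at most (Y/2)/R ≤ √Y, because √Y < R + 1 ≤ 2R. -/
theorem abs_squarefreeJacobiSum_sub_le {n a : ℕ} (hn : Odd n) (ha : Odd a) (ha4 : a < 4) {Y : ℝ}
    (hY : 1 ≤ Y) :
    |squarefreeJacobiSum a Y n -
      Y / 2 * (jacobiTotal n / n) * moebiusSqSum (insert 2 n.primeFactors)| ≤ 9 * n * √Y := by
  set s := insert 2 n.primeFactors with hs
  set R := ⌊√Y⌋₊ with hR
  have hsq : 1 ≤ √Y := Real.one_le_sqrt.2 hY
  have hR1 : 1 ≤ R := Nat.one_le_floor_iff _ |>.2 hsq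
  have hRr : (1 : ℝ) ≤ R := by exact_mod_cast hR1
  have hRle : (R : ℝ) ≤ √Y := Nat.floor_le (by linarith)
  have hRlt : √Y < R + 1 := Nat.lt_floor_add_one _
  have hss : √Y * √Y = Y := Real.mul_self_sqrt (by linarith)
  have hn1 : (1 : ℝ) ≤ n := by exact_mod_cast hn.pos
  rw [squarefreeJacobiSum_eq ha Y]
  have hterm : ∀ d ∈ Finset.Icc 1 R, |(ArithmeticFunction.moebius d : ℝ) *
      ∑ l ∈ (Finset.Icc (-⌊Y⌋) ⌊Y⌋).filter (fun l : ℤ => l % 4 = a ∧ ((d ^ 2 : ℕ) : ℤ) ∣ l),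
        ((jacobiSym l n : ℤ) : ℝ) - Y / 2 * (jacobiTotal n / n) * moebiusTerm s d| ≤ 8 * n := by
    intro d hd
    have hd1 : 1 ≤ d := (Finset.mem_Icc.1 hd).1
    by_cases h : ∃ p ∈ s, p ∣ d
    · rw [sum_jacobiSym_multiples_eq_zero ha h, moebiusTerm, if_neg (by push Not; exact h)]
      simp
    · push Not at h
      have hdo : Odd d := by
        rw [← Nat.not_even_iff_odd, even_iff_two_dvd]
        exact h 2 (Finset.mem_insert_self _ _)
      have hdn : Nat.Coprime d n := by
        refine Nat.coprime_of_dvd fun p hp hpd hpn => ?_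
        exact h p (Finset.mem_insert_of_mem (Nat.mem_primeFactors.2 ⟨hp, hpn, hn.pos.ne'⟩)) hpd
      rw [sum_jacobiSym_multiples hdo hdn, moebiusTerm, if_pos h]
      have hdr : (d : ℝ) ≠ 0 := by exact_mod_cast (by omega : d ≠ 0)
      have e : Y / 2 * ((jacobiTotal n : ℝ) / n) * ((ArithmeticFunction.moebius d : ℝ) / d ^ 2) =
          (ArithmeticFunction.moebius d : ℝ) * (Y / d ^ 2 / 2 * (jacobiTotal n / n)) := by
        ring
      rw [e, ← mul_sub, abs_mul]
      calc _ ≤ 1 * (8 * (n : ℝ)) := by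
            refine mul_le_mul (abs_moebius_le_one_real d)
              (abs_sum_jacobiSym_sub_le hn ha4 (by positivity)) (abs_nonneg _) zero_le_one
        _ = 8 * n := one_mul _
  have h1 : |∑ d ∈ Finset.Icc 1 R, (ArithmeticFunction.moebius d : ℝ) *
      ∑ l ∈ (Finset.Icc (-⌊Y⌋) ⌊Y⌋).filter (fun l : ℤ => l % 4 = a ∧ ((d ^ 2 : ℕ) : ℤ) ∣ l),
        ((jacobiSym l n : ℤ) : ℝ) - Y / 2 * (jacobiTotal n / n) *
        ∑ d ∈ Finset.Icc 1 R, moebiusTerm s d| ≤ 8 * n * R := by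
    rw [Finset.mul_sum, ← Finset.sum_sub_distrib]
    refine (Finset.abs_sum_le_sum_abs _ _).trans ?_
    refine (Finset.sum_le_card_nsmul _ _ _ hterm).trans (le_of_eq ?_)
    rw [Nat.card_Icc, nsmul_eq_mul, Nat.add_sub_cancel, mul_comm]
  have h2 : |Y / 2 * (jacobiTotal n / n) * ∑ d ∈ Finset.Icc 1 R, moebiusTerm s d -
      Y / 2 * (jacobiTotal n / n) * moebiusSqSum s| ≤ √Y := by
    rw [← mul_sub, abs_mul, abs_sub_comm, abs_mul, abs_of_nonneg (by positivity : 0 ≤ Y / 2)]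
    have e1 := abs_moebiusSqSum_sub_le s (R := R) (by omega)
    have e2 := abs_jacobiTotal_div_le_one n
    calc _ ≤ Y / 2 * 1 * (1 / R) := by gcongr
      _ ≤ √Y := by
        rw [mul_one, mul_one_div, div_div, div_le_iff₀ (by positivity)]
        nlinarith
  have h3 := (abs_sub_le _ _ _).trans (add_le_add h1 h2)
  refine h3.trans ?_
  nlinarith [mul_le_mul_of_nonneg_left hRle (by linarith : (0 : ℝ) ≤ 8 * n)]

/-! ### Averages over fundamental discriminants -/

/-- The mean value of `D ↦ (D / n)`: it is `∏ p / (p + 1)` over the primes `p ∣ n` if `n` is a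
square and `0` otherwise. -/
noncomputable def jacobiMean (n : ℕ) : ℝ :=
  open Classical in if IsSquare n then ∏ p ∈ n.primeFactors, (p : ℝ) / (p + 1) else 0

theorem abs_jacobiMean_le_one (n : ℕ) : |jacobiMean n| ≤ 1 := by
  unfold jacobiMean
  split_ifs
  · rw [abs_of_nonneg (Finset.prod_nonneg fun p _ => by positivity)]
    refine Finset.prod_le_one (fun p _ => by positivity) fun p _ => ?_
    rw [div_le_one (by positivity)]
    linarith
  · simp

/-- For a square n, φ(n)/n supplies the factors 1 - 1/p and the Möbius sum lacks the factors 1 -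
1/p², both for p ∣ n; the quotient (1 - 1/p)/(1 - 1/p²) is p/(p+1). -/
theorem jacobiTotal_mul_moebiusSqSum {n : ℕ} (hn : Odd n) :
    (jacobiTotal n : ℝ) / n * moebiusSqSum (insert 2 n.primeFactors) =
      moebiusSqSum {2} * jacobiMean n := by
  have hn0 : (n : ℝ) ≠ 0 := by exact_mod_cast hn.pos.ne'
  unfold jacobiMean
  split_ifs with h
  · rw [jacobiTotal_of_isSquare hn.pos h, moebiusSqSum_union (s := {2}) (t := n.primeFactors)
      (by simp [Nat.prime_two]) (fun q hq => Nat.prime_of_mem_primeFactors hq)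
      (by
        rw [Finset.disjoint_singleton_left]
        intro h2
        exact Nat.not_even_iff_odd.2 hn (even_iff_two_dvd.2 (Nat.dvd_of_mem_primeFactors h2)))]
    have ht : ((n.totient : ℤ) : ℝ) / n = ∏ p ∈ n.primeFactors, (1 - (p : ℝ)⁻¹) := by
      have := congrArg (fun q : ℚ => (q : ℝ)) (Nat.totient_eq_mul_prod_factors n)
      push_cast at this
      rw [Int.cast_natCast, this]
      field_simp
    rw [ht, Finset.union_comm, ← Finset.insert_eq, mul_assoc, ← Finset.prod_mul_distrib, mul_comm]
    congr 1
    refine Finset.prod_congr rfl fun p hp => ?_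
    have hp0 : (p : ℝ) ≠ 0 := by exact_mod_cast (Nat.prime_of_mem_primeFactors hp).ne_zero
    have hp1 : (p : ℝ) + 1 ≠ 0 := by positivity
    field_simp
    ring
  · rw [jacobiTotal_of_not_isSquare hn h]
    simp

/-- A square-free m ≡ 2 (mod 4) is 2k with k odd and square-free. All discriminants thus become
dilates, by 1, 4 or 8, of odd square-free integers in a class modulo 4. -/
theorem isFundamentalDiscriminant_iff (D : ℤ) : IsFundamentalDiscriminant D ↔
    ((∃ m : ℤ, D = m ∧ m % 4 = 1 ∧ Squarefree m) ∨
      (∃ m : ℤ, D = 4 * m ∧ m % 4 = 3 ∧ Squarefree m)) ∨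
    ((∃ m : ℤ, D = 8 * m ∧ m % 4 = 1 ∧ Squarefree m) ∨
      (∃ m : ℤ, D = 8 * m ∧ m % 4 = 3 ∧ Squarefree m)) := by
  have h2 : ∀ m : ℤ, m % 2 = 1 → (Squarefree (2 * m) ↔ Squarefree m) := by
    intro m hm
    rw [← Int.squarefree_natAbs, ← Int.squarefree_natAbs, Int.natAbs_mul, Nat.squarefree_mul]
    · simp [Nat.squarefree_two]
    · rw [show (2 : ℤ).natAbs = 2 from rfl, Nat.coprime_two_left, Int.natAbs_odd]
      exact Int.odd_iff.2 hm
  constructor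
  · rintro (⟨h, hs⟩ | ⟨m, rfl, h | h, hs⟩)
    · exact Or.inl (Or.inl ⟨D, rfl, h, hs⟩)
    · obtain ⟨k, rfl⟩ : ∃ k, m = 2 * k := ⟨m / 2, by omega⟩
      have hs' := (h2 k (by omega)).1 hs
      have : k % 4 = 1 ∨ k % 4 = 3 := by omega
      rcases this with h' | h'
      · exact Or.inr (Or.inl ⟨k, by ring, h', hs'⟩)
      · exact Or.inr (Or.inr ⟨k, by ring, h', hs'⟩)
    · exact Or.inl (Or.inr ⟨m, rfl, h, hs⟩)
  · rintro ((⟨m, rfl, h, hs⟩ | ⟨m, rfl, h, hs⟩) | (⟨m, rfl, h, hs⟩ | ⟨m, rfl, h, hs⟩))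
    · exact Or.inl ⟨by omega, hs⟩
    · exact Or.inr ⟨m, rfl, Or.inr h, hs⟩
    · exact Or.inr ⟨2 * m, by ring, by omega, (h2 m (by omega)).2 hs⟩
    · exact Or.inr ⟨2 * m, by ring, by omega, (h2 m (by omega)).2 hs⟩

open Classical in
theorem sum_jacobiSym_dilate {c : ℕ} (hc : 0 < c) (a : ℕ) (x : ℝ) (n : ℕ) :
    ∑ D ∈ (Finset.Icc (-⌊x⌋) ⌊x⌋).filter
      (fun D : ℤ => ∃ m : ℤ, D = (c : ℤ) * m ∧ m % 4 = a ∧ Squarefree m),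
      ((jacobiSym D n : ℤ) : ℝ) = ((jacobiSym c n : ℤ) : ℝ) * squarefreeJacobiSum a (x / c) n := by
  have hcr : (0 : ℝ) < c := by exact_mod_cast hc
  have hle : ∀ m : ℤ, m ≤ ⌊x / c⌋ ↔ (c : ℤ) * m ≤ ⌊x⌋ := by
    intro m
    rw [Int.le_floor, Int.le_floor, le_div_iff₀ hcr]
    push_cast
    rw [mul_comm]
  have hmem : ∀ m : ℤ, m ∈ Finset.Icc (-⌊x / c⌋) ⌊x / c⌋ ↔
      (c : ℤ) * m ∈ Finset.Icc (-⌊x⌋) ⌊x⌋ := by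
    intro m
    have h1 := hle m
    have h2 := hle (-m)
    rw [mul_neg] at h2
    rw [Finset.mem_Icc, Finset.mem_Icc, neg_le, h1, h2, neg_le]
  rw [squarefreeJacobiSum, Finset.mul_sum]
  symm
  refine Finset.sum_bij (fun m _ => (c : ℤ) * m) ?_ ?_ ?_ ?_
  · intro m hm
    rw [Finset.mem_filter] at hm ⊢
    exact ⟨(hmem m).1 hm.1, m, rfl, hm.2⟩
  · intro m _ m' _ h
    exact mul_left_cancel₀ (by positivity) h
  · intro D hD
    rw [Finset.mem_filter] at hD
    obtain ⟨hD1, m, rfl, hm⟩ := hD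
    exact ⟨m, Finset.mem_filter.2 ⟨(hmem m).2 hD1, hm⟩, rfl⟩
  · intro m _
    rw [jacobiSym.mul_left]
    push_cast
    rfl

/-- The sum of `(D / n)` over the fundamental discriminants `D` with `|D| ≤ x`. -/
noncomputable def discriminantSum (x : ℝ) (n : ℕ) : ℝ :=
  ∑ D ∈ fundamentalDiscriminants x, ((jacobiSym D n : ℤ) : ℝ)

theorem discriminantSum_eq (x : ℝ) (n : ℕ) : discriminantSum x n =
    squarefreeJacobiSum 1 x n + ((jacobiSym 4 n : ℤ) : ℝ) * squarefreeJacobiSum 3 (x / 4) n +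
    (((jacobiSym 8 n : ℤ) : ℝ) * squarefreeJacobiSum 1 (x / 8) n +
      ((jacobiSym 8 n : ℤ) : ℝ) * squarefreeJacobiSum 3 (x / 8) n) := by
  classical
  have h1 := sum_jacobiSym_dilate (c := 1) one_pos 1 x n
  have h2 := sum_jacobiSym_dilate (c := 4) (by norm_num) 3 x n
  have h3 := sum_jacobiSym_dilate (c := 8) (by norm_num) 1 x n
  have h4 := sum_jacobiSym_dilate (c := 8) (by norm_num) 3 x n
  simp only [Nat.cast_one, jacobiSym.one_left, Int.cast_one, one_mul, div_one] at h1
  simp only [Nat.cast_ofNat, Nat.cast_one] at h2 h3 h4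
  rw [← h1, ← h2, ← h3, ← h4, discriminantSum, fundamentalDiscriminants]
  simp only [isFundamentalDiscriminant_iff]
  have hd : ∀ {p q : ℤ → Prop}, (∀ D, p D → q D → False) →
      Disjoint ((Finset.Icc (-⌊x⌋) ⌊x⌋).filter p) ((Finset.Icc (-⌊x⌋) ⌊x⌋).filter q) := by
    intro p q h
    exact Finset.disjoint_filter.2 fun D _ => h D
  rw [Finset.filter_or, Finset.filter_or, Finset.filter_or, Finset.sum_union, Finset.sum_union,
    Finset.sum_union]
  · refine hd fun D ⟨m, h, h', _⟩ ⟨m', k, k', _⟩ => ?_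
    omega
  · refine hd fun D ⟨m, h, h', _⟩ ⟨m', k, k', _⟩ => ?_
    omega
  · rw [← Finset.filter_or, ← Finset.filter_or]
    refine Finset.disjoint_filter.2 fun D _ h k => ?_
    rcases h with ⟨m, h, h', _⟩ | ⟨m, h, h', _⟩ <;> rcases k with ⟨m', k, k', _⟩ | ⟨m', k, k', _⟩ <;>
      omega

/-- The four dilated families have total density (1/2)(1 + 1/4 + 1/8 + 1/8) = 3/4, and each has
error at most 9n√x. -/
theorem abs_discriminantSum_sub_le {n : ℕ} (hn : Odd n) {x : ℝ} (hx : 8 ≤ x) :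
    |discriminantSum x n - 3 / 4 * x * moebiusSqSum {2} * jacobiMean n| ≤ 36 * n * √x := by
  have hZ := jacobiTotal_mul_moebiusSqSum hn
  have key : ∀ (a : ℕ) (c : ℕ), Odd a → a < 4 → 1 ≤ c → (c : ℝ) ≤ 8 → Nat.Coprime 2 n →
      (∃ k, c = 2 ^ k) →
      |((jacobiSym c n : ℤ) : ℝ) * squarefreeJacobiSum a (x / c) n -
        x / c / 2 * (moebiusSqSum {2} * jacobiMean n)| ≤ 9 * n * √x := by
    intro a c ha ha4 hc hc8 h2n hck
    have hc1 : (1 : ℝ) ≤ c := by exact_mod_cast hc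
    have h1 : (1 : ℝ) ≤ x / c := by
      rw [le_div_iff₀ (by linarith)]; linarith
    have h := abs_squarefreeJacobiSum_sub_le hn ha ha4 h1
    rw [mul_assoc, hZ] at h
    -- The twist by (c/n), with c a power of 2, does not affect the main term: it is 1 for an odd
    -- square n, and otherwise the main term is 0.
    have hm : x / c / 2 * (moebiusSqSum {2} * jacobiMean n) =
        ((jacobiSym c n : ℤ) : ℝ) * (x / c / 2 * (moebiusSqSum {2} * jacobiMean n)) := by
      by_cases hsq : IsSquare n
      · obtain ⟨k, rfl⟩ := hsq
        have hk0 : k ≠ 0 := by rintro rfl; simp at hn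
        have : NeZero k := ⟨hk0⟩
        obtain ⟨i, rfl⟩ := hck
        have : jacobiSym ((2 ^ i : ℕ) : ℤ) (k * k) = 1 := by
          rw [jacobiSym.mul_right, ← sq, jacobiSym.sq_one]
          rw [Int.gcd_natCast_natCast]
          exact (Nat.Coprime.coprime_mul_right_right h2n).pow_left i
        rw [this]; simp
      · simp [jacobiMean, hsq]
    rw [hm, ← mul_sub, abs_mul]
    calc _ ≤ 1 * (9 * (n : ℝ) * √(x / c)) :=
          mul_le_mul (abs_jacobiSym_le_one _ _) h (abs_nonneg _) zero_le_one
      _ ≤ 9 * n * √x := by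
        rw [one_mul]
        gcongr
        exact div_le_self (by linarith) hc1
  have h2n : Nat.Coprime 2 n := Nat.coprime_two_left.2 hn
  have h1 := key 1 1 odd_one (by norm_num) le_rfl (by norm_num) h2n ⟨0, by norm_num⟩
  have h2 := key 3 4 (by decide) (by norm_num) (by norm_num) (by norm_num) h2n ⟨2, by norm_num⟩
  have h3 := key 1 8 odd_one (by norm_num) (by norm_num) (by norm_num) h2n ⟨3, by norm_num⟩
  have h4 := key 3 8 (by decide) (by norm_num) (by norm_num) (by norm_num) h2n ⟨3, by norm_num⟩
  simp only [Nat.cast_one, jacobiSym.one_left, Int.cast_one, one_mul, div_one] at h1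
  simp only [Nat.cast_ofNat] at h2 h3 h4
  rw [discriminantSum_eq]
  rw [abs_le] at *
  constructor <;> linarith [h1.1, h1.2]

theorem discriminantSum_one (x : ℝ) :
    discriminantSum x 1 = ((fundamentalDiscriminants x).card : ℝ) := by
  simp [discriminantSum]

/-- The average of `(D / n)` over fundamental discriminants, for odd `n`. -/
theorem exists_abs_discriminantSum_div_sub_le : ∃ C x₀ : ℝ, 0 < C ∧ 0 < x₀ ∧ ∀ x : ℝ, x₀ ≤ x →
    0 < (fundamentalDiscriminants x).card ∧ ∀ n : ℕ, Odd n →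
      |discriminantSum x n / (fundamentalDiscriminants x).card - jacobiMean n| ≤ C * n / √x := by
  set A := moebiusSqSum {2} with hA
  have hA0 : 0 < A := moebiusSqSum_two_pos
  -- For √x ≥ 144/A the error 36√x is at most Ax/4, hence |𝓕(x)| ≥ Ax/2. The numerator error 72n√x
  -- divided by Ax/2 gives (144/A) n/√x.
  refine ⟨144 / A, max 8 ((144 / A) ^ 2), by positivity, by positivity, fun x hx => ?_⟩
  have hx8 : 8 ≤ x := (le_max_left _ _).trans hx
  have hx0 : 0 < x := by linarith
  have hs : 144 / A ≤ √x := Real.le_sqrt_of_sq_le ((le_max_right _ _).trans hx)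
  have hss : √x * √x = x := Real.mul_self_sqrt hx0.le
  have hsp : 0 < √x := Real.sqrt_pos.2 hx0
  rw [div_le_iff₀ hA0] at hs
  have hm1 : jacobiMean 1 = 1 := by simp [jacobiMean]
  have h1 := abs_discriminantSum_sub_le odd_one hx8
  rw [hm1, discriminantSum_one, ← hA] at h1
  set F : ℝ := ((fundamentalDiscriminants x).card : ℝ) with hF
  have hFlow : A * x / 2 ≤ F := by
    rw [abs_le] at h1
    push_cast at h1
    nlinarith [h1.1]
  have hF0 : 0 < F := lt_of_lt_of_le (by positivity) hFlow
  refine ⟨Nat.cast_pos.1 hF0, fun n hn => ?_⟩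
  have h2 := abs_discriminantSum_sub_le hn hx8
  have hmn := abs_jacobiMean_le_one n
  have hn1 : (1 : ℝ) ≤ n := by exact_mod_cast hn.pos
  have e : discriminantSum x n / F - jacobiMean n = ((discriminantSum x n -
      3 / 4 * x * A * jacobiMean n) - (F - 3 / 4 * x * A * 1) * jacobiMean n) / F := by
    field_simp
    ring
  rw [e, abs_div, abs_of_pos hF0, div_le_div_iff₀ hF0 hsp]
  have hb : |(discriminantSum x n - 3 / 4 * x * A * jacobiMean n) -
      (F - 3 / 4 * x * A * 1) * jacobiMean n| ≤ 72 * n * √x := by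
    refine (abs_sub _ _).trans ?_
    rw [abs_mul]
    have := mul_le_mul h1 hmn (abs_nonneg _) (by positivity)
    push_cast at this
    nlinarith
  calc _ ≤ 72 * n * √x * √x := by gcongr
    _ = 144 / A * n * (A * x / 2) := by rw [mul_assoc, hss]; field_simp; ring
    _ ≤ _ := by gcongr

/-! ### Taylor's formula for `exp (i y)` -/

/-- The derivative of the remainder of order n + 1 is c times the remainder of order n, so the bound
integrates inductively. A general imaginary c lets both signs of the argument be reduced to y ≥ 0.
-/
theorem norm_exp_mul_sub_sum_le {c : ℂ} (hc : c.re = 0) (hc1 : ‖c‖ ≤ 1) (n : ℕ) :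
    ∀ y : ℝ, 0 ≤ y → ‖Complex.exp (c * y) - ∑ m ∈ Finset.range n, (c * y) ^ m / (m.factorial : ℂ)‖ ≤
      y ^ n / n.factorial := by
  induction n with
  | zero =>
    intro y _
    simp [Complex.norm_exp, hc]
  | succ n ih =>
    intro y hy
    have hf' : ∀ x : ℝ, HasDerivAt (fun x : ℝ => Complex.exp (c * x) -
        ∑ m ∈ Finset.range (n + 1), (c * x) ^ m / (m.factorial : ℂ))
        (c * (Complex.exp (c * x) - ∑ m ∈ Finset.range n, (c * x) ^ m / (m.factorial : ℂ))) x := by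
      intro x
      have h0 : HasDerivAt (fun x : ℝ => c * (x : ℂ)) c x := by
        simpa using (Complex.ofRealCLM.hasDerivAt (x := x)).const_mul c
      have h2 : HasDerivAt (fun x : ℝ => ∑ m ∈ Finset.range (n + 1), (c * x) ^ m / (m.factorial : ℂ))
          (∑ m ∈ Finset.range (n + 1), ((m : ℂ) * (c * x) ^ (m - 1) * c) / (m.factorial : ℂ)) x := by
        exact HasDerivAt.fun_sum (u := Finset.range (n + 1))
          (fun m _ => (h0.fun_pow m).div_const (m.factorial : ℂ))
      refine (h0.cexp.fun_sub h2).congr_deriv ?_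
      rw [Finset.sum_range_succ']
      simp only [Nat.cast_zero, zero_mul, zero_div, add_zero, Nat.add_sub_cancel]
      rw [mul_sub, Finset.mul_sum, mul_comm c (Complex.exp (c * x))]
      congr 1
      refine Finset.sum_congr rfl fun m _ => ?_
      rw [Nat.factorial_succ]
      have h1 : ((m : ℂ) + 1) ≠ 0 := by exact_mod_cast Nat.succ_ne_zero m
      have h2 : (m.factorial : ℂ) ≠ 0 := by exact_mod_cast m.factorial_ne_zero
      push_cast
      field_simp
    have hB : ∀ x : ℝ, HasDerivAt (fun x : ℝ => x ^ (n + 1) / (n + 1).factorial)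
        (x ^ n / n.factorial) x := by
      intro x
      refine ((hasDerivAt_pow (n + 1) x).div_const ((n + 1).factorial : ℝ)).congr_deriv ?_
      rw [Nat.factorial_succ]
      have h2 : (n.factorial : ℝ) ≠ 0 := by exact_mod_cast n.factorial_ne_zero
      push_cast
      field_simp
    refine image_norm_le_of_norm_deriv_right_le_deriv_boundary (a := 0) (b := y)
      (fun x _ => (hf' x).continuousAt.continuousWithinAt) (fun x _ => (hf' x).hasDerivWithinAt)
      ?_ hB ?_ ⟨hy, le_rfl⟩
    · simp [Finset.sum_range_succ']
    · intro x hx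
      rw [norm_mul]
      calc _ ≤ 1 * (x ^ n / n.factorial) :=
            mul_le_mul hc1 (ih x hx.1) (norm_nonneg _) zero_le_one
        _ = _ := one_mul _

theorem norm_exp_I_mul_sub_sum_le (n : ℕ) (y : ℝ) :
    ‖Complex.exp (Complex.I * y) - ∑ m ∈ Finset.range n, (Complex.I * y) ^ m / (m.factorial : ℂ)‖ ≤
      |y| ^ n / n.factorial := by
  rcases le_total 0 y with h | h
  · rw [abs_of_nonneg h]
    exact norm_exp_mul_sub_sum_le Complex.I_re (by simp) n y h
  · rw [abs_of_nonpos h]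
    have := norm_exp_mul_sub_sum_le (c := -Complex.I) (by simp) (by simp) n (-y) (by linarith)
    simpa using this

/-! ### Expectations in the random model -/

instance randomModel_isProbabilityMeasure : IsProbabilityMeasure randomModel := by
  unfold randomModel; infer_instance

theorem integral_primeLaw {E : Type*} [NormedAddCommGroup E] [NormedSpace ℝ E] [CompleteSpace E]
    (p : Nat.Primes) (f : ℝ → E) :
    ∫ y, f y ∂(primeLaw p) = (((p : ℕ) : ℝ) / (2 * (((p : ℕ) : ℝ) + 1))) • (f 1 + f (-1)) +
      (1 / (((p : ℕ) : ℝ) + 1)) • f 0 := by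
  have hp : (0 : ℝ) ≤ ((p : ℕ) : ℝ) := Nat.cast_nonneg _
  have hi : ∀ (a c : ℝ), Integrable f (ENNReal.ofReal c • Measure.dirac a) := fun a c =>
    (integrable_dirac (by simp)).smul_measure ENNReal.ofReal_ne_top
  rw [primeLaw, integral_add_measure ((hi _ _).add_measure (hi _ _)) (hi _ _),
    integral_add_measure (hi _ _) (hi _ _)]
  simp only [integral_smul_measure, integral_dirac]
  rw [ENNReal.toReal_ofReal (by positivity), ENNReal.toReal_ofReal (by positivity), smul_add]

theorem integral_randomModel_prod {𝕜 : Type*} [RCLike 𝕜] (P : Finset Nat.Primes)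
    (f : Nat.Primes → ℝ → 𝕜) (hf : ∀ p, Continuous (f p)) :
    ∫ ω, ∏ p ∈ P, f p (ω p) ∂randomModel = ∏ p ∈ P, ∫ y, f p y ∂(primeLaw p) := by
  have hind : ProbabilityTheory.iIndepFun (fun (p : Nat.Primes) (ω : Nat.Primes → ℝ) => ω p)
      randomModel :=
    ProbabilityTheory.iIndepFun_infinitePi (X := fun _ y => y) fun _ => measurable_id
  have hind' := hind.precomp (g := ((↑) : P → Nat.Primes)) Subtype.val_injective
  have hmap : ∀ p : Nat.Primes, ∫ ω, f p (ω p) ∂randomModel = ∫ y, f p y ∂(primeLaw p) := by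
    intro p
    have h := Measure.infinitePi_map_eval primeLaw p
    rw [← h, integral_map (measurable_pi_apply p).aemeasurable (hf p).aestronglyMeasurable]
    rfl
  have := hind'.integral_fun_prod_comp (f := fun p : P => f p)
    (fun p => (measurable_pi_apply _).aemeasurable) (fun p => (hf p).aestronglyMeasurable)
  simp only [hmap] at this
  rw [← Finset.prod_coe_sort P fun p => ∫ y, f p y ∂(primeLaw p), ← this]
  refine integral_congr_ae (ae_of_all _ fun ω => ?_)
  exact (Finset.prod_coe_sort P fun p => f p (ω p)).symm

theorem integral_pow_primeLaw (p : Nat.Primes) {k : ℕ} (hk : k ≠ 0) :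
    ∫ y, y ^ k ∂(primeLaw p) = if Even k then ((p : ℕ) : ℝ) / (((p : ℕ) : ℝ) + 1) else 0 := by
  have hp : ((p : ℕ) : ℝ) + 1 ≠ 0 := by positivity
  rw [integral_primeLaw]
  split_ifs with h
  · simp only [one_pow, h.neg_one_pow, zero_pow hk, smul_eq_mul]
    field_simp
    ring
  · simp [(Nat.not_even_iff_odd.1 h).neg_one_pow, zero_pow hk]

theorem ae_randomModel_abs_le (p : Nat.Primes) : ∀ᵐ ω ∂randomModel, |ω p| ≤ 1 := by
  have h := Measure.infinitePi_map_eval primeLaw p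
  have h1 : ∀ᵐ y ∂(primeLaw p), |y| ≤ 1 := by
    simp only [primeLaw]
    rw [ae_add_measure_iff, ae_add_measure_iff]
    refine ⟨⟨?_, ?_⟩, ?_⟩ <;> refine Measure.ae_smul_measure ?_ _ <;>
      simp [ae_dirac_eq]
  rw [← h] at h1
  exact ae_of_ae_map (measurable_pi_apply p).aemeasurable h1

/-! ### Moments -/

theorem factorization_prod_primes {m : ℕ} (q : Fin m → Nat.Primes) (p : Nat.Primes) :
    (∏ i, (q i : ℕ)).factorization p = (Finset.univ.filter fun i => q i = p).card := by
  rw [Nat.factorization_prod fun i _ => (q i).2.ne_zero, Finset.sum_apply', Finset.card_filter]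
  refine Finset.sum_congr rfl fun i _ => ?_
  rw [(q i).2.factorization, Finsupp.single_apply]
  simp only [Nat.Primes.coe_nat_inj]

theorem primeFactors_prod_primes {m : ℕ} (q : Fin m → Nat.Primes) :
    (∏ i, (q i : ℕ)).primeFactors = (Finset.univ.image q).image fun p : Nat.Primes => (p : ℕ) := by
  have h0 : (∏ i, (q i : ℕ)) ≠ 0 := Finset.prod_ne_zero_iff.2 fun i _ => (q i).2.ne_zero
  ext p
  simp only [Nat.mem_primeFactors, Finset.mem_image, Finset.mem_univ, true_and]
  constructor
  · rintro ⟨hp, hd, _⟩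
    obtain ⟨i, _, hi⟩ := (hp.prime.dvd_finsetProd_iff _).1 hd
    exact ⟨q i, ⟨i, rfl⟩, ((Nat.prime_dvd_prime_iff_eq hp (q i).2).1 hi).symm⟩
  · rintro ⟨_, ⟨i, rfl⟩, rfl⟩
    exact ⟨(q i).2, Finset.dvd_prod_of_mem _ (Finset.mem_univ i), h0⟩

/-- Group equal primes: by independence the expectation is ∏ E 𝕏(p)^k with k the exponent of p in
the product. One odd exponent makes it vanish; otherwise every factor is p/(p+1). -/
theorem integral_prod_eval_randomModel {m : ℕ} (q : Fin m → Nat.Primes) :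
    ∫ ω, ∏ i, ω (q i) ∂randomModel = jacobiMean (∏ i, (q i : ℕ)) := by
  have h0 : (∏ i, (q i : ℕ)) ≠ 0 := Finset.prod_ne_zero_iff.2 fun i _ => (q i).2.ne_zero
  set k : Nat.Primes → ℕ := fun p => (Finset.univ.filter fun i => q i = p).card with hk
  have hfac : ∀ p : Nat.Primes, (∏ i, (q i : ℕ)).factorization p = k p :=
    factorization_prod_primes q
  have hk0 : ∀ p ∈ Finset.univ.image q, k p ≠ 0 := by
    intro p hp
    obtain ⟨i, _, rfl⟩ := Finset.mem_image.1 hp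
    exact (Finset.card_pos.2 ⟨i, by simp⟩).ne'
  simp only [fun ω : Nat.Primes → ℝ => Finset.prod_comp (s := Finset.univ) ω q]
  rw [integral_randomModel_prod (𝕜 := ℝ) _ (fun p y => y ^ k p) fun p => by fun_prop]
  rw [Finset.prod_congr rfl fun p hp => integral_pow_primeLaw p (hk0 p hp)]
  unfold jacobiMean
  split_ifs with hsq
  · have hinj : Set.InjOn (fun p : Nat.Primes => (p : ℕ)) ↑(Finset.univ.image q) :=
      fun a _ b _ h => (Nat.Primes.coe_nat_inj a b).1 h
    rw [primeFactors_prod_primes, Finset.prod_image hinj]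
    refine Finset.prod_congr rfl fun p _ => if_pos ?_
    obtain ⟨r, hr⟩ := hsq
    have hr0 : r ≠ 0 := by rintro rfl; exact h0 hr
    rw [← hfac, hr, Nat.factorization_mul hr0 hr0]
    exact ⟨_, rfl⟩
  · obtain ⟨p', hp, hodd⟩ := exists_odd_factorization h0 hsq
    obtain ⟨p, rfl⟩ : ∃ p : Nat.Primes, (p : ℕ) = p' := ⟨⟨p', hp⟩, rfl⟩
    have hkp := hfac p
    refine Finset.prod_eq_zero (i := p) ?_ (if_neg ?_)
    · by_contra hnot
      have : k p = 0 := by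
        rw [hk, Finset.card_eq_zero, Finset.filter_eq_empty_iff]
        intro i _ hi
        exact hnot (Finset.mem_image.2 ⟨i, Finset.mem_univ i, hi⟩)
      rw [hkp, this] at hodd
      simp at hodd
    · rw [← hkp]
      exact Nat.not_even_iff_odd.2 hodd

/-! ### The law of the character values -/

/-- The law of `χ_D` for `D` uniformly distributed over the fundamental discriminants up to `x`. -/
noncomputable def discriminantLaw (x : ℝ) : Measure (Nat.Primes → ℝ) :=
  ((fundamentalDiscriminants x).card : ENNReal)⁻¹ •
    ∑ D ∈ fundamentalDiscriminants x, Measure.dirac (charValues D)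

theorem discriminantLaw_isProbabilityMeasure {x : ℝ} (hx : 0 < (fundamentalDiscriminants x).card) :
    IsProbabilityMeasure (discriminantLaw x) := by
  constructor
  simp only [discriminantLaw, Measure.smul_apply, Measure.finsetSum_apply, measure_univ,
    Finset.sum_const, nsmul_eq_mul, mul_one, smul_eq_mul]
  exact ENNReal.inv_mul_cancel (by exact_mod_cast hx.ne') (ENNReal.natCast_ne_top _)

theorem ae_discriminantLaw {x : ℝ} {φ : (Nat.Primes → ℝ) → Prop} (h : ∀ D, φ (charValues D)) :
    ∀ᵐ ω ∂discriminantLaw x, φ ω := by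
  refine Measure.ae_smul_measure ?_ _
  rw [ae_iff, Measure.finsetSum_apply]
  refine Finset.sum_eq_zero fun D _ => ?_
  have : ∀ᵐ ω ∂(Measure.dirac (charValues D)), φ ω := by rw [ae_dirac_eq]; exact h D
  exact this

theorem integral_discriminantLaw {E : Type*} [NormedAddCommGroup E] [NormedSpace ℝ E]
    [CompleteSpace E] (x : ℝ) (f : (Nat.Primes → ℝ) → E) :
    ∫ ω, f ω ∂(discriminantLaw x) = ((fundamentalDiscriminants x).card : ℝ)⁻¹ •
      ∑ D ∈ fundamentalDiscriminants x, f (charValues D) := by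
  rw [discriminantLaw, integral_smul_measure, integral_finsetSum_measure]
  · simp
  · intro D _
    exact integrable_dirac (by simp)

theorem abs_charValues_le_one (D : ℤ) (p : Nat.Primes) : |charValues D p| ≤ 1 := by
  have h8 : ∀ z : ZMod 8, |ZMod.χ₈ z| ≤ 1 := by decide
  have hp : ((p : ℕ)) ≠ 0 := p.2.ne_zero
  have hj : ∀ n : ℕ, |jacobiSym D n| ≤ 1 := by
    intro n
    rcases jacobiSym.trichotomy D n with h | h | h <;> simp [h]
  have : |kroneckerChar D p| ≤ 1 := by
    rw [kroneckerChar, if_neg hp, abs_mul, abs_pow]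
    exact mul_le_one₀ (pow_le_one₀ (abs_nonneg _) (h8 _)) (abs_nonneg _) (hj _)
  unfold charValues
  exact_mod_cast this

theorem charValues_eq_jacobiSym (D : ℤ) {p : Nat.Primes} (hp : (p : ℕ) ≠ 2) :
    charValues D p = ((jacobiSym D p : ℤ) : ℝ) := by
  have h2 : padicValNat 2 p = 0 := by
    apply padicValNat.eq_zero_of_not_dvd
    intro h
    exact hp ((Nat.prime_dvd_prime_iff_eq Nat.prime_two p.2).1 h).symm
  simp [charValues, kroneckerChar, h2, p.2.ne_zero]

theorem jacobiSym_finset_prod_right {ι : Type*} (D : ℤ) (s : Finset ι) (q : ι → ℕ)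
    (hq : ∀ i, q i ≠ 0) : jacobiSym D (∏ i ∈ s, q i) = ∏ i ∈ s, jacobiSym D (q i) := by
  classical
  induction s using Finset.induction_on with
  | empty => simp
  | insert i s hi ih =>
    rw [Finset.prod_insert hi, Finset.prod_insert hi, jacobiSym.mul_right' _ (hq i)
      (Finset.prod_ne_zero_iff.2 fun i _ => hq i), ih]

theorem integral_prod_eval_discriminantLaw (x : ℝ) {m : ℕ} (q : Fin m → Nat.Primes)
    (hq : ∀ i, (q i : ℕ) ≠ 2) :
    ∫ ω, ∏ i, ω (q i) ∂(discriminantLaw x) =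
      discriminantSum x (∏ i, (q i : ℕ)) / (fundamentalDiscriminants x).card := by
  rw [integral_discriminantLaw, discriminantSum, smul_eq_mul, div_eq_inv_mul]
  congr 1
  refine Finset.sum_congr rfl fun D _ => ?_
  rw [jacobiSym_finset_prod_right D _ _ fun i => (q i).2.ne_zero]
  push_cast
  exact Finset.prod_congr rfl fun i _ => charValues_eq_jacobiSym D (hq i)

/-- The arithmetic input to the rest of the proof. The prime 2 is excluded because only at odd
primes is the Kronecker symbol read as a Jacobi symbol. -/
theorem exists_moment_comparison : ∃ C x₀ : ℝ, 0 < C ∧ 0 < x₀ ∧ ∀ x : ℝ, x₀ ≤ x →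
    IsProbabilityMeasure (discriminantLaw x) ∧
      ∀ (m : ℕ) (q : Fin m → Nat.Primes), (∀ i, (q i : ℕ) ≠ 2) →
        |∫ ω, ∏ i, ω (q i) ∂(discriminantLaw x) - ∫ ω, ∏ i, ω (q i) ∂randomModel| ≤
          C / √x * ∏ i, ((q i : ℕ) : ℝ) := by
  obtain ⟨C, x₀, hC, hx₀, h⟩ := exists_abs_discriminantSum_div_sub_le
  refine ⟨C, x₀, hC, hx₀, fun x hx => ⟨discriminantLaw_isProbabilityMeasure (h x hx).1,
    fun m q hq => ?_⟩⟩
  rw [integral_prod_eval_discriminantLaw x q hq, integral_prod_eval_randomModel]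
  refine ((h x hx).2 _ ?_).trans (le_of_eq ?_)
  · refine Finset.prod_induction _ Odd (fun a b => Odd.mul) odd_one fun i _ => ?_
    exact (q i).2.odd_of_ne_two (hq i)
  · push_cast
    ring

/-! ### Characteristic functions of linear forms -/

/-- The linear form `∑ c_p ω_p` over a finite set of primes. -/
noncomputable def linForm (P : Finset Nat.Primes) (c ω : Nat.Primes → ℝ) : ℝ :=
  ∑ p ∈ P, c p * ω p

theorem measurable_linForm (P : Finset Nat.Primes) (c : Nat.Primes → ℝ) :
    Measurable (linForm P c) :=
  Finset.measurable_fun_sum _ fun p _ => (measurable_pi_apply p).const_mul _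

theorem abs_linForm_le {P : Finset Nat.Primes} {c ω : Nat.Primes → ℝ} (h : ∀ p, |ω p| ≤ 1) :
    |linForm P c ω| ≤ ∑ p ∈ P, |c p| := by
  refine (Finset.abs_sum_le_sum_abs _ _).trans (Finset.sum_le_sum fun p _ => ?_)
  rw [abs_mul]
  exact mul_le_of_le_one_right (abs_nonneg _) (h p)

section

variable {μ : Measure (Nat.Primes → ℝ)} [IsProbabilityMeasure μ]

theorem integrable_comp_linForm {E : Type*} [NormedAddCommGroup E] [SecondCountableTopology E]
    (hμ : ∀ᵐ ω ∂μ, ∀ p, |ω p| ≤ 1) (P : Finset Nat.Primes) (c : Nat.Primes → ℝ) {g : ℝ → E}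
    (hg : Continuous g) : Integrable (fun ω => g (linForm P c ω)) μ := by
  obtain ⟨M, hM⟩ := (isCompact_Icc (a := -∑ p ∈ P, |c p|) (b := ∑ p ∈ P, |c p|)).exists_bound_of_continuousOn
    hg.continuousOn
  refine Integrable.of_bound (hg.stronglyMeasurable.comp_measurable
    (measurable_linForm P c)).aestronglyMeasurable M ?_
  filter_upwards [hμ] with ω hω
  exact hM _ (Set.mem_Icc.2 (abs_le.1 (abs_linForm_le hω)))

theorem integrable_prod_eval (hμ : ∀ᵐ ω ∂μ, ∀ p, |ω p| ≤ 1) {m : ℕ} (q : Fin m → Nat.Primes) :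
    Integrable (fun ω => ∏ i, ω (q i)) μ := by
  refine Integrable.of_bound (Finset.measurable_fun_prod _ fun i _ =>
    measurable_pi_apply (q i)).aestronglyMeasurable 1 ?_
  filter_upwards [hμ] with ω hω
  rw [Real.norm_eq_abs, Finset.abs_prod]
  exact Finset.prod_le_one (fun _ _ => abs_nonneg _) fun i _ => hω (q i)

theorem integral_linForm_pow (hμ : ∀ᵐ ω ∂μ, ∀ p, |ω p| ≤ 1) (P : Finset Nat.Primes)
    (c : Nat.Primes → ℝ) (m : ℕ) :
    ∫ ω, linForm P c ω ^ m ∂μ = ∑ q ∈ Fintype.piFinset (fun _ : Fin m => P),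
      (∏ i, c (q i)) * ∫ ω, ∏ i, ω (q i) ∂μ := by
  have h : ∀ ω, linForm P c ω ^ m = ∑ q ∈ Fintype.piFinset (fun _ : Fin m => P),
      (∏ i, c (q i)) * ∏ i, ω (q i) := by
    intro ω
    have := Finset.prod_univ_sum (fun _ : Fin m => P) (fun _ p => c p * ω p)
    simp only [Finset.prod_const, Finset.card_univ, Fintype.card_fin] at this
    rw [linForm, this]
    exact Finset.sum_congr rfl fun q _ => Finset.prod_mul_distrib
  simp only [h]
  rw [integral_finsetSum _ fun q _ => (integrable_prod_eval hμ q).const_mul _]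
  simp only [integral_const_mul]

variable {ν : Measure (Nat.Primes → ℝ)} [IsProbabilityMeasure ν]

/-- The m-th power expands over m-tuples of primes; the error for a tuple is proportional to the
product of its primes, so the errors recombine into an m-th power with weights |c_p| p. -/
theorem abs_integral_linForm_pow_sub_le (hμ : ∀ᵐ ω ∂μ, ∀ p, |ω p| ≤ 1)
    (hν : ∀ᵐ ω ∂ν, ∀ p, |ω p| ≤ 1) {δ : ℝ} {P : Finset Nat.Primes}
    (c : Nat.Primes → ℝ) (m : ℕ)
    (hδ : ∀ q : Fin m → Nat.Primes, (∀ i, q i ∈ P) →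
      |∫ ω, ∏ i, ω (q i) ∂μ - ∫ ω, ∏ i, ω (q i) ∂ν| ≤ δ * ∏ i, ((q i : ℕ) : ℝ)) :
    |∫ ω, linForm P c ω ^ m ∂μ - ∫ ω, linForm P c ω ^ m ∂ν| ≤
      δ * (∑ p ∈ P, |c p| * ((p : ℕ) : ℝ)) ^ m := by
  rw [integral_linForm_pow hμ, integral_linForm_pow hν, ← Finset.sum_sub_distrib]
  have h := Finset.prod_univ_sum (fun _ : Fin m => P) (fun _ p => |c p| * ((p : ℕ) : ℝ))
  simp only [Finset.prod_const, Finset.card_univ, Fintype.card_fin] at h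
  rw [h, Finset.mul_sum]
  refine (Finset.abs_sum_le_sum_abs _ _).trans (Finset.sum_le_sum fun q hq => ?_)
  rw [← mul_sub, abs_mul, Finset.abs_prod, Finset.prod_mul_distrib, mul_left_comm]
  exact mul_le_mul_of_nonneg_left (hδ q (Fintype.mem_piFinset.1 hq))
    (Finset.prod_nonneg fun _ _ => abs_nonneg _)

/-- Characteristic functions of a linear form agree under two laws with nearly equal moments. -/
theorem norm_integral_exp_linForm_sub_le (hμ : ∀ᵐ ω ∂μ, ∀ p, |ω p| ≤ 1)
    (hν : ∀ᵐ ω ∂ν, ∀ p, |ω p| ≤ 1) {δ W : ℝ} (hδ0 : 0 ≤ δ) {P : Finset Nat.Primes}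
    (c : Nat.Primes → ℝ) (hW : ∑ p ∈ P, |c p| * ((p : ℕ) : ℝ) ≤ W) (hW1 : 1 ≤ W)
    (hδ : ∀ (m : ℕ) (q : Fin m → Nat.Primes), (∀ i, q i ∈ P) →
      |∫ ω, ∏ i, ω (q i) ∂μ - ∫ ω, ∏ i, ω (q i) ∂ν| ≤ δ * ∏ i, ((q i : ℕ) : ℝ)) (K : ℕ) :
    ‖∫ ω, Complex.exp (Complex.I * linForm P c ω) ∂μ -
      ∫ ω, Complex.exp (Complex.I * linForm P c ω) ∂ν‖ ≤
      2 * (∫ ω, linForm P c ω ^ (2 * K) / (2 * K).factorial ∂ν) + 4 * δ * W ^ (2 * K) := by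
  set Y := linForm P c
  set n := 2 * K with hn
  have hW0 : 0 ≤ ∑ p ∈ P, |c p| * ((p : ℕ) : ℝ) := Finset.sum_nonneg fun _ _ => by positivity
  have hmom : ∀ m ≤ n, |∫ ω, Y ω ^ m ∂μ - ∫ ω, Y ω ^ m ∂ν| ≤ δ * W ^ n := by
    intro m hm
    refine (abs_integral_linForm_pow_sub_le hμ hν c m (hδ m)).trans ?_
    gcongr
    exact (pow_le_pow_left₀ hW0 hW m).trans (pow_le_pow_right₀ hW1 hm)
  set T : ℝ → ℂ := fun y => ∑ m ∈ Finset.range n, (Complex.I * y) ^ m / (m.factorial : ℂ) with hT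
  have hTc : Continuous T := by fun_prop
  have hEc : Continuous fun y : ℝ => Complex.exp (Complex.I * y) := by fun_prop
  have hfac : ∀ m : ℕ, (1 : ℝ) ≤ m.factorial := fun m => by exact_mod_cast m.factorial_pos
  have hrem : ∀ (ρ : Measure (Nat.Primes → ℝ)) [IsProbabilityMeasure ρ],
      (∀ᵐ ω ∂ρ, ∀ p, |ω p| ≤ 1) →
      ‖∫ ω, Complex.exp (Complex.I * Y ω) ∂ρ - ∫ ω, T (Y ω) ∂ρ‖ ≤
        ∫ ω, Y ω ^ n / n.factorial ∂ρ := by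
    intro ρ _ hρ
    rw [← integral_sub (integrable_comp_linForm hρ P c hEc) (integrable_comp_linForm hρ P c hTc)]
    refine norm_integral_le_of_norm_le (integrable_comp_linForm hρ P c
      (g := fun y => y ^ n / n.factorial) (by fun_prop)) (ae_of_all _ fun ω => ?_)
    have := norm_exp_I_mul_sub_sum_le n (Y ω)
    rwa [Even.pow_abs (even_two_mul K)] at this
  have hTint : ∀ (ρ : Measure (Nat.Primes → ℝ)) [IsProbabilityMeasure ρ],
      (∀ᵐ ω ∂ρ, ∀ p, |ω p| ≤ 1) → ∫ ω, T (Y ω) ∂ρ =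
        ∑ m ∈ Finset.range n, Complex.I ^ m / (m.factorial : ℂ) * ((∫ ω, Y ω ^ m ∂ρ : ℝ) : ℂ) := by
    intro ρ _ hρ
    simp only [hT]
    rw [integral_finsetSum _ fun m _ => integrable_comp_linForm hρ P c
      (g := fun y : ℝ => (Complex.I * y) ^ m / (m.factorial : ℂ)) (by fun_prop)]
    refine Finset.sum_congr rfl fun m _ => ?_
    rw [← integral_complex_ofReal, ← integral_const_mul]
    refine integral_congr_ae (ae_of_all _ fun ω => ?_)
    push_cast
    ring
  have h1 := hrem μ hμ
  have h2 := hrem ν hν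
  -- The Taylor polynomials differ by at most ∑ 1/m! ≤ e < 3 times the moment error.
  have h3 : ‖∫ ω, T (Y ω) ∂μ - ∫ ω, T (Y ω) ∂ν‖ ≤ 3 * (δ * W ^ n) := by
    rw [hTint μ hμ, hTint ν hν, ← Finset.sum_sub_distrib]
    have he : ∑ m ∈ Finset.range n, (1 : ℝ) / m.factorial ≤ 3 := by
      have := Real.sum_le_exp_of_nonneg (x := 1) zero_le_one n
      simp only [one_pow] at this
      exact this.trans (Real.exp_one_lt_d9.le.trans (by norm_num))
    refine (norm_sum_le _ _).trans (le_trans ?_ (mul_le_mul_of_nonneg_right he (by positivity)))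
    rw [Finset.sum_mul]
    refine Finset.sum_le_sum fun m hm => ?_
    rw [← mul_sub, norm_mul, norm_div, norm_pow, Complex.norm_I, one_pow, Complex.norm_natCast,
      ← Complex.ofReal_sub, Complex.norm_real, Real.norm_eq_abs]
    exact mul_le_mul_of_nonneg_left (hmom m (Finset.mem_range.1 hm).le) (by positivity)
  -- The exponent n = 2K is even, so the remainder under μ is itself a moment and can be moved to ν.
  -- This adds one δW^n to the three from the Taylor polynomials.
  have h4 : ∫ ω, Y ω ^ n / n.factorial ∂μ ≤ ∫ ω, Y ω ^ n / n.factorial ∂ν + δ * W ^ n := by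
    rw [integral_div, integral_div]
    have h5 := (le_abs_self _).trans (hmom n le_rfl)
    have h6 := hfac n
    rw [← sub_le_iff_le_add', ← sub_div]
    refine (div_le_div_of_nonneg_right h5 (by linarith)).trans ?_
    exact div_le_self (by positivity) h6
  have h7 : ∀ a b a' b' : ℂ, ‖a - b‖ ≤ ‖a - a'‖ + ‖a' - b'‖ + ‖b - b'‖ := by
    intro a b a' b'
    have : a - b = (a - a') + (a' - b') - (b - b') := by ring
    rw [this]
    exact (norm_sub_le _ _).trans (add_le_add_left (norm_add_le _ _) _)
  refine (h7 _ _ (∫ ω, T (Y ω) ∂μ) (∫ ω, T (Y ω) ∂ν)).trans ?_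
  linarith

end

/-! ### Linear forms in the random model -/

theorem ae_randomModel : ∀ᵐ ω ∂randomModel, ∀ p, |ω p| ≤ 1 :=
  ae_all_iff.2 ae_randomModel_abs_le

/-- Sub-Gaussian bound: each factor averages cosh c_p with the value 1 taken at 𝕏(p) = 0, so it is
at most cosh c_p ≤ exp(c_p²/2). -/
theorem integral_exp_linForm_randomModel_le (P : Finset Nat.Primes) (c : Nat.Primes → ℝ) :
    ∫ ω, Real.exp (linForm P c ω) ∂randomModel ≤ Real.exp ((∑ p ∈ P, c p ^ 2) / 2) := by
  simp only [linForm, Real.exp_sum]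
  have := integral_randomModel_prod (𝕜 := ℝ) P (fun p y => Real.exp (c p * y)) fun p => by fun_prop
  rw [this, Finset.sum_div, Real.exp_sum]
  refine Finset.prod_le_prod (fun p _ => integral_nonneg fun y => (Real.exp_pos _).le) fun p _ => ?_
  rw [integral_primeLaw]
  refine le_trans ?_ (Real.cosh_le_exp_half_sq (c p))
  have hp : (0 : ℝ) ≤ ((p : ℕ) : ℝ) := Nat.cast_nonneg _
  have h1 := Real.one_le_cosh (c p)
  have h2 : Real.exp (c p * 1) + Real.exp (c p * -1) = 2 * Real.cosh (c p) := by
    rw [mul_one, mul_neg_one, Real.cosh_eq]; ring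
  rw [h2, mul_zero, Real.exp_zero, smul_eq_mul, smul_eq_mul]
  have e : ((p : ℕ) : ℝ) / (2 * (((p : ℕ) : ℝ) + 1)) * (2 * Real.cosh (c p)) +
      1 / (((p : ℕ) : ℝ) + 1) * 1 = (((p : ℕ) : ℝ) * Real.cosh (c p) + 1) / (((p : ℕ) : ℝ) + 1) := by
    field_simp
  rw [e, div_le_iff₀ (by linarith)]
  linarith

/-- From z^{2K}/(2K)! ≤ e^z at z = e|y|, the scaling by e producing the saving e^{-2K}. The
exponential moment then has exponent (e²/2)∑c_p², and e² ≤ 8. -/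
theorem integral_linForm_pow_div_factorial_le (P : Finset Nat.Primes) (c : Nat.Primes → ℝ) (K : ℕ) :
    ∫ ω, linForm P c ω ^ (2 * K) / (2 * K).factorial ∂randomModel ≤
      2 * Real.exp (4 * ∑ p ∈ P, c p ^ 2 - 2 * K) := by
  set e := Real.exp 1 with he
  have he0 : 0 < e := Real.exp_pos 1
  have hpt : ∀ y : ℝ, y ^ (2 * K) / (2 * K).factorial ≤
      (e ^ (2 * K))⁻¹ * (Real.exp (e * y) + Real.exp (-e * y)) := by
    intro y
    have h1 := Real.pow_div_factorial_le_exp (e * |y|) (by positivity) (2 * K)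
    rw [mul_pow, Even.pow_abs (even_two_mul K)] at h1
    have h2 : Real.exp (e * |y|) ≤ Real.exp (e * y) + Real.exp (-e * y) := by
      rcases abs_cases y with ⟨h, _⟩ | ⟨h, _⟩ <;> rw [h]
      · linarith [Real.exp_pos (-e * y)]
      · rw [mul_neg, ← neg_mul]
        linarith [Real.exp_pos (e * y)]
    rw [← div_eq_inv_mul, le_div_iff₀ (by positivity)]
    calc _ = e ^ (2 * K) * y ^ (2 * K) / (2 * K).factorial := by ring
      _ ≤ _ := h1.trans h2
  have hint : ∀ t : ℝ, Integrable (fun ω => Real.exp (t * linForm P c ω)) randomModel := fun t =>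
    integrable_comp_linForm ae_randomModel P c (g := fun y => Real.exp (t * y)) (by fun_prop)
  have hlin : ∀ t ω, t * linForm P c ω = linForm P (fun p => t * c p) ω := by
    intro t ω
    simp only [linForm, Finset.mul_sum, mul_assoc]
  have hexp : ∀ t : ℝ, t ^ 2 = e ^ 2 →
      ∫ ω, Real.exp (t * linForm P c ω) ∂randomModel ≤ Real.exp (4 * ∑ p ∈ P, c p ^ 2) := by
    intro t ht
    simp only [hlin]
    refine (integral_exp_linForm_randomModel_le _ _).trans (Real.exp_le_exp.2 ?_)
    simp only [mul_pow, ht, ← Finset.mul_sum]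
    have : e ^ 2 ≤ 8 := by
      have := Real.exp_one_lt_d9
      nlinarith
    have hS : 0 ≤ ∑ p ∈ P, c p ^ 2 := Finset.sum_nonneg fun _ _ => sq_nonneg _
    nlinarith
  have hmono := integral_mono (integrable_comp_linForm ae_randomModel P c
    (g := fun y => y ^ (2 * K) / (2 * K).factorial) (by fun_prop))
    (((hint e).add (hint (-e))).const_mul (e ^ (2 * K))⁻¹) (fun ω => hpt (linForm P c ω))
  refine hmono.trans ?_
  simp only [Pi.add_apply]
  rw [integral_const_mul, integral_add (hint e) (hint (-e)), Real.exp_sub, div_eq_inv_mul]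
  have hek : Real.exp (2 * K) = e ^ (2 * K) := by
    rw [he, ← Real.exp_nat_mul]
    push_cast
    rw [mul_one]
  rw [hek, mul_left_comm]
  refine mul_le_mul_of_nonneg_left ?_ (by positivity)
  linarith [hexp e rfl, hexp (-e) (by ring)]

/-- Each factor is 1 - (p/(p+1))(1 - cos c_p). Here p/(p+1) ≥ 1/2 and 1 - cos c ≥ 2c²/π² ≥ c²/5, so
the factor is at most 1 - c_p²/10. The condition |c_p| ≤ 1 makes cos c_p, hence the factor,
non-negative. -/
theorem norm_integral_exp_linForm_randomModel_le (P : Finset Nat.Primes) (c : Nat.Primes → ℝ)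
    (hc : ∀ p ∈ P, |c p| ≤ 1) :
    ‖∫ ω, Complex.exp (Complex.I * linForm P c ω) ∂randomModel‖ ≤
      Real.exp (-(∑ p ∈ P, c p ^ 2) / 10) := by
  have h1 : ∀ ω, Complex.exp (Complex.I * linForm P c ω) =
      ∏ p ∈ P, Complex.exp (Complex.I * ((c p * ω p : ℝ) : ℂ)) := by
    intro ω
    rw [linForm, ← Complex.exp_sum, Complex.ofReal_sum, Finset.mul_sum]
  simp only [h1]
  have := integral_randomModel_prod (𝕜 := ℂ) P
    (fun p y => Complex.exp (Complex.I * ((c p * y : ℝ) : ℂ))) fun p => by fun_prop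
  rw [this, norm_prod, neg_div, Finset.sum_div, ← Finset.sum_neg_distrib, Real.exp_sum]
  refine Finset.prod_le_prod (fun _ _ => norm_nonneg _) fun p hp => ?_
  rw [integral_primeLaw]
  have hp2 : (2 : ℝ) ≤ ((p : ℕ) : ℝ) := by exact_mod_cast p.2.two_le
  have h2 : Complex.exp (Complex.I * ((c p * 1 : ℝ) : ℂ)) +
      Complex.exp (Complex.I * ((c p * -1 : ℝ) : ℂ)) = ((2 * Real.cos (c p) : ℝ) : ℂ) := by
    push_cast
    rw [Complex.cos]
    ring_nf
  have h3 : Complex.exp (Complex.I * ((c p * 0 : ℝ) : ℂ)) = ((1 : ℝ) : ℂ) := by simp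
  rw [h2, h3, Complex.real_smul, Complex.real_smul, ← Complex.ofReal_mul, ← Complex.ofReal_mul,
    ← Complex.ofReal_add, Complex.norm_real, Real.norm_eq_abs]
  have e : ((p : ℕ) : ℝ) / (2 * (((p : ℕ) : ℝ) + 1)) * (2 * Real.cos (c p)) +
      1 / (((p : ℕ) : ℝ) + 1) * 1 =
      1 - ((p : ℕ) : ℝ) / (((p : ℕ) : ℝ) + 1) * (1 - Real.cos (c p)) := by
    field_simp
    ring
  rw [e]
  have hq := Real.cos_le_one_sub_mul_cos_sq (x := c p) ((hc p hp).trans (by linarith [Real.pi_gt_three]))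
  have hc0 : 0 ≤ Real.cos (c p) := Real.cos_nonneg_of_mem_Icc (by
    have := abs_le.1 (hc p hp)
    constructor <;> linarith [Real.pi_gt_three])
  have hfrac : 1 / 2 ≤ ((p : ℕ) : ℝ) / (((p : ℕ) : ℝ) + 1) := by
    rw [div_le_div_iff₀ (by norm_num) (by linarith)]; linarith
  have hfrac1 : ((p : ℕ) : ℝ) / (((p : ℕ) : ℝ) + 1) ≤ 1 := by
    rw [div_le_one (by linarith)]; linarith
  have hcos1 := Real.cos_le_one (c p)
  have hpi : (1 : ℝ) / 5 ≤ 2 / Real.pi ^ 2 := by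
    rw [div_le_div_iff₀ (by norm_num) (by positivity)]
    nlinarith [Real.pi_lt_d2, Real.pi_pos]
  have hone : c p ^ 2 / 5 ≤ 1 - Real.cos (c p) := by
    nlinarith [sq_nonneg (c p)]
  rw [abs_of_nonneg (by nlinarith)]
  refine le_trans ?_ (Real.add_one_le_exp _)
  nlinarith

/-! ### Trigonometric sums -/

/-- `f` is a finite sum of exponentials with integer frequencies at most `L` in absolute value, and
with coefficients of absolute sum at most `A`. -/
def IsTrigSum (L : ℤ) (A : ℝ) (f : ℝ → ℂ) : Prop :=
  ∃ (ι : Type) (s : Finset ι) (c : ι → ℂ) (m : ι → ℤ),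
    (∀ x : ℝ, f x = ∑ i ∈ s, c i * Complex.exp (Complex.I * (m i * x))) ∧
      (∀ i ∈ s, |m i| ≤ L) ∧ ∑ i ∈ s, ‖c i‖ ≤ A

theorem IsTrigSum.mul {L L' : ℤ} {A A' : ℝ} {f g : ℝ → ℂ} (hf : IsTrigSum L A f)
    (hg : IsTrigSum L' A' g) : IsTrigSum (L + L') (A * A') fun x => f x * g x := by
  obtain ⟨ι, s, c, m, hf, hm, hA⟩ := hf
  obtain ⟨ι', s', c', m', hg, hm', hA'⟩ := hg
  refine ⟨ι × ι', s ×ˢ s', fun i => c i.1 * c' i.2, fun i => m i.1 + m' i.2, ?_, ?_, ?_⟩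
  · intro x
    beta_reduce
    rw [hf, hg, Finset.sum_mul_sum, Finset.sum_product]
    refine Finset.sum_congr rfl fun i _ => Finset.sum_congr rfl fun i' _ => ?_
    push_cast
    rw [add_mul, mul_add, Complex.exp_add]
    ring
  · intro i hi
    rw [Finset.mem_product] at hi
    exact (abs_add_le _ _).trans (add_le_add (hm _ hi.1) (hm' _ hi.2))
  · simp only [norm_mul]
    rw [Finset.sum_product]
    dsimp only
    rw [← Finset.sum_mul_sum]
    have h0 : 0 ≤ ∑ i ∈ s', ‖c' i‖ := Finset.sum_nonneg fun _ _ => norm_nonneg _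
    exact mul_le_mul hA hA' h0 ((Finset.sum_nonneg fun _ _ => norm_nonneg _).trans hA)

theorem IsTrigSum.comp_sub {L : ℤ} {A : ℝ} {f : ℝ → ℂ} (hf : IsTrigSum L A f) (y : ℝ) :
    IsTrigSum L A fun x => f (x - y) := by
  obtain ⟨ι, s, c, m, hf, hm, hA⟩ := hf
  refine ⟨ι, s, fun i => c i * Complex.exp (Complex.I * ((-(m i * y) : ℝ) : ℂ)), m, ?_, hm, ?_⟩
  · intro x
    beta_reduce
    rw [hf]
    refine Finset.sum_congr rfl fun i _ => ?_
    rw [mul_assoc, ← Complex.exp_add]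
    push_cast
    ring_nf
  · refine le_trans (le_of_eq (Finset.sum_congr rfl fun i _ => ?_)) hA
    rw [norm_mul, mul_comm Complex.I, Complex.norm_exp_ofReal_mul_I, mul_one]

theorem IsTrigSum.const_mul {L : ℤ} {A : ℝ} {f : ℝ → ℂ} (hf : IsTrigSum L A f) (k : ℂ) :
    IsTrigSum L (‖k‖ * A) fun x => k * f x := by
  obtain ⟨ι, s, c, m, hf, hm, hA⟩ := hf
  refine ⟨ι, s, fun i => k * c i, m, ?_, hm, ?_⟩
  · intro x
    beta_reduce
    rw [hf, Finset.mul_sum]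
    exact Finset.sum_congr rfl fun i _ => (mul_assoc _ _ _).symm
  · simp only [norm_mul, ← Finset.mul_sum]
    exact mul_le_mul_of_nonneg_left hA (norm_nonneg _)

theorem IsTrigSum.sum {κ : Type} (t : Finset κ) {L : ℤ} {A : ℝ} {f : κ → ℝ → ℂ}
    (hf : ∀ k, IsTrigSum L A (f k)) : IsTrigSum L (t.card * A) fun x => ∑ k ∈ t, f k x := by
  choose ι s c m hf hm hA using hf
  refine ⟨Σ k, ι k, t.sigma s, fun i => c i.1 i.2, fun i => m i.1 i.2, ?_, ?_, ?_⟩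
  · intro x
    rw [Finset.sum_sigma]
    exact Finset.sum_congr rfl fun k _ => hf k x
  · rintro ⟨k, i⟩ hi
    exact hm k i (Finset.mem_sigma.1 hi).2
  · rw [Finset.sum_sigma, ← nsmul_eq_mul]
    exact Finset.sum_le_card_nsmul _ _ _ fun k _ => hA k

theorem isTrigSum_one (L : ℤ) (hL : 0 ≤ L) : IsTrigSum L 1 fun _ => 1 :=
  ⟨Unit, {()}, fun _ => 1, fun _ => 0, by simp, by simpa using hL, by simp⟩

theorem IsTrigSum.mono {L L' : ℤ} {A A' : ℝ} {f : ℝ → ℂ} (hf : IsTrigSum L A f) (hL : L ≤ L')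
    (hA : A ≤ A') : IsTrigSum L' A' f := by
  obtain ⟨ι, s, c, m, hf, hm, h⟩ := hf
  exact ⟨ι, s, c, m, hf, fun i hi => (hm i hi).trans hL, h.trans hA⟩

theorem IsTrigSum.continuous {L : ℤ} {A : ℝ} {f : ℝ → ℂ} (hf : IsTrigSum L A f) :
    Continuous f := by
  obtain ⟨ι, s, c, m, hf, _⟩ := hf
  have : f = fun x : ℝ => ∑ i ∈ s, c i * Complex.exp (Complex.I * (m i * x)) := funext hf
  rw [this]
  fun_prop

/-- The equally spaced points `-π + 2πk/M`. -/
noncomputable def gridPoint (M k : ℕ) : ℝ := -Real.pi + 2 * Real.pi * k / M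

theorem abs_gridPoint_le {M k : ℕ} (hk : k < M) : |gridPoint M k| ≤ Real.pi := by
  have hM : (0 : ℝ) < M := by exact_mod_cast (Nat.zero_le k).trans_lt hk
  have h1 : (k : ℝ) / M ≤ 1 := by
    rw [div_le_one hM]; exact_mod_cast hk.le
  have h0 : 0 ≤ (k : ℝ) / M := by positivity
  have hpi := Real.pi_pos
  rw [gridPoint, mul_div_assoc, abs_le]
  constructor <;> nlinarith

theorem sum_exp_gridPoint {M : ℕ} {m : ℤ} (hm : |m| < M) (x : ℝ) :
    ∑ k ∈ Finset.range M, Complex.exp (Complex.I * (m * ((x - gridPoint M k : ℝ) : ℂ))) =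
      if m = 0 then (M : ℂ) else 0 := by
  split_ifs with h0
  · simp [h0]
  · have hM : M ≠ 0 := by rintro rfl; simp at hm; linarith [abs_nonneg m]
    have hMc : (M : ℂ) ≠ 0 := by exact_mod_cast hM
    set w : ℂ := Complex.exp (2 * Real.pi * Complex.I * (-(m / M))) with hw
    have hterm : ∀ k : ℕ, Complex.exp (Complex.I * (m * ((x - gridPoint M k : ℝ) : ℂ))) =
        Complex.exp (Complex.I * (m * (x + Real.pi))) * w ^ k := by
      intro k
      rw [hw, ← Complex.exp_nat_mul, ← Complex.exp_add, gridPoint]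
      congr 1
      push_cast
      field_simp
      ring
    simp only [hterm, ← Finset.mul_sum]
    have hw1 : w ≠ 1 := by
      rw [hw, Ne, Complex.exp_eq_one_iff]
      rintro ⟨n, hn⟩
      have h2 : (2 * Real.pi * Complex.I : ℂ) ≠ 0 := Complex.two_pi_I_ne_zero
      have h3 : (-(m / M) : ℂ) = n := by
        apply mul_left_cancel₀ h2
        rw [hn]; ring
      have h4 : (m : ℂ) = -(n * M) := by
        field_simp at h3
        linear_combination -h3
      have h5 : m = -(n * M) := by exact_mod_cast h4
      rcases eq_or_ne n 0 with rfl | hn0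
      · simp at h5; exact h0 h5
      · have : 1 ≤ |n| := Int.one_le_abs hn0
        rw [h5, abs_neg, abs_mul, Nat.abs_cast] at hm
        nlinarith
    have hwM : w ^ M = 1 := by
      rw [hw, ← Complex.exp_nat_mul, Complex.exp_eq_one_iff]
      refine ⟨-m, ?_⟩
      push_cast
      field_simp
    rw [geom_sum_eq hw1, hwM, sub_self, zero_div, mul_zero]

/-- Averaging over M equally spaced points annihilates every non-zero frequency below M, leaving the
constant term. Grid translates of a kernel are thus an exact partition of a constant. -/
theorem IsTrigSum.exists_sum_gridPoint_eq {L : ℤ} {A : ℝ} {f : ℝ → ℂ} (hf : IsTrigSum L A f)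
    {M : ℕ} (hL : L < M) : ∃ S : ℂ, ∀ x, ∑ k ∈ Finset.range M, f (x - gridPoint M k) = S := by
  obtain ⟨ι, s, c, m, hf, hm, -⟩ := hf
  refine ⟨∑ i ∈ s, c i * if m i = 0 then (M : ℂ) else 0, fun x => ?_⟩
  simp only [hf]
  rw [Finset.sum_comm]
  refine Finset.sum_congr rfl fun i hi => ?_
  rw [← Finset.mul_sum, sum_exp_gridPoint ((hm i hi).trans_lt hL)]

/-! ### A zero-free positive kernel -/

/-- The truncated geometric series `∑_{k < N} r ^ k e ^ {ikφ}` with `r = 1 - 1 / N`. -/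
noncomputable def geomKernel (N : ℕ) (φ : ℝ) : ℂ :=
  ∑ k ∈ Finset.range N, ((1 - 1 / (N : ℝ) : ℝ) * Complex.exp (Complex.I * φ)) ^ k

/-- The kernel `|∑_{k < N} r ^ k e ^ {ikφ}| ^ 2 / N ^ 2`, of size `(1 + N |φ|) ^ {-2}`. -/
noncomputable def posKernel (N : ℕ) (φ : ℝ) : ℝ := ‖geomKernel N φ‖ ^ 2 / (N : ℝ) ^ 2

theorem posKernel_nonneg (N : ℕ) (φ : ℝ) : 0 ≤ posKernel N φ := by
  unfold posKernel; positivity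

theorem posKernel_eq_sum (N : ℕ) (φ : ℝ) : (posKernel N φ : ℂ) =
    ∑ i ∈ Finset.range N ×ˢ Finset.range N,
      (((1 - 1 / (N : ℝ)) ^ (i.1 + i.2) / (N : ℝ) ^ 2 : ℝ) : ℂ) *
        Complex.exp (Complex.I * ((((i.1 : ℤ) - (i.2 : ℤ) : ℤ) : ℂ) * φ)) := by
  have h : ((‖geomKernel N φ‖ ^ 2 : ℝ) : ℂ) =
      geomKernel N φ * (starRingEnd ℂ) (geomKernel N φ) := by
    rw [Complex.mul_conj, Complex.normSq_eq_norm_sq]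
  rw [posKernel, Complex.ofReal_div, h, geomKernel, map_sum, Finset.sum_mul_sum, Finset.sum_product,
    Finset.sum_div]
  refine Finset.sum_congr rfl fun j _ => ?_
  rw [Finset.sum_div]
  refine Finset.sum_congr rfl fun k _ => ?_
  rw [map_pow, map_mul, Complex.conj_ofReal, ← Complex.exp_conj, map_mul, Complex.conj_I,
    Complex.conj_ofReal, mul_pow, mul_pow, ← Complex.exp_nat_mul, ← Complex.exp_nat_mul]
  have e : Complex.exp (Complex.I * ((((j : ℤ) - (k : ℤ) : ℤ) : ℂ) * φ)) =
      Complex.exp (j * (Complex.I * φ)) * Complex.exp (k * (-Complex.I * φ)) := by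
    rw [← Complex.exp_add]
    congr 1
    push_cast
    ring
  rw [e]
  push_cast
  ring

theorem one_sub_inv_mem {N : ℕ} (hN : 2 ≤ N) :
    1 / 2 ≤ 1 - 1 / (N : ℝ) ∧ 1 - 1 / (N : ℝ) ≤ 1 := by
  have hN2 : (2 : ℝ) ≤ N := by exact_mod_cast hN
  have h1 : 1 / (N : ℝ) ≤ 1 / 2 := one_div_le_one_div_of_le (by norm_num) hN2
  have h0 : 0 ≤ 1 / (N : ℝ) := by positivity
  constructor <;> linarith

theorem posKernel_coeff_mem {N : ℕ} (hN : 2 ≤ N) (j : ℕ) :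
    0 ≤ (1 - 1 / (N : ℝ)) ^ j / (N : ℝ) ^ 2 ∧
      (1 - 1 / (N : ℝ)) ^ j / (N : ℝ) ^ 2 ≤ 1 / (N : ℝ) ^ 2 := by
  obtain ⟨h1, h2⟩ := one_sub_inv_mem hN
  refine ⟨by positivity, ?_⟩
  gcongr
  exact pow_le_one₀ (by linarith) h2

theorem isTrigSum_posKernel {N : ℕ} (hN : 2 ≤ N) :
    IsTrigSum (N - 1) 1 fun φ => (posKernel N φ : ℂ) := by
  refine ⟨_, _, _, _, posKernel_eq_sum N, ?_, ?_⟩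
  · rintro ⟨j, k⟩ hjk
    simp only [Finset.mem_product, Finset.mem_range] at hjk
    rw [abs_le]
    constructor <;> dsimp only <;> omega
  · have hN0 : (N : ℝ) ≠ 0 := by positivity
    calc _ ≤ ∑ i ∈ Finset.range N ×ˢ Finset.range N, 1 / (N : ℝ) ^ 2 := by
          refine Finset.sum_le_sum fun i _ => ?_
          rw [Complex.norm_real, Real.norm_eq_abs, abs_of_nonneg (posKernel_coeff_mem hN _).1]
          exact (posKernel_coeff_mem hN _).2
      _ = 1 := by
        rw [Finset.sum_const, Finset.card_product, Finset.card_range, nsmul_eq_mul]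
        push_cast
        field_simp

/-- Only the diagonal frequencies survive the grid sum: N terms, each at most 2N/N². -/
theorem sum_posKernel_gridPoint_le {N : ℕ} (hN : 2 ≤ N) (a : ℝ) :
    ∑ k ∈ Finset.range (2 * N), posKernel N (a - gridPoint (2 * N) k) ≤ 2 := by
  have hN0 : (N : ℝ) ≠ 0 := by positivity
  have h : ((∑ k ∈ Finset.range (2 * N), posKernel N (a - gridPoint (2 * N) k) : ℝ) : ℂ) =
      ((∑ i ∈ Finset.range N ×ˢ Finset.range N, (1 - 1 / (N : ℝ)) ^ (i.1 + i.2) / (N : ℝ) ^ 2 *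
        if i.1 = i.2 then ((2 * N : ℕ) : ℝ) else 0 : ℝ) : ℂ) := by
    rw [Complex.ofReal_sum]
    simp only [posKernel_eq_sum]
    rw [Finset.sum_comm, Complex.ofReal_sum]
    refine Finset.sum_congr rfl fun i hi => ?_
    rw [← Finset.mul_sum, sum_exp_gridPoint]
    · rw [Complex.ofReal_mul]
      congr 1
      simp only [sub_eq_zero, Nat.cast_inj]
      split_ifs <;> simp
    · simp only [Finset.mem_product, Finset.mem_range] at hi
      rw [abs_lt]
      constructor <;> push_cast <;> omega
  rw [Complex.ofReal_inj.1 h, Finset.sum_product]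
  calc _ ≤ ∑ j ∈ Finset.range N, 2 / (N : ℝ) := by
        refine Finset.sum_le_sum fun j hj => ?_
        simp only [mul_ite, mul_zero]
        rw [Finset.sum_ite_eq, if_pos hj]
        refine (mul_le_mul_of_nonneg_right (posKernel_coeff_mem hN _).2 (by positivity)).trans
          (le_of_eq ?_)
        push_cast
        field_simp
    _ = 2 := by
      rw [Finset.sum_const, Finset.card_range, nsmul_eq_mul]
      field_simp

/-- The reason for the damping r = 1 - 1/N: since r^N ≤ 1/e ≤ 1/2, the numerator of the geometric
sum stays away from 0. Unlike the Fejér kernel, the resulting kernel has a lower bound of the same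
shape as its upper bound. -/
theorem one_sub_pow_bounds {N : ℕ} (hN : 2 ≤ N) (φ : ℝ) :
    1 / 2 ≤ ‖1 - ((1 - 1 / (N : ℝ) : ℝ) * Complex.exp (Complex.I * φ)) ^ N‖ ∧
      ‖1 - ((1 - 1 / (N : ℝ) : ℝ) * Complex.exp (Complex.I * φ)) ^ N‖ ≤ 2 := by
  obtain ⟨h1, h2⟩ := one_sub_inv_mem hN
  have hN0 : (N : ℝ) ≠ 0 := by positivity
  set z : ℂ := (1 - 1 / (N : ℝ) : ℝ) * Complex.exp (Complex.I * φ) with hz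
  have hzn : ‖z‖ = 1 - 1 / (N : ℝ) := by
    rw [hz, norm_mul, mul_comm Complex.I, Complex.norm_exp_ofReal_mul_I, mul_one, Complex.norm_real,
      Real.norm_eq_abs, abs_of_nonneg (by linarith)]
  have hzN : ‖z ^ N‖ ≤ 1 / 2 := by
    rw [norm_pow, hzn]
    have h3 : 1 - 1 / (N : ℝ) ≤ Real.exp (-(1 / N)) := by
      have := Real.add_one_le_exp (-(1 / (N : ℝ)))
      linarith
    calc (1 - 1 / (N : ℝ)) ^ N ≤ Real.exp (-(1 / N)) ^ N := pow_le_pow_left₀ (by linarith) h3 N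
      _ = Real.exp (-1) := by
        rw [← Real.exp_nat_mul]
        congr 1
        field_simp
      _ ≤ 1 / 2 := by
        rw [Real.exp_neg, one_div]
        apply inv_anti₀ (by norm_num)
        have := Real.add_one_le_exp (1 : ℝ)
        linarith
  constructor
  · have := norm_sub_norm_le (1 : ℂ) (z ^ N)
    rw [norm_one] at this
    linarith
  · have := norm_sub_le (1 : ℂ) (z ^ N)
    rw [norm_one] at this
    linarith

theorem one_sub_mul_geomKernel (N : ℕ) (φ : ℝ) :
    (1 - (1 - 1 / (N : ℝ) : ℝ) * Complex.exp (Complex.I * φ)) * geomKernel N φ =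
      1 - ((1 - 1 / (N : ℝ) : ℝ) * Complex.exp (Complex.I * φ)) ^ N :=
  mul_neg_geom_sum _ _

theorem le_posKernel {N : ℕ} (hN : 2 ≤ N) (φ : ℝ) :
    1 / (4 * (1 + N * |φ|) ^ 2) ≤ posKernel N φ := by
  obtain ⟨h1, h2⟩ := one_sub_inv_mem hN
  have hN0 : (0 : ℝ) < N := by positivity
  have hb := (one_sub_pow_bounds hN φ).1
  rw [← one_sub_mul_geomKernel, norm_mul] at hb
  have hup : ‖1 - ((1 - 1 / (N : ℝ) : ℝ) : ℂ) * Complex.exp (Complex.I * φ)‖ ≤ 1 / N + |φ| := by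
    have e : 1 - ((1 - 1 / (N : ℝ) : ℝ) : ℂ) * Complex.exp (Complex.I * φ) =
        ((1 / (N : ℝ) : ℝ) : ℂ) -
          ((1 - 1 / (N : ℝ) : ℝ) : ℂ) * (Complex.exp (Complex.I * φ) - 1) := by
      push_cast; ring
    rw [e]
    refine (norm_sub_le _ _).trans ?_
    rw [norm_mul, Complex.norm_real, Complex.norm_real, Real.norm_eq_abs, Real.norm_eq_abs,
      abs_of_nonneg (by positivity), abs_of_nonneg (by linarith : 0 ≤ 1 - 1 / (N : ℝ))]
    have h3 : ‖Complex.exp (Complex.I * φ) - 1‖ ≤ |φ| := Real.norm_exp_I_mul_ofReal_sub_one_le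
    have := mul_le_mul h2 h3 (norm_nonneg _) zero_le_one
    linarith
  have hpos : 0 < 1 + N * |φ| := by positivity
  have h4 : 1 / 2 ≤ (1 + N * |φ|) / N * ‖geomKernel N φ‖ := by
    have e : (1 + N * |φ|) / N = 1 / N + |φ| := by field_simp
    rw [e]
    exact hb.trans (mul_le_mul_of_nonneg_right hup (norm_nonneg _))
  rw [posKernel, div_le_div_iff₀ (by positivity) (by positivity), one_mul]
  have h5 : (N : ℝ) ≤ 2 * ((1 + N * |φ|) * ‖geomKernel N φ‖) := by
    rw [div_mul_eq_mul_div, div_le_div_iff₀ (by norm_num) hN0] at h4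
    linarith
  nlinarith [pow_le_pow_left₀ hN0.le h5 2]

theorem abs_div_ten_le_abs_sin {φ : ℝ} (hφ : |φ| ≤ 3 * Real.pi / 2) :
    |φ| / 10 ≤ |Real.sin (φ / 2)| := by
  have key : ∀ t : ℝ, 0 ≤ t → t ≤ 3 * Real.pi / 4 → t / 5 ≤ Real.sin t := by
    intro t ht ht'
    have hpi := Real.pi_gt_three
    have hpi4 := Real.pi_lt_d2
    have h2 : 1 / 2 ≤ 2 / Real.pi := by
      rw [div_le_div_iff₀ (by norm_num) Real.pi_pos]; linarith
    rcases le_total t (Real.pi / 2) with h | h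
    · have := Real.mul_le_sin ht h
      nlinarith
    · have := Real.mul_le_sin (x := Real.pi - t) (by linarith) (by linarith)
      rw [Real.sin_pi_sub] at this
      have h3 : 2 / Real.pi * (Real.pi / 4) ≤ 2 / Real.pi * (Real.pi - t) := by
        gcongr; linarith
      have h4 : 2 / Real.pi * (Real.pi / 4) = 1 / 2 := by field_simp; norm_num
      linarith
  rcases abs_cases φ with ⟨h, _⟩ | ⟨h, _⟩ <;> rw [h] at hφ ⊢
  · exact le_trans (by linarith) ((key (φ / 2) (by linarith) (by linarith)).trans (le_abs_self _))
  · have := key (-φ / 2) (by linarith) (by linarith)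
    rw [neg_div, Real.sin_neg] at this
    exact le_trans (by linarith) (this.trans (neg_le_abs _))

/-- The range 3π/2 accommodates differences x - y with |x| ≤ π/2 and |y| ≤ π, while staying away
from the next peak at 2π. -/
theorem posKernel_le {N : ℕ} (hN : 2 ≤ N) {φ : ℝ} (hφ : |φ| ≤ 3 * Real.pi / 2) :
    posKernel N φ ≤ 400 / (1 + N * |φ|) ^ 2 := by
  obtain ⟨h1, h2⟩ := one_sub_inv_mem hN
  have hN0 : (0 : ℝ) < N := by positivity
  have hb := (one_sub_pow_bounds hN φ).2
  rw [← one_sub_mul_geomKernel, norm_mul] at hb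
  have hsin := abs_div_ten_le_abs_sin hφ
  have hnorm : ‖1 - ((1 - 1 / (N : ℝ) : ℝ) : ℂ) * Complex.exp (Complex.I * φ)‖ ^ 2 =
      (1 / N) ^ 2 + 4 * (1 - 1 / N) * |Real.sin (φ / 2)| ^ 2 := by
    rw [mul_comm Complex.I, Complex.exp_mul_I, ← Complex.ofReal_cos, ← Complex.ofReal_sin,
      ← Complex.normSq_eq_norm_sq, Complex.normSq_apply, sq_abs]
    simp only [Complex.sub_re, Complex.sub_im, Complex.one_re, Complex.one_im, Complex.mul_re,
      Complex.mul_im, Complex.add_re, Complex.add_im, Complex.ofReal_re, Complex.ofReal_im,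
      Complex.I_re, Complex.I_im]
    have hc : Real.cos φ = 1 - 2 * Real.sin (φ / 2) ^ 2 := by
      have := Real.cos_two_mul (φ / 2)
      rw [mul_div_cancel₀ φ two_ne_zero] at this
      nlinarith [Real.sin_sq_add_cos_sq (φ / 2)]
    have hs := Real.sin_sq_add_cos_sq φ
    linear_combination (1 - 1 / (N : ℝ)) ^ 2 * hs - 2 * (1 - 1 / (N : ℝ)) * hc
  have hlow : ((1 + N * |φ|) / (10 * N)) ^ 2 ≤
      ‖1 - ((1 - 1 / (N : ℝ) : ℝ) : ℂ) * Complex.exp (Complex.I * φ)‖ ^ 2 := by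
    rw [hnorm]
    have e : (1 + N * |φ|) / (10 * N) = (1 / N + |φ|) / 10 := by field_simp
    rw [e]
    have h3 : (|φ| / 10) ^ 2 ≤ |Real.sin (φ / 2)| ^ 2 := pow_le_pow_left₀ (by positivity) hsin 2
    have h0 : 0 ≤ 1 / (N : ℝ) := by positivity
    nlinarith [sq_nonneg (1 / (N : ℝ) - |φ|), mul_le_mul_of_nonneg_right h1 (sq_nonneg |Real.sin (φ / 2)|)]
  have hlow' := (pow_le_pow_iff_left₀ (by positivity) (norm_nonneg _) two_ne_zero).1 hlow
  have h5 : (1 + N * |φ|) / (10 * N) * ‖geomKernel N φ‖ ≤ 2 :=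
    (mul_le_mul_of_nonneg_right hlow' (norm_nonneg _)).trans hb
  have hpos : 0 < 1 + N * |φ| := by positivity
  rw [div_mul_eq_mul_div, div_le_iff₀ (by positivity)] at h5
  rw [posKernel, div_le_div_iff₀ (by positivity) (by positivity)]
  have := pow_le_pow_left₀ (by positivity) h5 2
  nlinarith

/-! ### Smoothing an interval -/

/-- For a between x and y both partial distances are at most |x - y|, so the two-sided bounds let
the decay of order 4 be shared between the two factors. The constant is 400² · 4². -/
theorem posKernel_sq_le {N : ℕ} (hN : 2 ≤ N) {x y a : ℝ} (hx : |x| ≤ Real.pi / 2)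
    (hy : |y| ≤ Real.pi) (ha : a ∈ Set.uIcc x y) :
    posKernel N (x - y) ^ 2 ≤ 2560000 * (posKernel N (x - a) * posKernel N (a - y)) := by
  have hxy : |x - y| ≤ 3 * Real.pi / 2 := (abs_sub _ _).trans (by linarith)
  have hxa : |x - a| ≤ |x - y| := by
    rw [abs_sub_comm, abs_sub_comm x y]; exact Set.abs_sub_left_of_mem_uIcc ha
  have hay : |a - y| ≤ |x - y| := by
    rw [abs_sub_comm a y, abs_sub_comm x y]; exact Set.abs_sub_right_of_mem_uIcc ha |>.trans (by rw [abs_sub_comm])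
  have h1 := posKernel_le hN hxy
  have h2 := le_posKernel hN (x - a)
  have h3 := le_posKernel hN (a - y)
  have h0 := posKernel_nonneg N (x - y)
  have hw : ∀ {s t : ℝ}, |s| ≤ |t| → (1 + N * |s|) ^ 2 ≤ (1 + N * |t|) ^ 2 := by
    intro s t h
    gcongr
  have hxa' := hw hxa
  have hay' := hw hay
  set w := (1 + N * |x - y|) ^ 2 with hwdef
  have hw0 : 0 < w := by positivity
  have ha0 : 0 < (1 + (N : ℝ) * |x - a|) ^ 2 := by positivity
  have hy0 : 0 < (1 + (N : ℝ) * |a - y|) ^ 2 := by positivity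
  have h2' : 1 / (4 * w) ≤ posKernel N (x - a) :=
    le_trans (one_div_le_one_div_of_le (by positivity) (by linarith)) h2
  have h3' : 1 / (4 * w) ≤ posKernel N (a - y) :=
    le_trans (one_div_le_one_div_of_le (by positivity) (by linarith)) h3
  have h4 : 1 / (4 * w) * (1 / (4 * w)) ≤ posKernel N (x - a) * posKernel N (a - y) :=
    mul_le_mul h2' h3' (by positivity) (posKernel_nonneg _ _)
  calc _ ≤ (400 / w) ^ 2 := pow_le_pow_left₀ h0 h1 2
    _ = 2560000 * (1 / (4 * w) * (1 / (4 * w))) := by field_simp; norm_num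
    _ ≤ _ := by linarith

/-- A point outside I bounds I on one side, so the endpoint on that side is finite and separates x
from y. On an unbounded side `sInf` or `sSup` has a default value, which later only adds a
non-negative kernel term. -/
theorem Set.OrdConnected.sInf_mem_uIcc_or {I : Set ℝ} (hI : I.OrdConnected) {x y : ℝ} (hx : x ∈ I)
    (hy : y ∉ I) : sInf I ∈ Set.uIcc x y ∨ sSup I ∈ Set.uIcc x y := by
  rcases lt_or_gt_of_ne (show y ≠ x by rintro rfl; exact hy hx) with h | h
  · left
    have hlb : y ∈ lowerBounds I := by
      intro w hw
      by_contra hlt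
      exact hy (hI.out hw hx ⟨(not_le.1 hlt).le, h.le⟩)
    rw [Set.uIcc_of_ge h.le]
    exact ⟨le_csInf ⟨x, hx⟩ hlb, csInf_le ⟨y, hlb⟩ hx⟩
  · right
    have hub : y ∈ upperBounds I := by
      intro w hw
      by_contra hlt
      exact hy (hI.out hx hw ⟨h.le, (not_le.1 hlt).le⟩)
    rw [Set.uIcc_of_le h.le]
    exact ⟨le_csSup ⟨y, hub⟩ hx, csSup_le ⟨x, hx⟩ hub⟩

open Classical in
/-- A trigonometric sum close to the indicator function of an interval. -/
theorem exists_isTrigSum_near_indicator {N : ℕ} (hN : 2 ≤ N) {I : Set ℝ} (hI : I.OrdConnected) :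
    ∃ h : ℝ → ℝ, IsTrigSum (2 * N) (32 * N) (fun x => (h x : ℂ)) ∧ (∀ x, 0 ≤ h x ∧ h x ≤ 1) ∧
      ∀ x, |x| ≤ Real.pi / 2 → |(if x ∈ I then 1 else 0) - h x| ≤
        81920000 * (posKernel N (x - sInf I) + posKernel N (x - sSup I)) := by
  have hN2 : (2 : ℝ) ≤ N := by exact_mod_cast hN
  set M := 2 * N with hM
  set G : ℝ → ℝ := posKernel N with hG
  set y := gridPoint M with hy
  have hG2 : IsTrigSum (2 * N - 2) 1 fun x => ((G x ^ 2 : ℝ) : ℂ) := by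
    have := (isTrigSum_posKernel hN).mul (isTrigSum_posKernel hN)
    convert this.mono (L' := 2 * N - 2) (A' := 1) (by omega) (by norm_num) using 2
    push_cast
    ring
  obtain ⟨S', hS'⟩ := hG2.exists_sum_gridPoint_eq (M := M) (by omega)
  obtain ⟨S, hS⟩ : ∃ S : ℝ, ∀ x, ∑ k ∈ Finset.range M, G (x - y k) ^ 2 = S := by
    refine ⟨S'.re, fun x => ?_⟩
    have := congrArg Complex.re (hS' x)
    rw [← Complex.ofReal_sum, Complex.ofReal_re] at this
    exact this
  have hS16 : 1 / 16 ≤ S := by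
    rw [← hS (y 0)]
    have h0 : 1 / 4 ≤ G (y 0 - y 0) := by
      have := le_posKernel hN (y 0 - y 0)
      simpa using this
    have h1 : G (y 0 - y 0) ^ 2 ≤ ∑ k ∈ Finset.range M, G (y 0 - y k) ^ 2 :=
      Finset.single_le_sum (f := fun k => G (y 0 - y k) ^ 2) (fun k _ => sq_nonneg _)
        (Finset.mem_range.2 (by omega))
    nlinarith
  have hS0 : 0 < S := by linarith
  have hinv : S⁻¹ ≤ 16 := by
    rw [inv_le_comm₀ hS0 (by norm_num)]; linarith
  have hinv0 : 0 ≤ S⁻¹ := by positivity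
  -- The partition of unity formed by the squared kernels at the 2N grid points, restricted to the
  -- points in I. Squaring keeps the degree at 2N - 2, below the number of points, so the full sum
  -- is the constant S.
  refine ⟨fun x => S⁻¹ * ∑ k ∈ (Finset.range M).filter (fun k => y k ∈ I), G (x - y k) ^ 2,
    ?_, ?_, ?_⟩
  · have h1 : IsTrigSum (2 * N - 2) (((Finset.range M).filter (fun k => y k ∈ I)).card * 1)
        fun x => ∑ k ∈ (Finset.range M).filter (fun k => y k ∈ I), ((G (x - y k) ^ 2 : ℝ) : ℂ) :=
      IsTrigSum.sum _ fun k => hG2.comp_sub (y k)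
    have h2 := h1.const_mul ((S⁻¹ : ℝ) : ℂ)
    have hcard : (((Finset.range M).filter (fun k => y k ∈ I)).card : ℝ) ≤ 2 * N := by
      have := (Finset.card_filter_le (Finset.range M) (fun k => y k ∈ I)).trans
        (Finset.card_range M).le
      exact_mod_cast this
    have h3 : ‖((S⁻¹ : ℝ) : ℂ)‖ * ((((Finset.range M).filter (fun k => y k ∈ I)).card : ℝ) * 1) ≤
        32 * N := by
      rw [Complex.norm_real, Real.norm_eq_abs, abs_of_nonneg hinv0, mul_one]
      calc _ ≤ 16 * (2 * (N : ℝ)) := mul_le_mul hinv hcard (by positivity) (by norm_num)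
        _ = _ := by ring
    convert h2.mono (L' := 2 * N) (by omega) h3 using 2
    push_cast
    rfl
  · intro x
    refine ⟨mul_nonneg hinv0 (Finset.sum_nonneg fun _ _ => sq_nonneg _), ?_⟩
    rw [inv_mul_le_iff₀ hS0, mul_one, ← hS x]
    exact Finset.sum_le_sum_of_subset_of_nonneg (Finset.filter_subset _ _)
      fun _ _ _ => sq_nonneg _
  · intro x hx
    -- Each grid point on the other side of an endpoint a from x contributes at most a multiple of
    -- G(x - a) G(a - y_k), and the second factor sums over the grid to at most 2.
    have hsplit : ∀ T : Finset ℕ, T ⊆ Finset.range M →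
        (∀ k ∈ T, sInf I ∈ Set.uIcc x (y k) ∨ sSup I ∈ Set.uIcc x (y k)) →
        S⁻¹ * ∑ k ∈ T, G (x - y k) ^ 2 ≤ 81920000 * (G (x - sInf I) + G (x - sSup I)) := by
      intro T hT hsep
      have hb : ∑ k ∈ T, G (x - y k) ^ 2 ≤ ∑ k ∈ Finset.range M, 2560000 *
          (G (x - sInf I) * G (sInf I - y k) + G (x - sSup I) * G (sSup I - y k)) := by
        refine (Finset.sum_le_sum fun k hk => ?_).trans (Finset.sum_le_sum_of_subset_of_nonneg hT
          fun k _ _ => ?_)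
        · have hk' := abs_gridPoint_le (Finset.mem_range.1 (hT hk))
          have n1 := mul_nonneg (posKernel_nonneg N (x - sInf I)) (posKernel_nonneg N (sInf I - y k))
          have n2 := mul_nonneg (posKernel_nonneg N (x - sSup I)) (posKernel_nonneg N (sSup I - y k))
          rcases hsep k hk with h | h
          · have := posKernel_sq_le hN hx hk' h
            linarith
          · have := posKernel_sq_le hN hx hk' h
            linarith
        · have n1 := mul_nonneg (posKernel_nonneg N (x - sInf I)) (posKernel_nonneg N (sInf I - y k))
          have n2 := mul_nonneg (posKernel_nonneg N (x - sSup I)) (posKernel_nonneg N (sSup I - y k))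
          linarith
      rw [← Finset.mul_sum, Finset.sum_add_distrib, ← Finset.mul_sum, ← Finset.mul_sum] at hb
      have g1 := mul_le_mul_of_nonneg_left (sum_posKernel_gridPoint_le hN (sInf I))
        (posKernel_nonneg N (x - sInf I))
      have g2 := mul_le_mul_of_nonneg_left (sum_posKernel_gridPoint_le hN (sSup I))
        (posKernel_nonneg N (x - sSup I))
      have hb' : ∑ k ∈ T, G (x - y k) ^ 2 ≤ 5120000 * (G (x - sInf I) + G (x - sSup I)) := by
        linarith
      have hsum0 : 0 ≤ ∑ k ∈ T, G (x - y k) ^ 2 := Finset.sum_nonneg fun _ _ => sq_nonneg _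
      calc _ ≤ 16 * (5120000 * (G (x - sInf I) + G (x - sSup I))) :=
            mul_le_mul hinv hb' hsum0 (by norm_num)
        _ = _ := by ring
    have hpos0 : 0 ≤ S⁻¹ * ∑ k ∈ (Finset.range M).filter (fun k => y k ∈ I), G (x - y k) ^ 2 :=
      mul_nonneg hinv0 (Finset.sum_nonneg fun _ _ => sq_nonneg _)
    by_cases hxI : x ∈ I
    · rw [if_pos hxI]
      have hone : (1 : ℝ) - S⁻¹ * ∑ k ∈ (Finset.range M).filter (fun k => y k ∈ I), G (x - y k) ^ 2 =
          S⁻¹ * ∑ k ∈ (Finset.range M).filter (fun k => ¬ y k ∈ I), G (x - y k) ^ 2 := by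
        have h1 := Finset.sum_filter_add_sum_filter_not (Finset.range M) (fun k => y k ∈ I)
          (fun k => G (x - y k) ^ 2)
        rw [hS x] at h1
        rw [eq_sub_of_add_eq' h1, mul_sub, inv_mul_cancel₀ hS0.ne']
      rw [hone, abs_of_nonneg (mul_nonneg hinv0 (Finset.sum_nonneg fun _ _ => sq_nonneg _))]
      exact hsplit _ (Finset.filter_subset _ _) fun k hk =>
        hI.sInf_mem_uIcc_or hxI (Finset.mem_filter.1 hk).2
    · rw [if_neg hxI, zero_sub, abs_neg, abs_of_nonneg hpos0]
      refine hsplit _ (Finset.filter_subset _ _) fun k hk => ?_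
      rw [Set.uIcc_comm]
      exact hI.sInf_mem_uIcc_or (Finset.mem_filter.1 hk).2 hxI

/-! ### Comparison of two laws on boxes -/

section

variable {J : ℕ} {μ ν : Measure (Fin J → ℝ)} [IsProbabilityMeasure μ] [IsProbabilityMeasure ν]

theorem integral_prod_isTrigSum {f : Fin J → ℝ → ℂ} {ι : Fin J → Type} {s : ∀ j, Finset (ι j)}
    {c : ∀ j, ι j → ℂ} {m : ∀ j, ι j → ℤ}
    (hf : ∀ j, ∀ x : ℝ, f j x = ∑ i ∈ s j, c j i * Complex.exp (Complex.I * (m j i * x))) :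
    ∫ x, ∏ j, f j (x j) ∂μ = ∑ i ∈ Fintype.piFinset s, (∏ j, c j (i j)) *
      ∫ x, Complex.exp (Complex.I * ((∑ j, (m j (i j) : ℝ) * x j : ℝ) : ℂ)) ∂μ := by
  have h : ∀ x : Fin J → ℝ, ∏ j, f j (x j) = ∑ i ∈ Fintype.piFinset s, (∏ j, c j (i j)) *
      Complex.exp (Complex.I * ((∑ j, (m j (i j) : ℝ) * x j : ℝ) : ℂ)) := by
    intro x
    simp only [hf]
    rw [Finset.prod_univ_sum]
    refine Finset.sum_congr rfl fun i _ => ?_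
    rw [Finset.prod_mul_distrib, ← Complex.exp_sum]
    push_cast
    rw [Finset.mul_sum]
  simp only [h]
  rw [integral_finsetSum]
  · simp only [integral_const_mul]
  · intro i _
    refine Integrable.const_mul (Integrable.of_bound ?_ 1 (ae_of_all _ fun x => ?_)) _
    · exact Continuous.aestronglyMeasurable (by fun_prop)
    · rw [mul_comm, Complex.norm_exp_ofReal_mul_I]

/-- A product of J trigonometric sums is a combination of characters exp(i m·x) whose coefficients
have absolute sum at most A^J. -/
theorem norm_integral_prod_sub_le {L : ℤ} {A η : ℝ}
    (hη : ∀ m : Fin J → ℤ, (∀ j, |m j| ≤ L) →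
      ‖∫ x, Complex.exp (Complex.I * ((∑ j, (m j : ℝ) * x j : ℝ) : ℂ)) ∂μ -
        ∫ x, Complex.exp (Complex.I * ((∑ j, (m j : ℝ) * x j : ℝ) : ℂ)) ∂ν‖ ≤ η)
    (hη0 : 0 ≤ η) {f : Fin J → ℝ → ℂ} (hf : ∀ j, IsTrigSum L A (f j)) :
    ‖∫ x, ∏ j, f j (x j) ∂μ - ∫ x, ∏ j, f j (x j) ∂ν‖ ≤ A ^ J * η := by
  choose ι s c m hf hm hc using hf
  rw [integral_prod_isTrigSum hf, integral_prod_isTrigSum hf, ← Finset.sum_sub_distrib]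
  calc _ ≤ ∑ i ∈ Fintype.piFinset s, (∏ j, ‖c j (i j)‖) * η := by
        refine (norm_sum_le _ _).trans (Finset.sum_le_sum fun i hi => ?_)
        rw [← mul_sub, norm_mul, norm_prod]
        exact mul_le_mul_of_nonneg_left
          (hη _ fun j => hm j _ (Fintype.mem_piFinset.1 hi j))
          (Finset.prod_nonneg fun _ _ => norm_nonneg _)
    _ = (∏ j, ∑ i ∈ s j, ‖c j i‖) * η := by
        rw [← Finset.sum_mul, Finset.prod_univ_sum]
    _ ≤ A ^ J * η := by
        gcongr
        refine (Finset.prod_le_prod (fun j _ => Finset.sum_nonneg fun _ _ => norm_nonneg _)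
          fun j _ => hc j).trans ?_
        simp

theorem integrable_posKernel {N : ℕ} (hN : 2 ≤ N) (j : Fin J) (a : ℝ) :
    Integrable (fun x : Fin J → ℝ => posKernel N (x j - a)) μ := by
  obtain ⟨ι, s, c, m, hf, hm, hA⟩ := isTrigSum_posKernel hN
  have hcont : Continuous fun x : ℝ => posKernel N x := by
    unfold posKernel geomKernel; fun_prop
  refine Integrable.of_bound (Continuous.aestronglyMeasurable
    (hcont.comp (by fun_prop : Continuous fun x : Fin J → ℝ => x j - a))) 1 (ae_of_all _ fun x => ?_)
  have h1 : ((posKernel N (x j - a) : ℝ) : ℂ) = _ := hf (x j - a)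
  rw [Real.norm_eq_abs, ← Real.norm_eq_abs, ← Complex.norm_real, h1]
  refine ((norm_sum_le _ _).trans (le_of_eq (Finset.sum_congr rfl fun i _ => ?_))).trans hA
  rw [norm_mul, mul_comm Complex.I]
  have : ((m i : ℂ) * ((x j - a : ℝ) : ℂ)) = ((m i * (x j - a) : ℝ) : ℂ) := by push_cast; rfl
  rw [this, Complex.norm_exp_ofReal_mul_I, mul_one]

/-- Small-interval estimate: for each of the N values of the first index, the frequencies i - k are
distinct and lie in [-N, N], so each contributes at most κ/N². -/
theorem integral_posKernel_le {N : ℕ} (hN : 2 ≤ N) (j : Fin J) (a : ℝ) {κ : ℝ}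
    (hκ : ∑ m ∈ Finset.Icc (-N : ℤ) N,
      ‖∫ x, Complex.exp (Complex.I * ((m * x j : ℝ) : ℂ)) ∂ν‖ ≤ κ) :
    ∫ x, posKernel N (x j - a) ∂ν ≤ κ / N := by
  have hN0 : (0 : ℝ) < N := by positivity
  set φ : ℤ → ℝ := fun m => ‖∫ x, Complex.exp (Complex.I * ((m * x j : ℝ) : ℂ)) ∂ν‖ with hφ
  have h1 : ((∫ x, posKernel N (x j - a) ∂ν : ℝ) : ℂ) =
      ∑ i ∈ Finset.range N ×ˢ Finset.range N,
        (((1 - 1 / (N : ℝ)) ^ (i.1 + i.2) / (N : ℝ) ^ 2 : ℝ) : ℂ) *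
          (Complex.exp (Complex.I * ((-(((i.1 : ℤ) - (i.2 : ℤ) : ℤ) * a) : ℝ) : ℂ)) *
          ∫ x, Complex.exp (Complex.I * (((((i.1 : ℤ) - (i.2 : ℤ) : ℤ) : ℝ) * x j : ℝ) : ℂ)) ∂ν) := by
    rw [← integral_complex_ofReal]
    simp only [posKernel_eq_sum]
    rw [integral_finsetSum]
    · refine Finset.sum_congr rfl fun i _ => ?_
      rw [integral_const_mul]
      congr 1
      rw [← integral_const_mul]
      refine integral_congr_ae (ae_of_all _ fun x => ?_)
      beta_reduce
      rw [← Complex.exp_add]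
      congr 1
      push_cast
      ring
    · intro i _
      refine Integrable.const_mul (Integrable.of_bound ?_ 1 (ae_of_all _ fun x => ?_)) _
      · exact Continuous.aestronglyMeasurable (by fun_prop)
      · have : (((((i.1 : ℤ) - (i.2 : ℤ) : ℤ) : ℂ)) * ((x j - a : ℝ) : ℂ)) =
            (((((i.1 : ℤ) - (i.2 : ℤ) : ℤ) : ℝ) * (x j - a) : ℝ) : ℂ) := by push_cast; rfl
        rw [this, mul_comm, Complex.norm_exp_ofReal_mul_I]
  have h2 : ∫ x, posKernel N (x j - a) ∂ν ≤ ∑ i ∈ Finset.range N ×ˢ Finset.range N,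
      1 / (N : ℝ) ^ 2 * φ ((i.1 : ℤ) - (i.2 : ℤ)) := by
    refine (le_abs_self _).trans ?_
    rw [← Real.norm_eq_abs, ← Complex.norm_real, h1]
    refine (norm_sum_le _ _).trans (Finset.sum_le_sum fun i _ => ?_)
    rw [norm_mul, norm_mul, mul_comm Complex.I, Complex.norm_exp_ofReal_mul_I, one_mul,
      Complex.norm_real, Real.norm_eq_abs, abs_of_nonneg (posKernel_coeff_mem hN _).1]
    exact mul_le_mul_of_nonneg_right (posKernel_coeff_mem hN _).2 (norm_nonneg _)
  refine h2.trans ?_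
  rw [Finset.sum_product]
  have h3 : ∀ i ∈ Finset.range N, ∑ k ∈ Finset.range N,
      1 / (N : ℝ) ^ 2 * φ ((i : ℤ) - (k : ℤ)) ≤ 1 / (N : ℝ) ^ 2 * κ := by
    intro i hi
    rw [← Finset.mul_sum]
    refine mul_le_mul_of_nonneg_left (le_trans ?_ hκ) (by positivity)
    have hinj : Set.InjOn (fun k : ℕ => (i : ℤ) - (k : ℤ)) (Finset.range N) := by
      intro k _ k' _ h
      simp only at h
      omega
    rw [← Finset.sum_image (f := φ) hinj]
    refine Finset.sum_le_sum_of_subset_of_nonneg ?_ fun _ _ _ => norm_nonneg _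
    intro m hm
    obtain ⟨k, hk, rfl⟩ := Finset.mem_image.1 hm
    have := Finset.mem_range.1 hi
    have := Finset.mem_range.1 hk
    rw [Finset.mem_Icc]
    constructor <;> omega
  refine (Finset.sum_le_card_nsmul _ _ _ h3).trans (le_of_eq ?_)
  rw [Finset.card_range, nsmul_eq_mul]
  field_simp

theorem abs_prod_sub_prod_le {ι : Type*} (s : Finset ι) {f g : ι → ℝ}
    (hf : ∀ i, 0 ≤ f i ∧ f i ≤ 1) (hg : ∀ i, 0 ≤ g i ∧ g i ≤ 1) :
    |∏ i ∈ s, f i - ∏ i ∈ s, g i| ≤ ∑ i ∈ s, |f i - g i| := by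
  classical
  induction s using Finset.induction_on with
  | empty => simp
  | insert a s ha ih =>
    rw [Finset.prod_insert ha, Finset.prod_insert ha, Finset.sum_insert ha]
    have e : f a * ∏ i ∈ s, f i - g a * ∏ i ∈ s, g i =
        (f a - g a) * ∏ i ∈ s, f i + g a * (∏ i ∈ s, f i - ∏ i ∈ s, g i) := by ring
    rw [e]
    refine (abs_add_le _ _).trans (add_le_add ?_ ?_)
    · rw [abs_mul, abs_of_nonneg (Finset.prod_nonneg fun i _ => (hf i).1)]
      exact mul_le_of_le_one_right (abs_nonneg _)
        (Finset.prod_le_one (fun i _ => (hf i).1) fun i _ => (hf i).2)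
    · rw [abs_mul, abs_of_nonneg (hg a).1]
      exact (mul_le_of_le_one_left (abs_nonneg _) (hg a).2).trans ih

/-- Two laws with nearly equal characteristic functions have nearly equal values on boxes. -/
theorem abs_measureReal_box_sub_le {N : ℕ} (hN : 2 ≤ N) {η κ : ℝ}
    (hμ : ∀ᵐ x ∂μ, ∀ j, |x j| ≤ Real.pi / 2) (hν : ∀ᵐ x ∂ν, ∀ j, |x j| ≤ Real.pi / 2)
    (hη : ∀ m : Fin J → ℤ, (∀ j, |m j| ≤ 2 * N) →
      ‖∫ x, Complex.exp (Complex.I * ((∑ j, (m j : ℝ) * x j : ℝ) : ℂ)) ∂μ -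
        ∫ x, Complex.exp (Complex.I * ((∑ j, (m j : ℝ) * x j : ℝ) : ℂ)) ∂ν‖ ≤ η)
    (hκ : ∀ j, ∑ m ∈ Finset.Icc (-N : ℤ) N,
      ‖∫ x, Complex.exp (Complex.I * ((m * x j : ℝ) : ℂ)) ∂ν‖ ≤ κ)
    {I : Fin J → Set ℝ} (hI : ∀ j, (I j).OrdConnected) :
    |μ.real (Set.univ.pi I) - ν.real (Set.univ.pi I)| ≤
      400000000 * (J * (κ / N + η)) + (32 * N) ^ J * η := by
  classical
  have hN0 : (0 : ℝ) < N := by positivity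
  have hη0 : 0 ≤ η := (norm_nonneg _).trans (hη (fun _ => 0) fun j => by simp)
  choose h hh hh01 hhI using fun j => exists_isTrigSum_near_indicator hN (hI j)
  have hcont : ∀ j, Continuous (h j) := fun j => by
    have := Complex.continuous_re.comp (hh j).continuous
    exact this
  -- The decay of the characteristic function is assumed for ν alone; the kernel bound passes to μ
  -- at cost η, the kernel being a trigonometric sum in one coordinate.
  have hkernel : ∀ j a, ∫ x, posKernel N (x j - a) ∂ν ≤ κ / N ∧
      ∫ x, posKernel N (x j - a) ∂μ ≤ κ / N + η := by
    intro j a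
    have h1 := integral_posKernel_le hN j a (hκ j)
    refine ⟨h1, ?_⟩
    set f : Fin J → ℝ → ℂ := Function.update (fun _ _ => 1) j
      (fun x => (posKernel N (x - a) : ℂ)) with hf
    have hft : ∀ i, IsTrigSum (2 * N) 1 (f i) := by
      intro i
      rcases eq_or_ne i j with rfl | hij
      · rw [hf, Function.update_self]
        exact ((isTrigSum_posKernel hN).comp_sub a).mono (by omega) le_rfl
      · rw [hf, Function.update_of_ne hij]
        exact isTrigSum_one _ (by omega)
    have h2 := norm_integral_prod_sub_le hη hη0 hft
    have h3 : ∀ x : Fin J → ℝ, ∏ i, f i (x i) = (posKernel N (x j - a) : ℂ) := by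
      intro x
      rw [Finset.prod_eq_single j]
      · rw [hf, Function.update_self]
      · intro i _ hij
        rw [hf, Function.update_of_ne hij]
      · simp
    simp only [h3, one_pow, one_mul] at h2
    rw [integral_complex_ofReal, integral_complex_ofReal, ← Complex.ofReal_sub, Complex.norm_real,
      Real.norm_eq_abs] at h2
    linarith [(abs_le.1 h2).2]
  have hκη : 0 ≤ J * (κ / N + η) := by
    rcases Nat.eq_zero_or_pos J with h0 | h0
    · simp [h0]
    · have := (hkernel ⟨0, h0⟩ 0).1
      have h4 : 0 ≤ ∫ x, posKernel N (x ⟨0, h0⟩ - 0) ∂ν :=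
        integral_nonneg fun x => posKernel_nonneg _ _
      have : 0 ≤ κ / N := h4.trans this
      positivity
  have hprod_int : ∀ (ρ : Measure (Fin J → ℝ)) [IsProbabilityMeasure ρ],
      Integrable (fun x : Fin J → ℝ => ∏ j, h j (x j)) ρ := by
    intro ρ _
    refine Integrable.of_bound (Continuous.aestronglyMeasurable (continuous_finsetProd _ fun j _ =>
      (hcont j).comp (continuous_apply j))) 1 (ae_of_all _ fun x => ?_)
    rw [Real.norm_eq_abs, abs_of_nonneg (Finset.prod_nonneg fun j _ => (hh01 j _).1)]
    exact Finset.prod_le_one (fun j _ => (hh01 j _).1) fun j _ => (hh01 j _).2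
  have hmeas : MeasurableSet (Set.univ.pi I) :=
    MeasurableSet.univ_pi fun j => (hI j).measurableSet
  have hsmooth : ∀ (ρ : Measure (Fin J → ℝ)) [IsProbabilityMeasure ρ],
      (∀ᵐ x ∂ρ, ∀ j, |x j| ≤ Real.pi / 2) →
      (∀ j a, ∫ x, posKernel N (x j - a) ∂ρ ≤ κ / N + η) →
      |ρ.real (Set.univ.pi I) - ∫ x, ∏ j, h j (x j) ∂ρ| ≤
        200000000 * (J * (κ / N + η)) := by
    intro ρ _ hρ hk
    have hind : ρ.real (Set.univ.pi I) = ∫ x, ∏ j, (if x j ∈ I j then (1 : ℝ) else 0) ∂ρ := by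
      rw [← integral_indicator_one hmeas]
      refine integral_congr_ae (ae_of_all _ fun x => ?_)
      beta_reduce
      rw [Finset.prod_ite_zero]
      simp [Set.indicator, Set.mem_pi]
    have hind_int : Integrable (fun x : Fin J → ℝ => ∏ j, (if x j ∈ I j then (1 : ℝ) else 0)) ρ := by
      refine ((integrable_const (1 : ℝ)).indicator hmeas).congr (ae_of_all _ fun x => ?_)
      beta_reduce
      rw [Finset.prod_ite_zero]
      simp [Set.indicator, Set.mem_pi]
    rw [hind, ← integral_sub hind_int (hprod_int ρ), ← Real.norm_eq_abs]
    have hterm : ∀ j, Integrable (fun x : Fin J → ℝ => 81920000 *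
        (posKernel N (x j - sInf (I j)) + posKernel N (x j - sSup (I j)))) ρ := fun j =>
      ((integrable_posKernel hN j _).add (integrable_posKernel hN j _)).const_mul _
    have hint : Integrable (fun x : Fin J → ℝ => ∑ j, 81920000 *
        (posKernel N (x j - sInf (I j)) + posKernel N (x j - sSup (I j)))) ρ :=
      integrable_finsetSum _ fun j _ => hterm j
    refine (norm_integral_le_of_norm_le hint ?_).trans ?_
    · filter_upwards [hρ] with x hx
      rw [Real.norm_eq_abs]
      refine (abs_prod_sub_prod_le Finset.univ (fun j => ?_) fun j => hh01 j (x j)).trans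
        (Finset.sum_le_sum fun j _ => ?_)
      · split_ifs <;> norm_num
      · exact hhI j (x j) (hx j)
    · rw [integral_finsetSum _ fun j _ => hterm j]
      have : ∀ j ∈ Finset.univ, ∫ x, 81920000 * (posKernel N (x j - sInf (I j)) +
          posKernel N (x j - sSup (I j))) ∂ρ ≤ 163840000 * (κ / N + η) := by
        intro j _
        rw [integral_const_mul, integral_add (integrable_posKernel hN j _)
          (integrable_posKernel hN j _)]
        linarith [hk j (sInf (I j)), hk j (sSup (I j))]
      refine (Finset.sum_le_card_nsmul _ _ _ this).trans ?_
      rw [Finset.card_univ, Fintype.card_fin, nsmul_eq_mul]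
      linarith
  have h1 := hsmooth μ hμ fun j a => (hkernel j a).2
  have h2 := hsmooth ν hν fun j a => (hkernel j a).1.trans (by linarith)
  have h3 := norm_integral_prod_sub_le hη hη0 hh
  simp only [← Complex.ofReal_prod] at h3
  rw [integral_complex_ofReal, integral_complex_ofReal, ← Complex.ofReal_sub, Complex.norm_real,
    Real.norm_eq_abs] at h3
  have h4 := abs_le.1 h1
  have h5 := abs_le.1 h2
  have h6 := abs_le.1 h3
  rw [abs_le]
  constructor <;> linarith [h4.1, h4.2, h5.1, h5.2, h6.1, h6.2]

end

/-! ### The variance of the prime sums -/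

/-- The sum of the squares of the coefficients `(log p) / p ^ s` over the primes `y < p < z`. -/
noncomputable def primeVariance (y z s : ℝ) : ℝ :=
  ∑ p ∈ primesBetween y z, (Real.log ((p : ℕ) : ℝ) / ((p : ℕ) : ℝ) ^ s) ^ 2

/-- Chebyshev's bounds: θ(4x) ≥ 4x log 2 - o(x) and θ(x) ≤ x log 4 leave 2x log 2 - o(x), which
exceeds x. With 2x in place of 4x the main terms would cancel. -/
theorem exists_theta_sub_ge : ∃ X : ℝ, ∀ x : ℝ, X ≤ x →
    x ≤ Chebyshev.theta (4 * x) - Chebyshev.theta x := by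
  have h1 : ∀ᶠ x : ℝ in atTop, Real.log x ≤ 1 / 100 * x ^ (1 / 2 : ℝ) := by
    have := (isLittleO_log_rpow_atTop (r := 1 / 2) (by norm_num)).bound (c := 1 / 100) (by norm_num)
    filter_upwards [this, eventually_ge_atTop 1] with x hx hx1
    rw [Real.norm_eq_abs, Real.norm_eq_abs, abs_of_nonneg (Real.log_nonneg hx1),
      abs_of_nonneg (by positivity)] at hx
    exact hx
  have h2 : Tendsto (fun x : ℝ => 4 * x) atTop atTop := tendsto_id.const_mul_atTop (by norm_num)
  obtain ⟨X, hX⟩ := eventually_atTop.1 (h2.eventually h1)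
  refine ⟨max X 100, fun x hx => ?_⟩
  have hx1 : 100 ≤ x := (le_max_right _ _).trans hx
  have hl := hX x ((le_max_left _ _).trans hx)
  rw [← Real.sqrt_eq_rpow] at hl
  have hup := Chebyshev.theta_le_log4_mul_x (x := x) (by linarith)
  have hlow := Chebyshev.theta_ge' (x := 4 * x) (by linarith)
  have hs : √(4 * x) * √(4 * x) = 4 * x := Real.mul_self_sqrt (by linarith)
  have hs0 : 0 ≤ √(4 * x) := Real.sqrt_nonneg _
  have h4 : Real.log 4 = 2 * Real.log 2 := by
    rw [show (4 : ℝ) = 2 ^ 2 by norm_num, Real.log_pow]; norm_num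
  have hlog2 := Real.log_two_gt_d9
  have hlog2' := Real.log_two_lt_d9
  have hl2 : Real.log (4 * x + 2) ≤ Real.log (4 * x) + Real.log 2 := by
    rw [← Real.log_mul (by linarith) (by norm_num)]
    exact Real.log_le_log (by linarith) (by linarith)
  have hs1 : √(4 * x) ≤ 4 * x := by
    have : 1 ≤ √(4 * x) := Real.one_le_sqrt.2 (by linarith)
    nlinarith
  rw [h4] at hup
  nlinarith [mul_le_mul_of_nonneg_left hl hs0]

theorem sum_primesBetween (y z : ℝ) (f : ℕ → ℝ) : ∑ p ∈ primesBetween y z, f (p : ℕ) =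
    ∑ n ∈ ((Finset.range ⌈z⌉₊).filter (fun n : ℕ => y < (n : ℝ))).filter Nat.Prime, f n :=
  Finset.sum_subtype_eq_sum_filter _

/-- The variance is large when `(y, z)` contains a multiplicative neighbourhood of `e ^ {1/σ}`. -/
theorem exists_one_le_primeVariance : ∃ σ₀ : ℝ, 0 < σ₀ ∧ ∀ σ y z : ℝ, 0 < σ → σ ≤ σ₀ → 0 < y →
    0 < z → Real.log y * σ < 1 → 3 < Real.log z * σ → 1 ≤ primeVariance y z (1 / 2 + σ) := by
  obtain ⟨X, hX⟩ := exists_theta_sub_ge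
  refine ⟨min (1 / 400) (1 / max X 1), by positivity, fun σ y z hσ hσ0 hy hz hyσ hzσ => ?_⟩
  have hσ1 : σ ≤ 1 / 400 := hσ0.trans (min_le_left _ _)
  have hσX : max X 1 ≤ 1 / σ := by
    rw [le_div_iff₀ hσ, mul_comm, ← le_div_iff₀ (by positivity)]
    exact hσ0.trans (min_le_right _ _)
  set T := Real.exp (1 / σ) with hT
  have hTX : X ≤ T := by
    have := Real.add_one_le_exp (1 / σ)
    linarith [le_max_left X 1]
  have hT0 : 0 < T := Real.exp_pos _
  have hth := hX T hTX
  have hyT : y < T := by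
    rw [← Real.log_lt_iff_lt_exp hy, lt_div_iff₀ hσ]; exact hyσ
  have h4 : Real.log 4 ≤ 2 := by
    rw [show (4 : ℝ) = 2 ^ 2 by norm_num, Real.log_pow]
    have := Real.log_two_lt_d9
    push_cast
    linarith
  have hinv : 400 ≤ 1 / σ := by
    rw [le_div_iff₀ hσ]; linarith
  have hTz : 4 * T < z := by
    rw [← Real.log_lt_log_iff (by positivity) hz, Real.log_mul (by norm_num) hT0.ne', hT,
      Real.log_exp]
    have : 3 / σ < Real.log z := by rw [div_lt_iff₀ hσ]; exact hzσ
    have e : 3 / σ = 3 * (1 / σ) := by ring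
    linarith
  -- The primes in (T, 4T], T = e^{1/σ}, suffice: there p^{2σ} is bounded and log p is about 1/σ.
  set B : Finset ℕ := (Finset.Ioc ⌊T⌋₊ ⌊4 * T⌋₊).filter Nat.Prime with hB
  have hBT : ∀ n ∈ B, T < n ∧ (n : ℝ) ≤ 4 * T := by
    intro n hn
    rw [hB, Finset.mem_filter, Finset.mem_Ioc] at hn
    exact ⟨(Nat.floor_lt hT0.le).1 hn.1.1, (Nat.le_floor_iff (by positivity)).1 hn.1.2⟩
  have hsub : B ⊆ ((Finset.range ⌈z⌉₊).filter (fun n : ℕ => y < (n : ℝ))).filter Nat.Prime := by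
    intro n hn
    obtain ⟨h1, h2⟩ := hBT n hn
    simp only [Finset.mem_filter, Finset.mem_range, Nat.lt_ceil]
    exact ⟨⟨by linarith, by linarith⟩, (Finset.mem_filter.1 hn).2⟩
  have htheta : Chebyshev.theta (4 * T) - Chebyshev.theta T = ∑ n ∈ B, Real.log n := by
    rw [Chebyshev.theta, Chebyshev.theta, sub_eq_iff_eq_add, hB, ← Finset.sum_union]
    · congr 1
      rw [← Finset.filter_union, Finset.union_comm, Finset.Ioc_union_Ioc_eq_Ioc (Nat.zero_le _)]
      exact Nat.floor_mono (by linarith)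
    · refine Finset.disjoint_filter_filter ?_
      rw [Finset.disjoint_left]
      intro n h1 h2
      rw [Finset.mem_Ioc] at h1 h2
      omega
  have hpow : ∀ n ∈ B, ((n : ℝ) ^ (1 / 2 + σ)) ^ 2 ≤ 400 * T := by
    intro n hn
    obtain ⟨h1, h2⟩ := hBT n hn
    have hn0 : (0 : ℝ) < n := hT0.trans h1
    have e : ((n : ℝ) ^ (1 / 2 + σ)) ^ 2 = n * (n : ℝ) ^ (2 * σ) := by
      rw [← Real.rpow_natCast, ← Real.rpow_mul hn0.le, ← Real.rpow_one_add' hn0.le (by positivity)]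
      congr 1
      push_cast
      ring
    have h3 : (n : ℝ) ^ (2 * σ) ≤ 81 := by
      rw [Real.rpow_def_of_pos hn0]
      have hlogn : Real.log n ≤ 2 + 1 / σ := by
        have := Real.log_le_log hn0 h2
        rw [Real.log_mul (by norm_num) hT0.ne', hT, Real.log_exp] at this
        linarith
      have h4 : Real.log n * (2 * σ) ≤ 4 := by
        have := mul_le_mul_of_nonneg_right hlogn (by positivity : 0 ≤ 2 * σ)
        have e2 : (2 + 1 / σ) * (2 * σ) = 4 * σ + 2 := by field_simp; ring
        rw [e2] at this
        linarith
      calc Real.exp (Real.log n * (2 * σ)) ≤ Real.exp 4 := Real.exp_le_exp.2 h4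
        _ = Real.exp 1 ^ 4 := by rw [← Real.exp_nat_mul]; norm_num
        _ ≤ 3 ^ 4 := by
          gcongr
          exact Real.exp_one_lt_d9.le.trans (by norm_num)
        _ = 81 := by norm_num
    rw [e]
    calc (n : ℝ) * (n : ℝ) ^ (2 * σ) ≤ 4 * T * 81 := by gcongr
      _ ≤ 400 * T := by linarith
  rw [primeVariance, sum_primesBetween y z fun n => (Real.log (n : ℝ) / (n : ℝ) ^ (1 / 2 + σ)) ^ 2]
  refine le_trans ?_ (Finset.sum_le_sum_of_subset_of_nonneg hsub fun _ _ _ => sq_nonneg _)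
  -- One factor log n ≥ 1/σ ≥ 400 pays for the constant in `hpow`; the other is kept to form the
  -- Chebyshev sum.
  have hterm : ∀ n ∈ B, Real.log n / T ≤ (Real.log (n : ℝ) / (n : ℝ) ^ (1 / 2 + σ)) ^ 2 := by
    intro n hn
    obtain ⟨h1, h2⟩ := hBT n hn
    have hn0 : (0 : ℝ) < n := hT0.trans h1
    have hlogn : 400 ≤ Real.log n := by
      have := Real.log_le_log hT0 h1.le
      rw [hT, Real.log_exp] at this
      linarith
    rw [div_pow, div_le_div_iff₀ hT0 (by positivity)]
    have := mul_le_mul_of_nonneg_left (hpow n hn) (by linarith : 0 ≤ Real.log n)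
    nlinarith [mul_le_mul_of_nonneg_right hlogn (by positivity : 0 ≤ Real.log n * T)]
  refine le_trans ?_ (Finset.sum_le_sum hterm)
  rw [← Finset.sum_div, ← htheta, le_div_iff₀ hT0]
  linarith

/-! ### Linear combinations of the prime sums -/

/-- The coefficient `(log p) / p ^ s`. -/
noncomputable def primeCoeff (s : ℝ) (p : Nat.Primes) : ℝ :=
  Real.log ((p : ℕ) : ℝ) / ((p : ℕ) : ℝ) ^ s

theorem primeCoeff_nonneg (s : ℝ) (p : Nat.Primes) : 0 ≤ primeCoeff s p :=
  div_nonneg (Real.log_natCast_nonneg _) (by positivity)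

theorem primeCoeff_le_one {s : ℝ} (hs : 1 / 2 ≤ s) (p : Nat.Primes) : primeCoeff s p ≤ 1 := by
  have hp : (1 : ℝ) ≤ ((p : ℕ) : ℝ) := by exact_mod_cast p.2.one_le
  rw [primeCoeff, div_le_one (by positivity)]
  refine le_trans ?_ (Real.rpow_le_rpow_of_exponent_le hp hs)
  rw [← Real.sqrt_eq_rpow]
  have h1 : Real.log ((p : ℕ) : ℝ) = 2 * Real.log √((p : ℕ) : ℝ) := by
    rw [Real.log_sqrt (by linarith)]; ring
  have h0 : 0 < √((p : ℕ) : ℝ) / 2 := by positivity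
  have h2 := Real.log_le_sub_one_of_pos h0
  rw [Real.log_div (by positivity) (by norm_num)] at h2
  have h3 := Real.log_two_lt_d9
  rw [h1]
  linarith

theorem primeSum_eq_linForm (y z s : ℝ) (ω : Nat.Primes → ℝ) :
    primeSum y z s ω = linForm (primesBetween y z) (primeCoeff s) ω := by
  refine Finset.sum_congr rfl fun p _ => ?_
  rw [primeCoeff, mul_div_assoc, mul_comm]

theorem card_primesBetween_le (y : ℝ) {z : ℝ} (hz : 1 ≤ z) :
    ((primesBetween y z).card : ℝ) ≤ 2 * z := by
  have h1 : (primesBetween y z).card ≤ ⌈z⌉₊ := by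
    refine (le_of_eq (Finset.card_subtype Nat.Prime _)).trans ?_
    refine (Finset.card_filter_le _ _).trans ((Finset.card_filter_le _ _).trans ?_)
    rw [Finset.card_range]
  have h2 : (⌈z⌉₊ : ℝ) < z + 1 := Nat.ceil_lt_add_one (by linarith)
  have h3 : ((primesBetween y z).card : ℝ) ≤ ⌈z⌉₊ := by exact_mod_cast h1
  linarith

section

variable {J : ℕ} (s u v : Fin J → ℝ)

/-- All primes occurring in one of the sums. -/
noncomputable def allPrimes : Finset Nat.Primes :=
  Finset.univ.biUnion fun j => primesBetween (u j) (v j)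

/-- The coefficient of `ω_p` in the combination of the prime sums with weights `t`. -/
noncomputable def combCoeff (t : Fin J → ℝ) (p : Nat.Primes) : ℝ :=
  ∑ j, if p ∈ primesBetween (u j) (v j) then t j * primeCoeff (s j) p else 0

theorem sum_mul_primeSumVec (t : Fin J → ℝ) (ω : Nat.Primes → ℝ) :
    ∑ j, t j * primeSumVec s u v ω j = linForm (allPrimes u v) (combCoeff s u v t) ω := by
  simp only [primeSumVec, primeSum_eq_linForm, linForm, combCoeff, Finset.sum_mul]
  rw [Finset.sum_comm]
  refine Finset.sum_congr rfl fun j _ => ?_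
  have hsub : primesBetween (u j) (v j) ⊆ allPrimes u v :=
    Finset.subset_biUnion_of_mem (fun j => primesBetween (u j) (v j)) (Finset.mem_univ j)
  rw [Finset.mul_sum, ← Finset.sum_subset hsub]
  · refine Finset.sum_congr rfl fun p hp => ?_
    rw [if_pos hp, mul_assoc]
  · intro p _ hp
    rw [if_neg hp, zero_mul]

/-- Cauchy–Schwarz over j at each prime; the factor J allows the prime ranges to overlap. -/
theorem sum_combCoeff_sq_le (t : Fin J → ℝ) :
    ∑ p ∈ allPrimes u v, combCoeff s u v t p ^ 2 ≤
      J * ∑ j, t j ^ 2 * primeVariance (u j) (v j) (s j) := by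
  have h1 : ∀ p, combCoeff s u v t p ^ 2 ≤ J * ∑ j, (if p ∈ primesBetween (u j) (v j) then
      t j ^ 2 * primeCoeff (s j) p ^ 2 else 0) := by
    intro p
    refine (sq_sum_le_card_mul_sum_sq (s := Finset.univ)).trans (le_of_eq ?_)
    rw [Finset.card_univ, Fintype.card_fin]
    congr 1
    refine Finset.sum_congr rfl fun j _ => ?_
    split_ifs <;> ring
  refine (Finset.sum_le_sum fun p _ => h1 p).trans ?_
  rw [← Finset.mul_sum, Finset.sum_comm]
  refine mul_le_mul_of_nonneg_left (Finset.sum_le_sum fun j _ => ?_) (Nat.cast_nonneg _)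
  rw [← Finset.sum_filter, primeVariance, Finset.mul_sum]
  refine Finset.sum_le_sum_of_subset_of_nonneg (fun p hp => (Finset.mem_filter.1 hp).2) ?_
  intro p _ _
  positivity

/-- Trivial bound: each range has at most 2B primes, each below B and with coefficient at most 1. -/
theorem sum_abs_combCoeff_mul_le (t : Fin J → ℝ) (hs : ∀ j, 1 / 2 ≤ s j) {B : ℝ} (hB : 1 ≤ B)
    (hv : ∀ j, v j ≤ B) : ∑ p ∈ allPrimes u v, |combCoeff s u v t p| * ((p : ℕ) : ℝ) ≤
      (∑ j, |t j|) * (2 * B ^ 2) := by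
  have h1 : ∀ p, |combCoeff s u v t p| * ((p : ℕ) : ℝ) ≤
      ∑ j, (if p ∈ primesBetween (u j) (v j) then |t j| * B else 0) := by
    intro p
    have h0 : (0 : ℝ) ≤ ((p : ℕ) : ℝ) := Nat.cast_nonneg _
    refine (mul_le_mul_of_nonneg_right (Finset.abs_sum_le_sum_abs _ _) h0).trans ?_
    rw [Finset.sum_mul]
    refine Finset.sum_le_sum fun j _ => ?_
    split_ifs with hp
    · rw [abs_mul, abs_of_nonneg (primeCoeff_nonneg _ _), mul_assoc]
      refine mul_le_mul_of_nonneg_left ?_ (abs_nonneg _)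
      have hpv := (mem_primesBetween.1 hp).2
      calc _ ≤ 1 * B := mul_le_mul (primeCoeff_le_one (hs j) p) (hpv.le.trans (hv j)) h0 zero_le_one
        _ = B := one_mul B
    · simp
  refine (Finset.sum_le_sum fun p _ => h1 p).trans ?_
  rw [Finset.sum_comm, Finset.sum_mul]
  refine Finset.sum_le_sum fun j _ => ?_
  rw [← Finset.sum_filter, Finset.sum_const, nsmul_eq_mul]
  have hcard : (((allPrimes u v).filter fun p => p ∈ primesBetween (u j) (v j)).card : ℝ) ≤
      2 * B := by
    refine le_trans ?_ (card_primesBetween_le (u j) hB)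
    refine Nat.cast_le.2 (Finset.card_le_card fun p hp => ?_)
    have := mem_primesBetween.1 (Finset.mem_filter.1 hp).2
    exact mem_primesBetween.2 ⟨this.1, this.2.trans_le (hv j)⟩
  calc _ ≤ 2 * B * (|t j| * B) := by gcongr
    _ = _ := by ring

theorem abs_primeSumVec_le {ω : Nat.Primes → ℝ} (hω : ∀ p, |ω p| ≤ 1) (hs : ∀ j, 1 / 2 ≤ s j) {B : ℝ}
    (hB : 1 ≤ B) (hv : ∀ j, v j ≤ B) (j : Fin J) : |primeSumVec s u v ω j| ≤ 2 * B := by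
  rw [primeSumVec, primeSum_eq_linForm]
  refine (abs_linForm_le hω).trans ?_
  have h1 : ∀ p ∈ primesBetween (u j) (v j), |primeCoeff (s j) p| ≤ 1 := fun p _ => by
    rw [abs_of_nonneg (primeCoeff_nonneg _ _)]
    exact primeCoeff_le_one (hs j) p
  refine (Finset.sum_le_card_nsmul _ _ _ h1).trans ?_
  rw [nsmul_eq_mul, mul_one]
  refine le_trans ?_ (card_primesBetween_le (u j) hB)
  refine Nat.cast_le.2 (Finset.card_le_card fun p hp => ?_)
  have := mem_primesBetween.1 hp
  exact mem_primesBetween.2 ⟨this.1, this.2.trans_le (hv j)⟩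

theorem measurable_primeSumVec : Measurable (primeSumVec s u v) := by
  refine measurable_pi_lambda _ fun j => ?_
  have : (fun ω => primeSumVec s u v ω j) =
      linForm (primesBetween (u j) (v j)) (primeCoeff (s j)) :=
    funext fun ω => primeSum_eq_linForm _ _ _ ω
  rw [this]
  exact measurable_linForm _ _

/-- The characteristic function of one prime sum in the random model. -/
theorem norm_integral_exp_primeSumVec_le (j : Fin J) {t : ℝ}
    (ht : ∀ p ∈ primesBetween (u j) (v j), |t| * primeCoeff (s j) p ≤ 1) :
    ‖∫ ω, Complex.exp (Complex.I * ((t * primeSumVec s u v ω j : ℝ) : ℂ)) ∂randomModel‖ ≤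
      Real.exp (-(t ^ 2 * primeVariance (u j) (v j) (s j)) / 10) := by
  have h1 : ∀ ω, t * primeSumVec s u v ω j =
      linForm (primesBetween (u j) (v j)) (fun p => t * primeCoeff (s j) p) ω := by
    intro ω
    rw [primeSumVec, primeSum_eq_linForm, linForm, linForm, Finset.mul_sum]
    simp only [mul_assoc]
  simp only [h1]
  refine (norm_integral_exp_linForm_randomModel_le _ _ fun p hp => ?_).trans (le_of_eq ?_)
  · rw [abs_mul, abs_of_nonneg (primeCoeff_nonneg _ _)]
    exact ht p hp
  · simp only [mul_pow, ← Finset.mul_sum]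
    rfl

end

/-- From (|m|ρ - 5)² ≥ 0 the Gaussian is at most e^{5/2} e^{-ρ|m|}, with e^{5/2} ≤ 13, and each of
the two geometric series is at most 1 + 1/ρ. -/
theorem sum_exp_neg_sq_le {ρ : ℝ} (hρ : 0 < ρ) (N : ℕ) :
    ∑ m ∈ Finset.Icc (-N : ℤ) N, Real.exp (-((m * ρ) ^ 2) / 10) ≤ 26 * (1 + 1 / ρ) := by
  have hpt : ∀ m : ℤ, Real.exp (-((m * ρ) ^ 2) / 10) ≤ 13 * Real.exp (-ρ) ^ m.natAbs := by
    intro m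
    have hm : |(m : ℝ)| = (m.natAbs : ℝ) := by rw [Nat.cast_natAbs, Int.cast_abs]
    have h13 : Real.exp (5 / 2) ≤ 13 := by
      have h1 : Real.exp (5 / 2) ^ 2 = Real.exp 1 ^ 5 := by
        rw [← Real.exp_nat_mul, ← Real.exp_nat_mul]; norm_num
      have h2 : Real.exp 1 ^ 5 ≤ 2.72 ^ 5 := by
        gcongr
        exact Real.exp_one_lt_d9.le.trans (by norm_num)
      nlinarith [Real.exp_pos (5 / 2)]
    refine le_trans ?_ (mul_le_mul_of_nonneg_right h13 (by positivity))
    rw [← Real.exp_nat_mul, ← Real.exp_add, Real.exp_le_exp, ← hm, mul_pow, ← sq_abs (m : ℝ)]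
    nlinarith [sq_nonneg (|(m : ℝ)| * ρ - 5)]
  have hr0 : 0 < Real.exp (-ρ) := Real.exp_pos _
  have hr1 : Real.exp (-ρ) < 1 := by rw [Real.exp_lt_one_iff]; linarith
  have hgeom : ∀ n : ℕ, ∑ k ∈ Finset.range n, Real.exp (-ρ) ^ k ≤ 1 + 1 / ρ := by
    intro n
    have h1 := (hasSum_geometric_of_lt_one hr0.le hr1)
    refine (h1.summable.sum_le_tsum _ fun k _ => by positivity).trans ?_
    rw [h1.tsum_eq, inv_le_comm₀ (by linarith) (by positivity)]
    have h2 : Real.exp (-ρ) * (1 + ρ) ≤ 1 := by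
      have h3 := Real.add_one_le_exp ρ
      calc _ ≤ Real.exp (-ρ) * Real.exp ρ := by gcongr; linarith
        _ = 1 := by rw [← Real.exp_add]; simp
    have e : (1 + 1 / ρ)⁻¹ = ρ / (1 + ρ) := by field_simp; ring
    rw [e, div_le_iff₀ (by linarith)]
    linarith
  refine (Finset.sum_le_sum fun m _ => hpt m).trans ?_
  rw [← Finset.mul_sum]
  have hsub : Finset.Icc (-N : ℤ) N ⊆ (Finset.range (N + 1)).image (fun k : ℕ => (k : ℤ)) ∪
      (Finset.range (N + 1)).image (fun k : ℕ => -(k : ℤ)) := by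
    intro m hm
    rw [Finset.mem_Icc] at hm
    simp only [Finset.mem_union, Finset.mem_image, Finset.mem_range]
    rcases le_total 0 m with h | h
    · exact Or.inl ⟨m.toNat, by omega, by omega⟩
    · exact Or.inr ⟨(-m).toNat, by omega, by omega⟩
  have h2 : ∑ m ∈ Finset.Icc (-N : ℤ) N, Real.exp (-ρ) ^ m.natAbs ≤ 2 * (1 + 1 / ρ) := by
    refine (Finset.sum_le_sum_of_subset_of_nonneg hsub fun _ _ _ => by positivity).trans ?_
    have hinter : 0 ≤ ∑ m ∈ (Finset.range (N + 1)).image (fun k : ℕ => (k : ℤ)) ∩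
        (Finset.range (N + 1)).image (fun k : ℕ => -(k : ℤ)), Real.exp (-ρ) ^ m.natAbs :=
      Finset.sum_nonneg fun _ _ => by positivity
    refine (le_add_of_nonneg_right hinter).trans ?_
    rw [Finset.sum_union_inter, Finset.sum_image (by intro a _ b _ h; simpa using h),
      Finset.sum_image (by intro a _ b _ h; simpa using h)]
    simp only [Int.natAbs_natCast, Int.natAbs_neg]
    linarith [hgeom (N + 1)]
  linarith

/-! ### Comparison of the two models for a fixed cutoff -/

open Classical in
theorem charProportion_eq_measureReal (x : ℝ) {J : ℕ} (s u v : Fin J → ℝ)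
    {R : Set (Fin J → ℝ)} (hR : MeasurableSet R) :
    charProportion x s u v R = (discriminantLaw x).real {ω | primeSumVec s u v ω ∈ R} := by
  have hm : MeasurableSet {ω | primeSumVec s u v ω ∈ R} := measurable_primeSumVec s u v hR
  rw [← integral_indicator_one hm, integral_discriminantLaw, charProportion, smul_eq_mul,
    div_eq_inv_mul, Finset.card_filter]
  congr 1
  push_cast
  refine Finset.sum_congr rfl fun D _ => ?_
  simp [Set.indicator_apply]

/-- Comparison of characteristic functions of the two models. -/
theorem norm_integral_exp_sum_sub_le {J : ℕ} (s u v t : Fin J → ℝ) {x B δ W S : ℝ}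
    (hμ : IsProbabilityMeasure (discriminantLaw x)) (hδ0 : 0 ≤ δ)
    (hδ : ∀ (m : ℕ) (q : Fin m → Nat.Primes), (∀ i, (q i : ℕ) ≠ 2) →
      |∫ ω, ∏ i, ω (q i) ∂(discriminantLaw x) - ∫ ω, ∏ i, ω (q i) ∂randomModel| ≤
        δ * ∏ i, ((q i : ℕ) : ℝ))
    (hs : ∀ j, 1 / 2 ≤ s j) (hu : ∀ j, 2 ≤ u j) (hB : 1 ≤ B) (hv : ∀ j, v j ≤ B)
    (hW1 : 1 ≤ W) (hW : (∑ j, |t j|) * (2 * B ^ 2) ≤ W)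
    (hS : J * ∑ j, t j ^ 2 * primeVariance (u j) (v j) (s j) ≤ S) (K : ℕ) :
    ‖∫ ω, Complex.exp (Complex.I * ((∑ j, t j * primeSumVec s u v ω j : ℝ) : ℂ))
        ∂(discriminantLaw x) -
      ∫ ω, Complex.exp (Complex.I * ((∑ j, t j * primeSumVec s u v ω j : ℝ) : ℂ)) ∂randomModel‖ ≤
      4 * Real.exp (4 * S - 2 * K) + 4 * δ * W ^ (2 * K) := by
  simp only [sum_mul_primeSumVec]
  have hP : ∀ p ∈ allPrimes u v, (p : ℕ) ≠ 2 := by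
    intro p hp h2
    obtain ⟨j, _, hj⟩ := Finset.mem_biUnion.1 hp
    have h3 := (mem_primesBetween.1 hj).1
    rw [h2] at h3
    push_cast at h3
    linarith [hu j]
  refine (norm_integral_exp_linForm_sub_le (ae_discriminantLaw abs_charValues_le_one)
    ae_randomModel hδ0 (combCoeff s u v t)
    ((sum_abs_combCoeff_mul_le s u v t hs hB hv).trans hW) hW1
    (fun m q hq => hδ m q fun i => hP _ (hq i)) K).trans ?_
  have h1 := integral_linForm_pow_div_factorial_le (allPrimes u v) (combCoeff s u v t) K
  have h2 := (sum_combCoeff_sq_le s u v t).trans hS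
  have h3 : Real.exp (4 * ∑ p ∈ allPrimes u v, combCoeff s u v t p ^ 2 - 2 * K) ≤
      Real.exp (4 * S - 2 * K) := Real.exp_le_exp.2 (by linarith)
  linarith

/-- The discrepancy for the box `R`, in terms of explicit parameters. -/
theorem abs_charProportion_sub_le {J : ℕ} (s u v : Fin J → ℝ) {x B δ Q η : ℝ} {N K : ℕ}
    (hμ : IsProbabilityMeasure (discriminantLaw x)) (hδ0 : 0 ≤ δ)
    (hδ : ∀ (m : ℕ) (q : Fin m → Nat.Primes), (∀ i, (q i : ℕ) ≠ 2) →
      |∫ ω, ∏ i, ω (q i) ∂(discriminantLaw x) - ∫ ω, ∏ i, ω (q i) ∂randomModel| ≤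
        δ * ∏ i, ((q i : ℕ) : ℝ))
    (hJ : 1 ≤ J)
    (hs : ∀ j, 1 / 2 ≤ s j) (hu : ∀ j, 2 ≤ u j) (hB : 1 ≤ B) (hv : ∀ j, v j ≤ B)
    (hV : ∀ j, 1 ≤ primeVariance (u j) (v j) (s j)) (hQ : 1 ≤ Q)
    (hQp : ∀ j, ∀ p ∈ primesBetween (u j) (v j), Q * primeCoeff (s j) p ≤ 1)
    (hN : 2 ≤ N) (hNQ : 2 * Q * B ≤ N)
    (hη : 4 * Real.exp (16 * J ^ 2 * Q ^ 2 - 2 * K) + 4 * δ * (4 * J * Q * B ^ 2) ^ (2 * K) ≤ η)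
    {R : Set (Fin J → ℝ)} (hR : IsBox R) :
    |charProportion x s u v R - randomProb s u v R| ≤
      400000000 * (J * (52 / Q + η)) + (32 * N) ^ J * η := by
  obtain ⟨I, hI, rfl⟩ := hR
  have hN0 : (0 : ℝ) < N := by exact_mod_cast (by omega : 0 < N)
  have hJ1 : (1 : ℝ) ≤ J := by exact_mod_cast hJ
  set V : Fin J → ℝ := fun j => primeVariance (u j) (v j) (s j) with hVdef
  have hV0 : ∀ j, 0 < √(V j) := fun j => Real.sqrt_pos.2 (by linarith [hV j])
  have hV1 : ∀ j, 1 ≤ √(V j) := fun j => Real.one_le_sqrt.2 (hV j)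
  -- With this scale `l j ^ 2 * V j = (Q / N) ^ 2` for every j, so frequencies up to N probe the
  -- normalised sum up to Q. The bound V_j ≥ 1 keeps m l_j at most Q for |m| ≤ N.
  set l : Fin J → ℝ := fun j => Q / (√(V j) * N) with hl
  have hl0 : ∀ j, 0 < l j := fun j => by have := hV0 j; positivity
  have hlN : ∀ j, l j * N ≤ Q := fun j => by
    have := hV0 j
    have e : l j * N = Q / √(V j) := by simp only [hl]; field_simp
    rw [e]
    exact div_le_self (by linarith) (hV1 j)
  have hlV : ∀ j, l j ^ 2 * V j = (Q / N) ^ 2 := fun j => by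
    have h2 : √(V j) ^ 2 = V j := Real.sq_sqrt (by linarith [hV j])
    have := hV0 j
    simp only [hl]
    rw [div_pow, mul_pow, h2]
    have : V j ≠ 0 := by linarith [hV j]
    field_simp
  set X : (Nat.Primes → ℝ) → Fin J → ℝ := fun ω j => l j * primeSumVec s u v ω j with hX
  have hXm : Measurable X :=
    measurable_pi_lambda _ fun j => ((measurable_pi_iff.1 (measurable_primeSumVec s u v)) j).const_mul _
  have hR : MeasurableSet (Set.univ.pi I) := MeasurableSet.univ_pi fun j => (hI j).measurableSet
  set I' : Fin J → Set ℝ := fun j => (fun y => y / l j) ⁻¹' I j with hI'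
  have hI'o : ∀ j, (I' j).OrdConnected := fun j => (hI j).preimage_mono
    fun a b hab => div_le_div_of_nonneg_right hab (hl0 j).le
  have hR' : MeasurableSet (Set.univ.pi I') := MeasurableSet.univ_pi fun j => (hI'o j).measurableSet
  have hpre : X ⁻¹' (Set.univ.pi I') = {ω | primeSumVec s u v ω ∈ Set.univ.pi I} := by
    ext ω
    simp only [Set.mem_preimage, Set.mem_pi, Set.mem_univ, true_implies, hI', hX, Set.mem_ofPred_eq]
    refine forall_congr' fun j => ?_
    rw [mul_div_cancel_left₀ _ (hl0 j).ne']
  rw [charProportion_eq_measureReal x s u v hR, randomProb, ← hpre,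
    ← map_measureReal_apply hXm hR', ← map_measureReal_apply hXm hR']
  have p1 : IsProbabilityMeasure ((discriminantLaw x).map X) :=
    Measure.isProbabilityMeasure_map hXm.aemeasurable
  have p2 : IsProbabilityMeasure (randomModel.map X) :=
    Measure.isProbabilityMeasure_map hXm.aemeasurable
  have hbox : MeasurableSet {y : Fin J → ℝ | ∀ j, |y j| ≤ Real.pi / 2} := by
    rw [Set.ofPred_forall]
    exact MeasurableSet.iInter fun j => measurableSet_le (measurable_pi_apply j).abs measurable_const
  have hXb : ∀ ω : Nat.Primes → ℝ, (∀ p, |ω p| ≤ 1) → ∀ j, |X ω j| ≤ Real.pi / 2 := by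
    intro ω hω j
    have h1 := abs_primeSumVec_le s u v hω hs hB hv j
    have h2 : |X ω j| ≤ l j * (2 * B) := by
      simp only [hX]
      rw [abs_mul, abs_of_pos (hl0 j)]
      exact mul_le_mul_of_nonneg_left h1 (hl0 j).le
    -- This is why N ≥ 2QB is required: the rescaled sums must avoid the wrap-around of the periodic
    -- kernel.
    have h3 : l j * (2 * B) ≤ 1 := by
      have h4 : Q * (l j * (2 * B)) ≤ Q * 1 := by
        calc _ = l j * (2 * Q * B) := by ring
          _ ≤ l j * N := mul_le_mul_of_nonneg_left hNQ (hl0 j).le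
          _ ≤ _ := by linarith [hlN j]
      exact le_of_mul_le_mul_left h4 (by linarith)
    linarith [Real.pi_gt_three]
  have hmap : ∀ (μ : Measure (Nat.Primes → ℝ)) (t : Fin J → ℝ),
      ∫ y, Complex.exp (Complex.I * ((∑ j, t j * y j : ℝ) : ℂ)) ∂(μ.map X) =
        ∫ ω, Complex.exp (Complex.I * ((∑ j, t j * l j * primeSumVec s u v ω j : ℝ) : ℂ)) ∂μ := by
    intro μ t
    rw [integral_map hXm.aemeasurable (Measurable.aestronglyMeasurable (by fun_prop))]
    simp only [hX, mul_assoc]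
  have main := abs_measureReal_box_sub_le (μ := (discriminantLaw x).map X)
    (ν := randomModel.map X) (N := N) hN (η := η) (κ := 26 * (1 + 1 / (Q / N)))
    ((ae_map_iff hXm.aemeasurable hbox).2 (ae_discriminantLaw fun D =>
      hXb _ (abs_charValues_le_one D)))
    ((ae_map_iff hXm.aemeasurable hbox).2 (ae_randomModel.mono hXb)) ?_ ?_ hI'o
  · refine main.trans ?_
    have hη0 : 0 ≤ η := le_trans (by positivity) hη
    have hQN : Q ≤ N := by nlinarith
    have h1 : 26 * (1 + 1 / (Q / N)) / N ≤ 52 / Q := by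
      rw [div_le_div_iff₀ hN0 (by linarith)]
      have : 26 * (1 + 1 / (Q / N)) * Q = 26 * (Q + N) := by field_simp
      rw [this]
      linarith
    gcongr
  · intro m hm
    rw [hmap, hmap]
    refine le_trans ?_ hη
    have hml : ∀ j, |(m j : ℝ) * l j| ≤ 2 * Q := fun j => by
      have h1 : |(m j : ℝ)| ≤ 2 * N := by exact_mod_cast hm j
      rw [abs_mul, abs_of_pos (hl0 j)]
      calc _ ≤ 2 * N * l j := mul_le_mul_of_nonneg_right h1 (hl0 j).le
        _ ≤ _ := by linarith [hlN j]
    have := norm_integral_exp_sum_sub_le s u v (fun j => m j * l j) (S := 4 * J ^ 2 * Q ^ 2)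
      (W := 4 * J * Q * B ^ 2) hμ hδ0 hδ hs hu hB hv ?_ ?_ ?_ K
    · refine this.trans (le_of_eq ?_)
      congr 3
      ring
    · have : 1 ≤ B ^ 2 := one_le_pow₀ hB
      have h2 : 1 ≤ J * Q := one_le_mul_of_one_le_of_one_le hJ1 hQ
      nlinarith
    · have h1 := Finset.sum_le_sum fun j (_ : j ∈ Finset.univ) => hml j
      rw [Finset.sum_const, Finset.card_univ, Fintype.card_fin, nsmul_eq_mul] at h1
      calc _ ≤ (J * (2 * Q)) * (2 * B ^ 2) := by gcongr
        _ = _ := by ring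
    · have h1 : ∀ j ∈ Finset.univ, ((m j : ℝ) * l j) ^ 2 * V j ≤ 4 * Q ^ 2 := by
        intro j _
        have h1 : |(m j : ℝ)| ≤ 2 * N := by exact_mod_cast hm j
        have h2 : (m j : ℝ) ^ 2 ≤ (2 * N) ^ 2 := sq_le_sq' (abs_le.1 h1).1 (abs_le.1 h1).2
        rw [mul_pow, mul_assoc, hlV]
        calc _ ≤ (2 * (N : ℝ)) ^ 2 * (Q / N) ^ 2 := by gcongr
          _ = _ := by field_simp; norm_num
      have h2 := Finset.sum_le_sum h1
      rw [Finset.sum_const, Finset.card_univ, Fintype.card_fin, nsmul_eq_mul] at h2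
      calc _ ≤ (J : ℝ) * (J * (4 * Q ^ 2)) := by gcongr
        _ = _ := by ring
  · intro j
    refine le_trans (Finset.sum_le_sum fun m hm => ?_)
      (sum_exp_neg_sq_le (ρ := Q / N) (by positivity) N)
    rw [Finset.mem_Icc] at hm
    rw [integral_map hXm.aemeasurable (Measurable.aestronglyMeasurable (by fun_prop))]
    have h1 : |(m : ℝ)| ≤ N := by
      rw [abs_le]
      exact ⟨by exact_mod_cast hm.1, by exact_mod_cast hm.2⟩
    have := norm_integral_exp_primeSumVec_le s u v j (t := m * l j) fun p hp => by
      have h2 : |(m : ℝ) * l j| ≤ Q := by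
        rw [abs_mul, abs_of_pos (hl0 j)]
        calc _ ≤ N * l j := mul_le_mul_of_nonneg_right h1 (hl0 j).le
          _ ≤ _ := by linarith [hlN j]
      exact (mul_le_mul_of_nonneg_right h2 (primeCoeff_nonneg _ _)).trans (hQp j p hp)
    simp only [hX, ← mul_assoc]
    refine this.trans (le_of_eq ?_)
    rw [mul_pow, mul_assoc, hlV j, mul_pow]

/-! ### Choice of parameters -/

/-- The error in the comparison of characteristic functions. -/
theorem charFun_error_le {w C : ℝ} {J K : ℕ} (hw : 16 ≤ w) (hC : 0 < C) (hCw : 4 * C ≤ w)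
    (hJw : (J : ℝ) ≤ w) (hK : w ^ 5 ≤ K) (hK' : K ≤ w ^ 5 + 1) (hJ : 1 ≤ J) :
    4 * Real.exp (16 * J ^ 2 * w ^ 2 - 2 * K) +
      4 * (C / Real.exp (w ^ 10 / 2)) * (4 * J * w * Real.exp (w ^ 2) ^ 2) ^ (2 * K) ≤
        5 * Real.exp (-w ^ 5) := by
  have hw0 : 0 < w := by linarith
  have h2 : 256 ≤ w ^ 2 := by nlinarith
  have hJ1 : (1 : ℝ) ≤ J := by exact_mod_cast hJ
  have hfirst : Real.exp (16 * J ^ 2 * w ^ 2 - 2 * K) ≤ Real.exp (-w ^ 5) := by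
    rw [Real.exp_le_exp]
    have h3 : (J : ℝ) ^ 2 * w ^ 2 ≤ w ^ 2 * w ^ 2 := by gcongr
    have h4 : 16 * w ^ 4 ≤ w * w ^ 4 := by gcongr
    nlinarith
  have hW : 4 * J * w * Real.exp (w ^ 2) ^ 2 ≤ Real.exp (3 * w ^ 2) := by
    have h3 : 4 * J * w ≤ Real.exp (w ^ 2) := by
      have h4 := Real.quadratic_le_exp_of_nonneg (sq_nonneg w)
      nlinarith
    calc _ ≤ Real.exp (w ^ 2) * Real.exp (w ^ 2) ^ 2 := by gcongr
      _ = _ := by rw [← Real.exp_nat_mul, ← Real.exp_add]; congr 1; push_cast; ring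
  have hpow : (4 * J * w * Real.exp (w ^ 2) ^ 2) ^ (2 * K) ≤
      Real.exp (6 * w ^ 7 + 6 * w ^ 2) := by
    calc _ ≤ Real.exp (3 * w ^ 2) ^ (2 * K) := by gcongr
      _ = Real.exp (2 * K * (3 * w ^ 2)) := by rw [← Real.exp_nat_mul]; push_cast; rfl
      _ ≤ _ := by
        rw [Real.exp_le_exp]
        calc _ ≤ 2 * (w ^ 5 + 1) * (3 * w ^ 2) := by gcongr
          _ = _ := by ring
  -- The saving w^10/2 from √x dominates the cost 6w^7 + 6w² of the moments.
  have hsecond : 4 * (C / Real.exp (w ^ 10 / 2)) *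
      (4 * J * w * Real.exp (w ^ 2) ^ 2) ^ (2 * K) ≤ Real.exp (-w ^ 5) := by
    have hCe : 4 * C ≤ Real.exp w := by linarith [Real.add_one_le_exp w]
    calc _ ≤ 4 * (C / Real.exp (w ^ 10 / 2)) * Real.exp (6 * w ^ 7 + 6 * w ^ 2) := by gcongr
      _ = 4 * C * Real.exp (-(w ^ 10 / 2)) * Real.exp (6 * w ^ 7 + 6 * w ^ 2) := by
        rw [Real.exp_neg]; ring
      _ ≤ Real.exp w * Real.exp (-(w ^ 10 / 2)) * Real.exp (6 * w ^ 7 + 6 * w ^ 2) := by gcongr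
      _ = Real.exp (w + -(w ^ 10 / 2) + (6 * w ^ 7 + 6 * w ^ 2)) := by
        rw [Real.exp_add (w + _), Real.exp_add w]
      _ ≤ _ := by
        rw [Real.exp_le_exp]
        have h3 : 4096 ≤ w ^ 3 := by
          calc (4096 : ℝ) = 16 ^ 3 := by norm_num
            _ ≤ _ := by gcongr
        have h7 : 4096 * w ^ 7 ≤ w ^ 10 := by
          calc _ ≤ w ^ 3 * w ^ 7 := by gcongr
            _ = _ := by ring
        have h1 : w ≤ w ^ 7 := le_self_pow₀ (by linarith) (by norm_num)
        have h5 : w ^ 5 ≤ w ^ 7 := pow_le_pow_right₀ (by linarith) (by norm_num)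
        have h2 : w ^ 2 ≤ w ^ 7 := pow_le_pow_right₀ (by linarith) (by norm_num)
        linarith
  linarith

/-- The total error. -/
theorem box_error_le {w : ℝ} {J N : ℕ} (hw : 4000000000 ≤ w) (hJw : (J : ℝ) ≤ w) (hJ : 1 ≤ J)
    (hN : N ≤ 3 * w * Real.exp (w ^ 2)) :
    400000000 * (J * (52 / w + 5 * Real.exp (-w ^ 5))) + (32 * N) ^ J * (5 * Real.exp (-w ^ 5)) ≤
      (400000000 * 52 + 2) * (J / w) := by
  have hw0 : 0 < w := by linarith
  have hJ1 : (1 : ℝ) ≤ J := by exact_mod_cast hJ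
  have hq := Real.quadratic_le_exp_of_nonneg hw0.le
  have hexp : 2000000000 * w ≤ Real.exp w := by nlinarith
  have h35 : 2 * w ^ 3 + w ≤ w ^ 5 := by
    have h1 : 16 ≤ w ^ 2 := by nlinarith
    have h2 : 16 * w ^ 3 ≤ w ^ 2 * w ^ 3 := by gcongr
    have h3 : w ≤ w ^ 3 := le_self_pow₀ (by linarith) (by norm_num)
    nlinarith
  have hw3 : 0 < w ^ 3 := by positivity
  have hinv : 2000000000 * Real.exp (-w) ≤ 1 / w := by
    rw [le_div_iff₀ hw0, Real.exp_neg]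
    calc _ = 2000000000 * w * (Real.exp w)⁻¹ := by ring
      _ ≤ Real.exp w * (Real.exp w)⁻¹ := by gcongr
      _ = 1 := mul_inv_cancel₀ (Real.exp_pos _).ne'
  have h1 : Real.exp (-w ^ 5) ≤ Real.exp (-w) := Real.exp_le_exp.2 (by linarith)
  have hNe : 32 * (N : ℝ) ≤ Real.exp (2 * w ^ 2) := by
    have h3 := Real.add_one_le_exp (w ^ 2)
    calc _ ≤ 32 * (3 * w * Real.exp (w ^ 2)) := by gcongr
      _ = 96 * w * Real.exp (w ^ 2) := by ring
      _ ≤ Real.exp (w ^ 2) * Real.exp (w ^ 2) := by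
        gcongr
        nlinarith
      _ = _ := by rw [← Real.exp_add]; congr 1; ring
  have hpow : (32 * (N : ℝ)) ^ J ≤ Real.exp (2 * w ^ 3) := by
    calc _ ≤ Real.exp (2 * w ^ 2) ^ J := by gcongr
      _ = Real.exp (J * (2 * w ^ 2)) := by rw [← Real.exp_nat_mul]
      _ ≤ _ := by
        rw [Real.exp_le_exp]
        calc _ ≤ w * (2 * w ^ 2) := by gcongr
          _ = _ := by ring
  have h2 : (32 * (N : ℝ)) ^ J * Real.exp (-w ^ 5) ≤ Real.exp (-w) := by
    calc _ ≤ Real.exp (2 * w ^ 3) * Real.exp (-w ^ 5) := by gcongr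
      _ = Real.exp (2 * w ^ 3 + -w ^ 5) := by rw [Real.exp_add]
      _ ≤ _ := Real.exp_le_exp.2 (by linarith)
  have h3 : 1 / w ≤ J / w := by gcongr
  have h4 : (J : ℝ) * (400000000 * (5 * Real.exp (-w ^ 5))) ≤ J * (1 / w) := by
    gcongr
    linarith
  have h5 := Real.exp_pos (-w)
  have e1 : (400000000 : ℝ) * (J * (52 / w + 5 * Real.exp (-w ^ 5))) =
      400000000 * 52 * (J / w) + J * (400000000 * (5 * Real.exp (-w ^ 5))) := by ring
  have e2 : (J : ℝ) * (1 / w) = J / w := by ring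
  rw [e1]
  linarith

/-- Bounding log P by (10/3)P^{3/10} leaves P^{1/5} ≥ w² of the denominator √P, enough to absorb
(10/3)w. -/
theorem mul_primeCoeff_le_one {w s y : ℝ} (hw : 4 ≤ w) (hs : 1 / 2 ≤ s) {p : Nat.Primes}
    (hy : w ^ 10 ≤ y) (hp : y < ((p : ℕ) : ℝ)) : w * primeCoeff s p ≤ 1 := by
  set P : ℝ := ((p : ℕ) : ℝ)
  have hP1 : (1 : ℝ) ≤ P := Nat.one_le_cast.2 p.2.one_le
  have hP0 : 0 < P := by linarith
  have hlog := Real.log_le_rpow_div hP0.le (ε := 3 / 10) (by norm_num)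
  have hs' : P ^ (1 / 2 : ℝ) ≤ P ^ s := Real.rpow_le_rpow_of_exponent_le hP1 hs
  have hw2 : w ^ 2 ≤ P ^ (1 / 5 : ℝ) := by
    have h1 : (w ^ 10) ^ (1 / 5 : ℝ) = w ^ 2 := by
      rw [← Real.rpow_natCast w 10, ← Real.rpow_mul (by linarith), ← Real.rpow_natCast w 2]
      norm_num
    rw [← h1]
    exact Real.rpow_le_rpow (by positivity) (hy.trans hp.le) (by norm_num)
  have hsplit : P ^ (1 / 2 : ℝ) = P ^ (3 / 10 : ℝ) * P ^ (1 / 5 : ℝ) := by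
    rw [← Real.rpow_add hP0]; norm_num
  have hP3 : 0 < P ^ (3 / 10 : ℝ) := Real.rpow_pos_of_pos hP0 _
  rw [primeCoeff, ← mul_div_assoc, div_le_one (by positivity)]
  refine le_trans ?_ hs'
  calc w * Real.log P ≤ w * (P ^ (3 / 10 : ℝ) / (3 / 10)) := by gcongr
    _ = P ^ (3 / 10 : ℝ) * (10 / 3 * w) := by ring
    _ ≤ P ^ (3 / 10 : ℝ) * P ^ (1 / 5 : ℝ) := by
      gcongr
      nlinarith
    _ = _ := hsplit.symm

/-- With w^10 = log x this converts J ≤ (log log x)² into J ≤ w. -/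
theorem log_pow_ten_sq_le {w : ℝ} (hw : 2560000 ≤ w) : Real.log (w ^ 10) ^ 2 ≤ w := by
  have hw0 : 0 < w := by linarith
  have h1 := Real.log_le_rpow_div hw0.le (ε := 1 / 4) (by norm_num)
  have h2 : (w ^ (1 / 4 : ℝ)) ^ 2 = √w := by
    rw [← Real.rpow_natCast, ← Real.rpow_mul hw0.le, Real.sqrt_eq_rpow]; norm_num
  have h0 : 0 ≤ Real.log w := Real.log_nonneg (by linarith)
  have h3 : Real.log w ^ 2 ≤ 16 * √w := by
    rw [← h2]
    calc _ ≤ (w ^ (1 / 4 : ℝ) / (1 / 4)) ^ 2 := by gcongr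
      _ = _ := by ring
  have h4 : 1600 ≤ √w := Real.le_sqrt_of_sq_le (by norm_num; linarith)
  have h5 := Real.mul_self_sqrt hw0.le
  rw [Real.log_pow]
  push_cast
  nlinarith

theorem mainTheorem9 :
    ∃ C : ℝ, 0 < C ∧
      ∀ (J : ℝ → ℕ) (s u v : (x : ℝ) → Fin (J x) → ℝ),
        (∀ᶠ x : ℝ in atTop, 0 < J x ∧ (J x : ℝ) ≤ Real.log (Real.log x) ^ 2) →
        (∀ᶠ x : ℝ in atTop, ∀ j : Fin (J x),
          Real.log x ^ (-(1 / 5) : ℝ) ≤ s x j - 1 / 2 ∧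
            s x j - 1 / 2 ≤ 1 / Real.log (Real.log x) ^ 2) →
        (∀ᶠ x : ℝ in atTop, ∀ j : Fin (J x),
          Real.log x ≤ u x j ∧ u x j < v x j ∧
            v x j < Real.exp (Real.log x ^ (1 / 5 : ℝ))) →
        (∀ ε : ℝ, 0 < ε → ∀ᶠ x : ℝ in atTop, ∀ j : Fin (J x),
          |Real.log (u x j) * (s x j - 1 / 2)| < ε) →
        (∀ M : ℝ, ∀ᶠ x : ℝ in atTop, ∀ j : Fin (J x),
          M < Real.log (v x j) * (s x j - 1 / 2)) →
        ∀ᶠ x : ℝ in atTop,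
          discrepancy x (s x) (u x) (v x) ≤ C * ((J x : ℝ) / Real.log x ^ (1 / 10 : ℝ)) := by
  obtain ⟨C, x₀, hC, hx₀, hmom⟩ := exists_moment_comparison
  obtain ⟨σ₀, hσ₀, hvar⟩ := exists_one_le_primeVariance
  refine ⟨400000000 * 52 + 2, by norm_num, fun J s u v h1 h2 h3 h4 h5 => ?_⟩
  have hlog : Tendsto (fun x : ℝ => Real.log x ^ (1 / 10 : ℝ)) atTop atTop :=
    (tendsto_rpow_atTop (by norm_num)).comp Real.tendsto_log_atTop
  have hloglog : Tendsto (fun x : ℝ => Real.log (Real.log x)) atTop atTop :=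
    Real.tendsto_log_atTop.comp Real.tendsto_log_atTop
  filter_upwards [h1, h2, h3, h4 1 one_pos, h5 3, eventually_ge_atTop x₀,
    hlog.eventually_ge_atTop (max 4000000000 (4 * C)),
    hloglog.eventually_ge_atTop (max 1 (1 / σ₀)),
    Real.tendsto_log_atTop.eventually_ge_atTop 2] with x h1 h2 h3 h4 h5 hx hw hll hl2
  obtain ⟨hJ, hJl⟩ := h1
  obtain ⟨hμ, hδ⟩ := hmom x hx
  set w := Real.log x ^ (1 / 10 : ℝ) with hwdef
  have hw1 : 4000000000 ≤ w := (le_max_left _ _).trans hw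
  have hCw : 4 * C ≤ w := (le_max_right _ _).trans hw
  have hx0 : 0 < x := hx₀.trans_le hx
  have hw10 : w ^ 10 = Real.log x := by
    rw [hwdef, ← Real.rpow_natCast, ← Real.rpow_mul (by linarith)]; norm_num
  have hw2 : Real.log x ^ (1 / 5 : ℝ) = w ^ 2 := by
    rw [hwdef, ← Real.rpow_natCast, ← Real.rpow_mul (by linarith)]; norm_num
  have hsqrt : √x = Real.exp (w ^ 10 / 2) := by
    rw [hw10, ← Real.log_sqrt hx0.le, Real.exp_log (Real.sqrt_pos.2 hx0)]
  have hJw : (J x : ℝ) ≤ w := by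
    refine hJl.trans ?_
    rw [← hw10]
    exact log_pow_ten_sq_le (by linarith)
  have hσ : ∀ j, 0 < s x j - 1 / 2 := fun j =>
    (Real.rpow_pos_of_pos (by linarith) _).trans_le (h2 j).1
  have hσ' : ∀ j, s x j - 1 / 2 ≤ σ₀ := fun j => by
    refine (h2 j).2.trans ?_
    have a1 := (le_max_left _ _).trans hll
    have a2 := (le_max_right _ _).trans hll
    rw [div_le_iff₀ hσ₀] at a2
    rw [div_le_iff₀ (by positivity)]
    nlinarith
  have hV : ∀ j, 1 ≤ primeVariance (u x j) (v x j) (s x j) := fun j => by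
    obtain ⟨b1, b2, -⟩ := h3 j
    have := hvar (s x j - 1 / 2) (u x j) (v x j) (hσ j) (hσ' j) (by linarith) (by linarith)
      (abs_lt.1 (h4 j)).2 (h5 j)
    rwa [add_sub_cancel] at this
  have hs : ∀ j, 1 / 2 ≤ s x j := fun j => by linarith [hσ j]
  have hB : 1 ≤ Real.exp (w ^ 2) := Real.one_le_exp (sq_nonneg w)
  have hwB : 4000000000 ≤ w * Real.exp (w ^ 2) := by nlinarith
  have hNle : 2 * w * Real.exp (w ^ 2) ≤ ⌈2 * w * Real.exp (w ^ 2)⌉₊ := Nat.le_ceil _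
  have : Nonempty {R : Set (Fin (J x) → ℝ) // IsBox R} :=
    ⟨⟨Set.univ, fun _ => Set.univ, fun _ => Set.ordConnected_univ, Set.pi_univ _ |>.symm⟩⟩
  refine ciSup_le fun R => ?_
  -- Q = w fixes the accuracy 1/w; B = e^{w²} bounds the primes; N is the least integer allowed by
  -- the wrap-around condition; K of size w^5 balances the Taylor remainder against the moment
  -- error.
  refine (abs_charProportion_sub_le (s x) (u x) (v x) (B := Real.exp (w ^ 2)) (δ := C / √x)
    (Q := w) (η := 5 * Real.exp (-w ^ 5)) (N := ⌈2 * w * Real.exp (w ^ 2)⌉₊) (K := ⌈w ^ 5⌉₊) hμ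
    (by positivity) hδ hJ hs (fun j => hl2.trans (h3 j).1) hB
    (fun j => hw2 ▸ (h3 j).2.2.le) hV (by linarith) (fun j p hp => ?_) ?_ hNle ?_ R.2).trans
    (box_error_le hw1 hJw hJ ?_)
  · exact mul_primeCoeff_le_one (by linarith) (hs j) (hw10.le.trans (h3 j).1)
      (mem_primesBetween.1 hp).1
  · exact_mod_cast (by linarith : (2 : ℝ) ≤ ⌈2 * w * Real.exp (w ^ 2)⌉₊)
  · rw [hsqrt]
    exact charFun_error_le (by linarith) hC hCw hJw (Nat.le_ceil _)
      (Nat.ceil_lt_add_one (by positivity)).le hJ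
  · have := Nat.ceil_lt_add_one (a := 2 * w * Real.exp (w ^ 2)) (by positivity)
    linarith
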